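/- Let $d\ge 3$ and write $(r,z)$ for the cylindrical coordinates of $x=(x',x_d)\in\mathbb R^{d}$, $r=|x'|$, $z=x_d$, with unit vectors $e^r=(x'/|x'|,0)$ and $e^z=(0,\dots,0,1)$. Let $s>1+d/2$, $T\in(0,\infty]$, and let $u\in C([0,T);H^{s}(\mathbb R^d))\cap C^1([0,T);H^{s-1}(\mathbb R^d))$ be a solution of the incompressible Euler equations $$\partial_t u+(u\cdot\nabla)u+\nabla p=0,\qquad \nabla\cdot u=0 \qquad\text{on } [0,T)\times\mathbb R^d$$ (for some pressure $p$) which is axisymmetric without swirl, $u(t)=u^r(t,r,z)e^r+u^z(t,r,z)e^z$ for every $t\in[0,T)$. Let $\omega:=\partial_z u^r-\partial_r u^z$ be its scalar vorticity and $\omega_0:=\omega(0)$, and suppose that $\omega_0\ge 0$, that $\omega_0$ is compactly supported in $\mathbb R^d$, and that $r^{-(d-2)}\omega_0\in L^\infty(\mathbb R^d)$. Put $$S_0:=\sup\{r>0:(r,z)\in\operatorname{supp}\omega_0\}\quad(\sup\emptyset:=0),\qquad m_r(t):=\iint_{\{(\bar r,\bar z):\ \bar r\ge 0,\ \bar r\ge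 r\}}\omega(t,\bar r,\bar z)\,d\bar z\,d\bar r\quad(r\ge 0).$$ Then $\omega(t)$ is integrable on the half plane $\{(\bar r,\bar z):\bar r\ge 0\}$ for every $t\in[0,T)$, so that $m_r(t)$ is well defined, and there exists a constant $C>0$, depending only on $d$, $\|r\omega_0\|_{L^1(\mathbb R^d)}$, $\|r^{-(d-2)}\omega_0\|_{L^\infty(\mathbb R^d)}$ and $S_0$, such that for all $t\in[0,T)$ and all $r_1,r_2>0$ with $S_0\le r_1<r_2$ the function $m_{r_1}$ is integrable on $[0,t]$ and $$m_{r_2}(t)\ \le\ \frac{C\,r_2}{(r_2-r_1)^2\,r_1^{d}}\int_0^t m_{r_1}(s)\,ds .$$ -/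

import Mathlib

open MeasureTheory Set
open scoped ENNReal SchwartzMap

noncomputable section

/-- Euclidean space of dimension `d`. -/
abbrev Euc (d : ℕ) : Type := EuclideanSpace ℝ (Fin d)

/-! ### Cylindrical coordinates: the axis of symmetry is the last coordinate axis -/

/-- The `k`-th standard unit vector (coordinates are numbered from `0`). -/
def unitVec (d k : ℕ) : Euc d := WithLp.toLp 2 fun i => if (i : ℕ) = k then 1 else 0

/-- The axial unit vector `e^z`. -/
def eZ (d : ℕ) : Euc d := unitVec d (d - 1)

/-- The axial coordinate `z`. -/
def zCoord {d : ℕ} (x : Euc d) : ℝ := inner ℝ x (eZ d)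

/-- The component of `x` orthogonal to the axis. -/
def offAxis {d : ℕ} (x : Euc d) : Euc d := x - zCoord x • eZ d

/-- The radial coordinate `r`, the distance to the axis. -/
def rCoord {d : ℕ} (x : Euc d) : ℝ := ‖offAxis x‖

/-- The radial unit vector `e^r` at `x` (equal to `0` on the axis). -/
def eR {d : ℕ} (x : Euc d) : Euc d := (rCoord x)⁻¹ • offAxis x

/-- The point with cylindrical coordinates `(r, z)` in a fixed meridional half plane;
for `r > 0` the radial unit vector at this point is `unitVec d 0`. -/
def meridian (d : ℕ) (r z : ℝ) : Euc d := r • unitVec d 0 + z • eZ d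

/-- The radial component `u^r(r, z)` of a vector field. -/
def radialComp {d : ℕ} (v : Euc d → Euc d) (r z : ℝ) : ℝ :=
  inner ℝ (v (meridian d r z)) (unitVec d 0)

/-- The axial component `u^z(r, z)` of a vector field. -/
def axialComp {d : ℕ} (v : Euc d → Euc d) (r z : ℝ) : ℝ :=
  inner ℝ (v (meridian d r z)) (eZ d)

/-- `v = u^r(r, z) e^r + u^z(r, z) e^z`: axisymmetric without swirl. -/
def IsAxisymmetricNoSwirl {d : ℕ} (v : Euc d → Euc d) : Prop :=
  ∀ x, v x = radialComp v (rCoord x) (zCoord x) • eR x + axialComp v (rCoord x) (zCoord x) • eZ d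

/-- The scalar vorticity `ω = ∂_z u^r - ∂_r u^z` as a function of `(r, z)`. -/
def vorticity {d : ℕ} (v : Euc d → Euc d) (r z : ℝ) : ℝ :=
  deriv (fun ζ => radialComp v r ζ) z - deriv (fun ρ => axialComp v ρ z) r

/-- The scalar vorticity as a function on `ℝ^d`. -/
def vorticityOn {d : ℕ} (v : Euc d → Euc d) (x : Euc d) : ℝ :=
  vorticity v (rCoord x) (zCoord x)

/-- The radial size of the support of the scalar vorticity:
`sup {r > 0 : (r, z) ∈ supp ω}` (`0` if there is no such `r`). -/
def radialSupport {d : ℕ} (v : Euc d → Euc d) : ℝ :=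
  sSup {ρ : ℝ | 0 < ρ ∧ ∃ x ∈ tsupport (vorticityOn v), rCoord x = ρ}

/-- The part `A_r = {(r', z') : r' ≥ r}` of the half plane `{(r', z') : r' ≥ 0}`. -/
def outerRegion (r : ℝ) : Set (ℝ × ℝ) := {q | 0 ≤ q.1 ∧ r ≤ q.1}

/-- The outer mass `m_r = ∬_{A_r} ω dz dr`. -/
def outerMass {d : ℕ} (v : Euc d → Euc d) (r : ℝ) : ℝ :=
  ∫ q in outerRegion r, vorticity v q.1 q.2

/-! ### The Euler equations -/

/-- The time interval `[0, T)`, where `T` may be `∞`. -/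
def timeInterval (T : EReal) : Set ℝ := {t | 0 ≤ t ∧ (t : EReal) < T}

/-- A real vector field, regarded as a complex one. -/
def complexify {d : ℕ} (v : Euc d → Euc d) (x : Euc d) : EuclideanSpace ℂ (Fin d) :=
  WithLp.toLp 2 fun i => (v x i : ℂ)

/-- `f ∈ H^σ` for `σ ≥ 0`, with Bessel potential `g`: the function `f` belongs to `L²`, and
`(1 + |ξ|²)^{σ/2}` applied to it as a Fourier multiplier gives `g ∈ L²`. -/
def HasBesselPotential {E F : Type*} [NormedAddCommGroup E] [InnerProductSpace ℝ E]
    [FiniteDimensional ℝ E] [MeasurableSpace E] [BorelSpace E]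
    [NormedAddCommGroup F] [NormedSpace ℂ F] [CompleteSpace F]
    (σ : ℝ) (f : E → F) (g : Lp F 2 (volume : Measure E)) : Prop :=
  ∃ f' : Lp F 2 (volume : Measure E), f' =ᵐ[volume] f ∧
    TemperedDistribution.besselPotential E F σ (f' : 𝓢'(E, F)) = (g : 𝓢'(E, F))

/-- `u ∈ C^n(I; H^σ(ℝ^d; ℝ^d))`, for `σ ≥ 0`. The Bessel potential of order `σ` is an isometry of
`H^σ` (with the norm `‖(1 + |ξ|²)^{σ/2} û‖_{L²}`) onto `L²`, so this says that each `u(t)`, `t ∈ I`,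
lies in `H^σ` and that its Bessel potential is a `C^n` curve in `L²`. -/
def IsContDiffSobolev {d : ℕ} (n : WithTop ℕ∞) (I : Set ℝ) (σ : ℝ) (u : ℝ → Euc d → Euc d) :
    Prop :=
  ∃ U : ℝ → Lp (EuclideanSpace ℂ (Fin d)) 2 (volume : Measure (Euc d)),
    ContDiffOn ℝ n U I ∧ ∀ t ∈ I, HasBesselPotential σ (complexify (u t)) (U t)

/-- The divergence `∑ i, ∂_i v_i`. -/
def divergence {d : ℕ} (v : Euc d → Euc d) (x : Euc d) : ℝ :=
  ∑ i : Fin d, fderiv ℝ v x (EuclideanSpace.single i 1) i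

/-- `u` is a solution of the incompressible Euler equations on `[0, T) × ℝ^d` of class
`C([0, T); H^s) ∩ C^1([0, T); H^{s-1})`. For `s > 1 + d / 2`, fields of this class are `C^1` in space
and in time (after modification on null sets), so the equations are required to hold pointwise. -/
structure IsEulerSolution (d : ℕ) (s : ℝ) (T : EReal) (u : ℝ → Euc d → Euc d) : Prop where
  continuous_sobolev : IsContDiffSobolev 0 (timeInterval T) s u
  contDiff_sobolev : IsContDiffSobolev 1 (timeInterval T) (s - 1) u
  differentiable : ∀ t ∈ timeInterval T, Differentiable ℝ (u t)
  divergence_free : ∀ t ∈ timeInterval T, ∀ x, divergence (u t) x = 0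
  momentum : ∃ p : ℝ → Euc d → ℝ, ∀ t ∈ timeInterval T, Differentiable ℝ (p t) ∧
    ∀ x, HasDerivWithinAt (fun τ => u τ x)
      (-(fderiv ℝ (u t) x (u t x)) - gradient (p t) x) (timeInterval T) t

end

/-!
The constant depends on the solution only through the impulse `∬ ρ^(d-1) ω dρ dz`, which is
`‖r ω₀‖_{L¹}` divided by the area of the unit sphere of `ℝ^(d-1)`
(`IsVorticalField.toReal_eLpNorm`) and which is conserved
(`IsVorticalSolution.integral_impulse`). Both this conservation law and the growth estimate for the
outer mass come from symmetrising the Biot–Savart law in the meridional half plane. For a function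
`V` of the radius and its primitive `f' = V ρ^(d-2)`, the weak form of the vorticity equation
`∂ₜω + div (ω w) = 0` gives
`d/dt ∬ ω f = ∬ V ω u^r ρ^(d-2) dρ dz`. Inserting `u^r(p) = c ∬ ω(q) k(p, q) ρ_q^(d-2) dq`, with an
antisymmetric kernel `k`, turns the right-hand side into a double integral of
`(V(ρ_p) - V(ρ_q)) k(p, q) ω(p) ω(q)`, up to a factor. If `V = 1`, it vanishes, which is the
conservation of the impulse. If `V = Λ (ρ - r₁)₊`, the integrand vanishes unless one of the two
points lies beyond `r₁`, and `|ρ_p - ρ_q| |k(p, q)| ≤ C ρ_q ρ_p^(-(d-1))` (`abs_mul_cylKernel_le`)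
bounds the integral by the impulse times the outer mass divided by `r₁`
(`IsVorticalField.abs_integral_flux_le`). With `Λ` chosen such that `f ≥ 1` for `ρ ≥ r₂`, and with
`f = 0` on the support of `ω₀`, integration in time gives the theorem
(`IsVorticalSolution.outerMass_le`), even without the factor `r₂ / r₁ ≥ 1` of the statement.

The kernel is an integral over the sphere of directions. Its bound combines the concentration of
the integrand on a small cap, near the diagonal (`integral_sphere_rpow_le`), and the cancellation
between antipodal points, far from it (`abs_integral_sphere_mul_rpow_le`). To avoid singular
integrals, the Biot–Savart law is used in a regularised form: the field is convolved with
`ε² (ε² + |y|²)^(-d/2-1)`, a multiple of the divergence of the explicit gradient field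
`(ε² + |y|²)^(-d/2) y`, and integrations by parts move the derivatives to the antisymmetric part
of `Du` (`integral_inner_mul_divergence`, `IsAxisymmetricNoSwirl.integral_mollified`). The kernel
bound is uniform in `ε`, and only the flux itself has to be passed to the limit
(`IsVorticalField.tendsto_regFlux`).

The estimate needs that `ω` stays nonnegative and compactly supported. As the vorticity is merely
continuous, its transport is derived from the momentum equation in a weak form. In the Sobolev class
under consideration the solution is a `C¹` curve and its gradient a continuous curve for the uniform
norm (`IsEulerSolution.exists_uniform_curves`), and its restriction to the meridional plane, which
is invariant, solves the momentum equation there (`IsEulerSolution.exists_planarFlow`). Test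
functions `g(ρ) h(z)` need only one derivative of each factor for the integrations by parts that
eliminate the pressure. In the frame of a trajectory, concentrating them at the moving point gives a
linear equation `κ' = b κ` for the vorticity `κ` at this point, whence `κ` is multiplied by a
positive factor (`PlanarFlow.exists_planarCurl_eq_mul`).
-/

/-! ### Fields of Sobolev class as Fourier multipliers -/

open FourierTransform in
/-- On `L¹ ∩ L²` the inverse Fourier transform of `L²` is given by the inverse Fourier integral. -/
theorem MeasureTheory.Lp.fourierInv_ae_eq_fourierTransformInv {E F : Type*} [NormedAddCommGroup E]
    [InnerProductSpace ℝ E] [FiniteDimensional ℝ E] [MeasurableSpace E] [BorelSpace E]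
    [NormedAddCommGroup F] [InnerProductSpace ℂ F] [CompleteSpace F]
    (h : Lp F 2 (volume : Measure E)) (k : Lp F 1 (volume : Measure E))
    (hk : (h : E → F) =ᵐ[volume] k) :
    ((𝓕⁻ h : Lp F 2 (volume : Measure E)) : E → F) =ᵐ[volume] Real.Lp.fourierTransformInv k := by
  refine ae_eq_of_integral_contDiff_smul_eq ((Lp.memLp _).locallyIntegrable (by norm_num))
    (BoundedContinuousFunction.continuous _).locallyIntegrable fun g hg hgc => ?_
  have hg₁ : HasCompactSupport (Complex.ofRealCLM ∘ g) := hgc.comp_left rfl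
  have hg₂ : ContDiff ℝ ((⊤ : ℕ∞) : WithTop ℕ∞) (Complex.ofRealCLM ∘ g) := by fun_prop
  set G : 𝓢(E, ℂ) := hg₁.toSchwartzMap hg₂ with hG
  have hGx : ∀ x, G x = (g x : ℂ) := fun x => rfl
  calc ∫ x, g x • (𝓕⁻ h : Lp F 2 (volume : Measure E)) x
      = ((𝓕⁻ h : Lp F 2 (volume : Measure E)) : 𝓢'(E, F)) G := by
        rw [Lp.toTemperedDistribution_apply]
        refine integral_congr_ae (.of_forall fun x => ?_)
        simp [hGx]
    _ = ∫ ξ, (𝓕⁻ G : 𝓢(E, ℂ)) ξ • k ξ := by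
        rw [← Lp.fourierInv_toTemperedDistribution_eq, TemperedDistribution.fourierInv_apply,
          Lp.toTemperedDistribution_apply]
        refine integral_congr_ae ?_
        filter_upwards [hk] with ξ hξ
        rw [hξ]
    _ = ∫ x, G x • Real.Lp.fourierTransformInv k x := by
        simp_rw [Real.Lp.fourierTransformInv_apply, SchwartzMap.fourierInv_coe]
        have := VectorFourier.integral_fourierIntegral_smul_eq_flip (μ := (volume : Measure E))
          (ν := (volume : Measure E)) (e := Real.fourierChar) (L := -innerₗ E)
          Real.continuous_fourierChar
          (continuous_inner.neg : Continuous fun p : E × E => -inner ℝ p.1 p.2)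
          G.integrable (L1.integrable_coeFn k)
        have hfl : (-innerₗ E : E →ₗ[ℝ] E →ₗ[ℝ] ℝ).flip = -innerₗ E := by
          ext x y; simp [real_inner_comm]
        rw [hfl] at this
        exact this
    _ = ∫ x, g x • Real.Lp.fourierTransformInv k x := by
        refine integral_congr_ae (.of_forall fun x => ?_)
        simp [hGx]

section Multiplier

variable {E F : Type*} [NormedAddCommGroup E]
    [InnerProductSpace ℝ E] [FiniteDimensional ℝ E] [MeasurableSpace E] [BorelSpace E]
    [NormedAddCommGroup F] [InnerProductSpace ℂ F] [CompleteSpace F]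

/-- Multiplication by an `L²` symbol, as a continuous map from `L²` to `L¹`. -/
noncomputable def mulSymbol {m : E → ℂ} (hm : MemLp m 2 (volume : Measure E)) :
    Lp F 2 (volume : Measure E) →L[ℂ] Lp F 1 (volume : Measure E) :=
  (ContinuousLinearMap.lsmul ℂ ℂ).holderL volume 2 2 1 (hm.toLp m)

open FourierTransform in
/-- The Fourier multiplier with an `L²` symbol, as a continuous map from `L²` to bounded continuous
functions. -/
noncomputable def boundedMultiplier (F : Type*) [NormedAddCommGroup F] [InnerProductSpace ℂ F]
    [CompleteSpace F] {m : E → ℂ} (hm : MemLp m 2 (volume : Measure E)) :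
    Lp F 2 (volume : Measure E) →L[ℂ] BoundedContinuousFunction E F :=
  (Real.Lp.fourierTransformInvCLM E F).comp
    ((mulSymbol hm).comp (Lp.fourierTransformₗᵢ E F).toLinearIsometry.toContinuousLinearMap)

omit [CompleteSpace F] in
theorem mulSymbol_ae {m : E → ℂ} (hm : MemLp m 2 (volume : Measure E))
    (g : Lp F 2 (volume : Measure E)) :
    (mulSymbol hm g : E → F) =ᵐ[volume] fun ξ => m ξ • g ξ := by
  filter_upwards [(ContinuousLinearMap.lsmul ℂ ℂ).coeFn_holder (r := 1) (hm.toLp m) g,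
    hm.coeFn_toLp] with x h1 h2
  change (ContinuousLinearMap.lsmul ℂ ℂ).holder 1 (hm.toLp m) g x = _
  rw [h1, h2]
  rfl

open FourierTransform in
theorem boundedMultiplier_apply {m : E → ℂ} (hm : MemLp m 2 (volume : Measure E))
    (g : Lp F 2 (volume : Measure E)) (x : E) :
    boundedMultiplier F hm g x =
      𝓕⁻ (fun ξ => m ξ • (𝓕 g : Lp F 2 (volume : Measure E)) ξ) x := by
  change Real.Lp.fourierTransformInvCLM E F (mulSymbol hm (𝓕 g)) x = _
  rw [Real.Lp.fourierTransformInvCLM_apply, Real.Lp.fourierTransformInv_apply]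
  exact Real.fourierInv_congr_ae (mulSymbol_ae hm _) x

open FourierTransform in
theorem ae_eq_boundedMultiplier {m : E → ℂ} (hm : MemLp m 2 (volume : Measure E))
    (g h : Lp F 2 (volume : Measure E))
    (hh : (h : E → F) =ᵐ[volume] fun ξ => m ξ • (𝓕 g : Lp F 2 (volume : Measure E)) ξ) :
    ((𝓕⁻ h : Lp F 2 (volume : Measure E)) : E → F) =ᵐ[volume] boundedMultiplier F hm g := by
  change _ =ᵐ[volume] ⇑(Real.Lp.fourierTransformInvCLM E F (mulSymbol hm (𝓕 g)))
  rw [Real.Lp.fourierTransformInvCLM_apply]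
  exact Lp.fourierInv_ae_eq_fourierTransformInv h _ (hh.trans (mulSymbol_ae hm _).symm)

open FourierTransform in
/-- A multiplier whose symbol is moreover bounded maps `L²` to `L²`. -/
theorem memLp_boundedMultiplier {m : E → ℂ} (hm : MemLp m 2 (volume : Measure E))
    (hb : MemLp m ∞ (volume : Measure E)) (g : Lp F 2 (volume : Measure E)) :
    MemLp (boundedMultiplier F hm g) 2 (volume : Measure E) := by
  have h : MemLp (fun ξ => m ξ • (𝓕 g : Lp F 2 (volume : Measure E)) ξ) 2 volume :=
    (Lp.memLp (𝓕 g)).smul hb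
  exact (memLp_congr_ae (ae_eq_boundedMultiplier hm g h.toLp h.coeFn_toLp)).1 (Lp.memLp _)

open FourierTransform in
/-- A function with Bessel potential `g` of order `σ` is the multiplier with symbol
`(1 + |ξ|²)^(-σ/2)`, applied to `g`. -/
theorem HasBesselPotential.ae_eq {σ : ℝ} {f : E → F} {g : Lp F 2 (volume : Measure E)}
    (hf : HasBesselPotential σ f g)
    (hm : MemLp (fun ξ : E => (((1 + ‖ξ‖ ^ 2) ^ (-σ / 2) : ℝ) : ℂ)) 2 volume)
    (hb : MemLp (fun ξ : E => (((1 + ‖ξ‖ ^ 2) ^ (-σ / 2) : ℝ) : ℂ)) ∞ volume) :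
    f =ᵐ[volume] boundedMultiplier F hm g := by
  obtain ⟨f', hf', hg⟩ := hf
  refine hf'.symm.trans ?_
  -- Invert the Bessel potential, and read the result on the Fourier side as an identity in `L²`.
  apply_fun TemperedDistribution.besselPotential E F (-σ) at hg
  rw [TemperedDistribution.besselPotential_besselPotential_apply, add_neg_cancel,
    TemperedDistribution.besselPotential_zero, ContinuousLinearMap.id_apply] at hg
  apply_fun 𝓕 at hg
  rw [TemperedDistribution.fourier_besselPotential_eq_smulLeftCLM_fourier_apply,
    Lp.fourier_toTemperedDistribution_eq,
    Lp.fourier_toTemperedDistribution_eq,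
    ← Lp.toTemperedDistribution_smul_eq (r := 2) (by fun_prop) hb] at hg
  have h2 : 𝓕 f' = (hb.toLp _ • (𝓕 g : Lp F 2 volume) : Lp F 2 volume) :=
    LinearMap.ker_eq_bot.1 (Lp.ker_toTemperedDistributionCLM_eq_bot (F := F)
      (μ := (volume : Measure E))) hg
  have h3 : f' = 𝓕⁻ (hb.toLp _ • (𝓕 g : Lp F 2 volume) : Lp F 2 volume) := by
    rw [← h2, FourierTransform.fourierInv_fourier_eq]
  rw [h3]
  apply ae_eq_boundedMultiplier
  filter_upwards [Lp.coeFn_lpSMul (r := 2) (hb.toLp _) (𝓕 g), hb.coeFn_toLp] with x h1 h2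
  rw [h1, Pi.smul_apply', h2]

end Multiplier

section Symbols

variable {E : Type*} [NormedAddCommGroup E]

/-- The symbol `(1 + |ξ|²)^(-σ/2)`. -/
noncomputable def besselSymbol (E : Type*) [NormedAddCommGroup E] (σ : ℝ) (ξ : E) : ℂ :=
  (((1 + ‖ξ‖ ^ 2) ^ (-σ / 2) : ℝ) : ℂ)

theorem norm_besselSymbol (σ : ℝ) (ξ : E) : ‖besselSymbol E σ ξ‖ = (1 + ‖ξ‖ ^ 2) ^ (-σ / 2) := by
  rw [besselSymbol, Complex.norm_real, Real.norm_of_nonneg (by positivity)]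

theorem continuous_besselSymbol (σ : ℝ) : Continuous (besselSymbol E σ) := by
  unfold besselSymbol
  refine Complex.continuous_ofReal.comp (Continuous.rpow_const (by fun_prop) fun ξ => .inl ?_)
  positivity

/-- One derivative costs one order of decay of the symbol. -/
theorem norm_mul_norm_besselSymbol_le (σ : ℝ) (ξ : E) :
    ‖ξ‖ * ‖besselSymbol E σ ξ‖ ≤ ‖besselSymbol E (σ - 1) ξ‖ := by
  rw [norm_besselSymbol, norm_besselSymbol]
  have h : (-(σ - 1) / 2) = 1 / 2 + -σ / 2 := by ring
  rw [h, Real.rpow_add (by positivity)]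
  gcongr
  rw [← Real.sqrt_eq_rpow]
  exact Real.le_sqrt_of_sq_le (by linarith)

variable [InnerProductSpace ℝ E]

/-- The symbol of the directional derivative `∂_v` composed with `(1 + |ξ|²)^(-σ/2)`. -/
noncomputable def derivSymbol (σ : ℝ) (v ξ : E) : ℂ :=
  2 * Real.pi * Complex.I * (inner ℝ ξ v : ℝ) * besselSymbol E σ ξ

theorem norm_derivSymbol_le (σ : ℝ) (v ξ : E) :
    ‖derivSymbol σ v ξ‖ ≤ 2 * Real.pi * ‖v‖ * ‖besselSymbol E (σ - 1) ξ‖ := by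
  rw [derivSymbol]
  simp only [norm_mul, Complex.norm_ofNat, Complex.norm_real, Complex.norm_I, mul_one]
  rw [Real.norm_of_nonneg Real.pi_nonneg, mul_assoc (2 * Real.pi), mul_assoc (2 * Real.pi)]
  refine mul_le_mul_of_nonneg_left ?_ (by positivity)
  calc ‖(inner ℝ ξ v : ℝ)‖ * ‖besselSymbol E σ ξ‖ ≤ (‖ξ‖ * ‖v‖) * ‖besselSymbol E σ ξ‖ := by
        gcongr; exact norm_inner_le_norm ξ v
    _ = ‖v‖ * (‖ξ‖ * ‖besselSymbol E σ ξ‖) := by ring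
    _ ≤ _ := by gcongr; exact norm_mul_norm_besselSymbol_le σ ξ

variable [FiniteDimensional ℝ E] [MeasurableSpace E] [BorelSpace E]

/-- The symbol is square integrable for `σ > d / 2`, which is the Sobolev embedding into the bounded
continuous functions. -/
theorem memLp_two_besselSymbol {σ : ℝ} (hσ : (Module.finrank ℝ E : ℝ) < 2 * σ) :
    MemLp (besselSymbol E σ) 2 (volume : Measure E) := by
  rw [memLp_two_iff_integrable_sq_norm (continuous_besselSymbol σ).aestronglyMeasurable]
  refine (integrable_rpow_neg_one_add_norm_sq hσ).congr (.of_forall fun ξ => ?_)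
  dsimp only
  rw [norm_besselSymbol, ← Real.rpow_mul_natCast (by positivity)]
  congr 1
  push_cast; ring

theorem memLp_top_besselSymbol {σ : ℝ} (hσ : 0 ≤ σ) :
    MemLp (besselSymbol E σ) ∞ (volume : Measure E) := by
  refine memLp_top_of_bound (continuous_besselSymbol σ).aestronglyMeasurable 1
    (.of_forall fun ξ => ?_)
  rw [norm_besselSymbol]
  exact Real.rpow_le_one_of_one_le_of_nonpos (by nlinarith [sq_nonneg ‖ξ‖]) (by linarith)

theorem memLp_derivSymbol {p : ℝ≥0∞} {σ : ℝ} (v : E)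
    (h : MemLp (besselSymbol E (σ - 1)) p (volume : Measure E)) :
    MemLp (derivSymbol σ v) p (volume : Measure E) := by
  refine (h.norm.const_mul (2 * Real.pi * ‖v‖)).of_le ?_ (.of_forall fun ξ => ?_)
  · have := continuous_besselSymbol (E := E) σ
    exact Continuous.aestronglyMeasurable (by unfold derivSymbol; fun_prop)
  · refine (norm_derivSymbol_le σ v ξ).trans (le_abs_self _)

open FourierTransform in
/-- Multipliers of order `σ > 1 + d / 2` take values in `C¹`, and the derivative is again a
multiplier. -/
theorem hasFDerivAt_boundedMultiplier {F : Type*} [NormedAddCommGroup F] [InnerProductSpace ℂ F]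
    [CompleteSpace F] {σ : ℝ} (h0 : MemLp (besselSymbol E σ) 2 (volume : Measure E))
    (h1 : MemLp (besselSymbol E (σ - 1)) 2 (volume : Measure E))
    (g : Lp F 2 (volume : Measure E)) (x : E) :
    ∃ L : E →L[ℝ] F, HasFDerivAt (boundedMultiplier F h0 g) L x ∧
      ∀ v, L v = boundedMultiplier F (memLp_derivSymbol v h1) g x := by
  set h : E → F := fun ξ => besselSymbol E σ ξ • (𝓕 g : Lp F 2 (volume : Measure E)) ξ with hh
  have hint : Integrable h :=
    memLp_one_iff_integrable.1 ((Lp.memLp (𝓕 g)).smul h0)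
  have hint' : Integrable (fun ξ => ‖ξ‖ * ‖h ξ‖) := by
    have : Integrable (fun ξ => besselSymbol E (σ - 1) ξ •
      (𝓕 g : Lp F 2 (volume : Measure E)) ξ) :=
        memLp_one_iff_integrable.1 ((Lp.memLp (𝓕 g)).smul h1)
    refine this.norm.mono' (by have := hint.1; fun_prop) (.of_forall fun ξ => ?_)
    rw [Real.norm_of_nonneg (by positivity), hh, norm_smul, norm_smul, ← mul_assoc]
    gcongr
    exact norm_mul_norm_besselSymbol_le σ ξ
  have hf : (boundedMultiplier F h0 g : E → F) = fun y => 𝓕 h (-y) := by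
    funext y
    rw [boundedMultiplier_apply, Real.fourierInv_eq_fourier_neg]
  have hD : HasFDerivAt (fun y => 𝓕 h (-y)) _ x :=
    (Real.hasFDerivAt_fourier hint hint' (-x)).comp x (hasFDerivAt_id x).neg
  rw [← hf] at hD
  refine ⟨_, hD, fun v => ?_⟩
  · rw [boundedMultiplier_apply, Real.fourierInv_eq_fourier_neg]
    simp only [ContinuousLinearMap.comp_neg, ContinuousLinearMap.comp_id,
      neg_apply]
    rw [Real.fourier_continuousLinearMap_apply]
    · rw [Real.fourier_eq, Real.fourier_eq, ← integral_neg]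
      congr 1
      ext ξ
      rw [← smul_neg, VectorFourier.fourierSMulRight_apply, hh]
      simp only [derivSymbol, Circle.smul_def]
      rw [neg_smul, neg_neg, RCLike.real_smul_eq_coe_smul (K := ℂ)]
      simp only [smul_smul]
      congr 1
      change _ = _ * (2 * (Real.pi : ℂ) * Complex.I * ((innerSL ℝ ξ v : ℝ) : ℂ) * _)
      simp only [RCLike.ofReal, Complex.coe_algebraMap]
      ring
    · refine (hint'.const_mul (2 * Real.pi * ‖(innerSL ℝ : E →L[ℝ] E →L[ℝ] ℝ)‖)).mono' ?_
        (.of_forall fun ξ => ?_)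
      · exact hint.1.fourierSMulRight
      · have := VectorFourier.norm_fourierSMulRight_le (innerSL ℝ) h ξ
        linarith

end Symbols

/-- The real part of a complex vector. -/
noncomputable def rePart (d : ℕ) : EuclideanSpace ℂ (Fin d) →L[ℝ] Euc d :=
  LinearMap.toContinuousLinearMap
    { toFun := fun v => WithLp.toLp 2 fun i => (v i).re
      map_add' := fun v w => by ext i; simp
      map_smul' := fun c v => by ext i; simp }

theorem rePart_complexify {d : ℕ} (v : Euc d → Euc d) (x : Euc d) :
    rePart d (complexify v x) = v x := by
  ext i
  simp [rePart, complexify]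

/-- The velocity field reconstructed from the Bessel potential of its complexification. -/
noncomputable def fieldOfPotential (d : ℕ) {m : Euc d → ℂ}
    (hm : MemLp m 2 (volume : Measure (Euc d))) :
    Lp (EuclideanSpace ℂ (Fin d)) 2 (volume : Measure (Euc d)) →L[ℝ]
      BoundedContinuousFunction (Euc d) (Euc d) :=
  ((rePart d).compLeftContinuousBounded (Euc d)).comp
    ((boundedMultiplier (EuclideanSpace ℂ (Fin d)) hm).restrictScalars ℝ)

/-- The derivative of the velocity field, reconstructed from the Bessel potential of the
complexification of the field. -/
noncomputable def gradOfPotential (d : ℕ) {σ : ℝ}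
    (h1 : MemLp (besselSymbol (Euc d) (σ - 1)) 2 (volume : Measure (Euc d))) :
    Lp (EuclideanSpace ℂ (Fin d)) 2 (volume : Measure (Euc d)) →L[ℝ]
      BoundedContinuousFunction (Euc d) (Euc d →L[ℝ] Euc d) :=
  ∑ i : Fin d, ((ContinuousLinearMap.smulRightL ℝ (Euc d) (Euc d)
    (EuclideanSpace.proj i)).compLeftContinuousBounded (Euc d)).comp
      (fieldOfPotential d (memLp_derivSymbol (EuclideanSpace.single i 1) h1))

theorem hasFDerivAt_fieldOfPotential {d : ℕ} {σ : ℝ}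
    (h0 : MemLp (besselSymbol (Euc d) σ) 2 (volume : Measure (Euc d)))
    (h1 : MemLp (besselSymbol (Euc d) (σ - 1)) 2 (volume : Measure (Euc d)))
    (g : Lp (EuclideanSpace ℂ (Fin d)) 2 (volume : Measure (Euc d))) (x : Euc d) :
    HasFDerivAt (fieldOfPotential d h0 g) (gradOfPotential d h1 g x) x := by
  obtain ⟨L, hL, hLv⟩ := hasFDerivAt_boundedMultiplier h0 h1 g x
  have h2 : HasFDerivAt (fieldOfPotential d h0 g) ((rePart d).comp L) x :=
    (rePart d).hasFDerivAt.comp x hL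
  suffices h : gradOfPotential d h1 g x = (rePart d).comp L by rw [h]; exact h2
  apply ContinuousLinearMap.coe_injective
  refine (EuclideanSpace.basisFun (Fin d) ℝ).toBasis.ext fun j => ?_
  simp only [OrthonormalBasis.coe_toBasis, EuclideanSpace.basisFun_apply,
    ContinuousLinearMap.coe_coe, ContinuousLinearMap.comp_apply]
  rw [hLv]
  simp only [gradOfPotential, sum_apply, BoundedContinuousFunction.sum_apply,
    ContinuousLinearMap.comp_apply]
  rw [Finset.sum_eq_single j]
  · simp [fieldOfPotential]
  · intro i _ hij
    simp [hij]
  · simp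

theorem memLp_fieldOfPotential {d : ℕ} {m : Euc d → ℂ} (hm : MemLp m 2 (volume : Measure (Euc d)))
    (hb : MemLp m ∞ (volume : Measure (Euc d)))
    (g : Lp (EuclideanSpace ℂ (Fin d)) 2 (volume : Measure (Euc d))) :
    MemLp (fieldOfPotential d hm g) 2 (volume : Measure (Euc d)) :=
  (rePart d).comp_memLp' (memLp_boundedMultiplier hm hb g)

theorem norm_gradOfPotential_le {d : ℕ} {σ : ℝ}
    (h1 : MemLp (besselSymbol (Euc d) (σ - 1)) 2 (volume : Measure (Euc d)))
    (g : Lp (EuclideanSpace ℂ (Fin d)) 2 (volume : Measure (Euc d))) (x : Euc d) :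
    ‖gradOfPotential d h1 g x‖ ≤ ∑ i : Fin d,
      ‖fieldOfPotential d (memLp_derivSymbol (EuclideanSpace.single i 1) h1) g x‖ := by
  simp only [gradOfPotential, sum_apply, BoundedContinuousFunction.sum_apply,
    ContinuousLinearMap.comp_apply]
  refine (norm_sum_le _ _).trans (Finset.sum_le_sum fun i _ => ?_)
  refine ContinuousLinearMap.opNorm_le_bound _ (norm_nonneg _) fun v => ?_
  change ‖v i • fieldOfPotential d (memLp_derivSymbol (EuclideanSpace.single i 1) h1) g x‖ ≤ _
  rw [norm_smul, mul_comm]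
  gcongr
  exact PiLp.norm_apply_le v i

theorem memLp_gradOfPotential {d : ℕ} {σ : ℝ}
    (h1 : MemLp (besselSymbol (Euc d) (σ - 1)) 2 (volume : Measure (Euc d)))
    (hb : MemLp (besselSymbol (Euc d) (σ - 1)) ∞ (volume : Measure (Euc d)))
    (g : Lp (EuclideanSpace ℂ (Fin d)) 2 (volume : Measure (Euc d))) :
    MemLp (fun x => gradOfPotential d h1 g x) 2 (volume : Measure (Euc d)) := by
  have hi : MemLp (fun x => ∑ i : Fin d,
      ‖fieldOfPotential d (memLp_derivSymbol (EuclideanSpace.single i 1) h1) g x‖) 2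
        (volume : Measure (Euc d)) := memLp_finsetSum _ fun i _ =>
    (memLp_fieldOfPotential (memLp_derivSymbol (EuclideanSpace.single i 1) h1)
        (memLp_derivSymbol _ hb) g).norm
  refine hi.of_le (BoundedContinuousFunction.continuous _).aestronglyMeasurable
    (.of_forall fun x => ?_)
  exact (norm_gradOfPotential_le h1 g x).trans (le_abs_self _)

theorem uniqueDiffOn_timeInterval (T : EReal) (hT : 0 < T) : UniqueDiffOn ℝ (timeInterval T) := by
  apply uniqueDiffOn_convex
  · refine Set.OrdConnected.convex ⟨fun a ha b hb c hc => ?_⟩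
    exact ⟨ha.1.trans hc.1, (EReal.coe_le_coe_iff.2 hc.2).trans_lt hb.2⟩
  · obtain ⟨b, hb0, hbT⟩ := EReal.lt_iff_exists_real_btwn.1 hT
    have hb0 : 0 < b := by exact_mod_cast hb0
    refine ⟨b / 2, mem_interior.2 ⟨Ioo 0 b, fun x hx => ⟨hx.1.le, ?_⟩, isOpen_Ioo, by
      constructor <;> linarith⟩⟩
    exact (EReal.coe_lt_coe_iff.2 hx.2).trans hbT

/-- A solution of class `C([0, T); H^s) ∩ C¹([0, T); H^(s-1))` is, in the topology of uniform
convergence in space, a `C¹` curve whose spatial derivative is a continuous curve; moreover the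
field and its derivative are square integrable. -/
theorem IsEulerSolution.exists_uniform_curves {d : ℕ} {s : ℝ} {T : EReal} {u : ℝ → Euc d → Euc d}
    (hu : IsEulerSolution d s T u) (hs : 1 + (d : ℝ) / 2 < s) (hT : 0 < T) :
    ∃ (U U' : ℝ → BoundedContinuousFunction (Euc d) (Euc d))
      (D : ℝ → BoundedContinuousFunction (Euc d) (Euc d →L[ℝ] Euc d)),
      (∀ t ∈ timeInterval T, (U t : Euc d → Euc d) = u t) ∧
      (∀ t ∈ timeInterval T, HasDerivWithinAt U (U' t) (timeInterval T) t) ∧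
      ContinuousOn U' (timeInterval T) ∧
      (∀ t ∈ timeInterval T, ∀ x, HasFDerivAt (u t) (D t x) x) ∧
      ContinuousOn D (timeInterval T) ∧
      (∀ t ∈ timeInterval T, MemLp (u t) 2 (volume : Measure (Euc d))) ∧
      ∀ t ∈ timeInterval T, MemLp (fun x => D t x) 2 (volume : Measure (Euc d)) := by
  obtain ⟨W, hW, hWu⟩ := hu.continuous_sobolev
  obtain ⟨W₁, hW₁, hWu₁⟩ := hu.contDiff_sobolev
  have hd : (Module.finrank ℝ (Euc d) : ℝ) = d := by simp
  have hs1 : (Module.finrank ℝ (Euc d) : ℝ) < 2 * (s - 1) := by rw [hd]; linarith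
  have hs0 : (Module.finrank ℝ (Euc d) : ℝ) < 2 * s := by linarith
  have hpos : (0 : ℝ) ≤ d := by positivity
  have h1 := memLp_two_besselSymbol (E := Euc d) hs1
  have h0 := memLp_two_besselSymbol (E := Euc d) hs0
  have h1b := memLp_top_besselSymbol (E := Euc d) (σ := s - 1) (by linarith)
  have h0b := memLp_top_besselSymbol (E := Euc d) (σ := s) (by linarith)
  have key : ∀ (σ : ℝ) (h2 : MemLp (besselSymbol (Euc d) σ) 2 volume)
      (hb : MemLp (besselSymbol (Euc d) σ) ∞ volume) (t : ℝ) (_ : t ∈ timeInterval T)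
      (g : Lp (EuclideanSpace ℂ (Fin d)) 2 (volume : Measure (Euc d)))
      (_ : HasBesselPotential σ (complexify (u t)) g),
      (fieldOfPotential d h2 g : Euc d → Euc d) = u t := by
    intro σ h2 hb t ht g hg
    refine Continuous.ae_eq_iff_eq volume (BoundedContinuousFunction.continuous _)
      (hu.differentiable t ht).continuous |>.1 ?_
    filter_upwards [hg.ae_eq h2 hb] with x hx
    rw [← rePart_complexify (u t) x, hx]
    rfl
  have e0 := fun t ht => key s h0 h0b t ht _ (hWu t ht)
  have e1 := fun t ht => key (s - 1) h1 h1b t ht _ (hWu₁ t ht)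
  have hU := uniqueDiffOn_timeInterval T hT
  -- The values and the time derivative come from the curve in `H^(s-1)`, the space derivative from
  -- the curve in `H^s`.
  refine ⟨fun t => fieldOfPotential d h1 (W₁ t),
    fun t => fieldOfPotential d h1 (derivWithin W₁ (timeInterval T) t),
    fun t => gradOfPotential d h1 (W t), e1, fun t ht => ?_, ?_, fun t ht x => ?_, ?_,
    fun t ht => ?_,
    fun t ht => memLp_gradOfPotential h1 h1b (W t)⟩
  · exact (fieldOfPotential d h1).hasFDerivAt.comp_hasDerivWithinAt t
      ((hW₁.differentiableOn (by norm_num)) t ht).hasDerivWithinAt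
  · exact (fieldOfPotential d h1).continuous.comp_continuousOn
      (hW₁.continuousOn_derivWithin hU le_rfl)
  · have := hasFDerivAt_fieldOfPotential h0 h1 (W t) x
    rwa [e0 t ht] at this
  · exact (gradOfPotential d h1).continuous.comp_continuousOn hW.continuousOn
  · rw [← e1 t ht]
    exact memLp_fieldOfPotential h1 h1b _

/-! ### Geometry of axisymmetric fields -/

theorem norm_unitVec {d k : ℕ} (hk : k < d) : ‖unitVec d k‖ = 1 := by
  have : unitVec d k = EuclideanSpace.single (⟨k, hk⟩ : Fin d) (1 : ℝ) := by
    ext i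
    simp [unitVec, Fin.ext_iff]
  simp [this]

theorem inner_unitVec {d j k : ℕ} (hj : j < d) (hjk : j ≠ k) :
    inner ℝ (unitVec d j) (unitVec d k) = (0 : ℝ) := by
  have : unitVec d j = EuclideanSpace.single (⟨j, hj⟩ : Fin d) (1 : ℝ) := by
    ext i
    simp [unitVec, Fin.ext_iff]
  rw [this, EuclideanSpace.inner_single_left]
  simp [unitVec, hjk]

theorem inner_radial_axial {d : ℕ} (hd : 3 ≤ d) : inner ℝ (unitVec d 0) (eZ d) = (0 : ℝ) :=
  inner_unitVec (by omega) (by omega)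

theorem inner_axial_radial {d : ℕ} (hd : 3 ≤ d) : inner ℝ (eZ d) (unitVec d 0) = (0 : ℝ) := by
  rw [real_inner_comm, inner_radial_axial hd]

theorem inner_radial_self {d : ℕ} (hd : 3 ≤ d) :
    inner ℝ (unitVec d 0) (unitVec d 0) = (1 : ℝ) := by
  rw [real_inner_self_eq_norm_sq, norm_unitVec (by omega), one_pow]

theorem inner_axial_self {d : ℕ} (hd : 3 ≤ d) : inner ℝ (eZ d) (eZ d) = (1 : ℝ) := by
  rw [real_inner_self_eq_norm_sq, eZ, norm_unitVec (by omega), one_pow]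

/-- The embedding of the plane spanned by the first coordinate axis and the axis of symmetry. -/
noncomputable def planeEmb (d : ℕ) : ℝ × ℝ →L[ℝ] Euc d :=
  (ContinuousLinearMap.fst ℝ ℝ ℝ).smulRight (unitVec d 0) +
    (ContinuousLinearMap.snd ℝ ℝ ℝ).smulRight (eZ d)

/-- The orthogonal projection to the meridional plane, in coordinates. -/
noncomputable def planeProj (d : ℕ) : Euc d →L[ℝ] ℝ × ℝ :=
  (innerSL ℝ (unitVec d 0)).prod (innerSL ℝ (eZ d))

theorem planeEmb_apply {d : ℕ} (p : ℝ × ℝ) : planeEmb d p = meridian d p.1 p.2 := rfl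

theorem planeProj_apply {d : ℕ} (x : Euc d) :
    planeProj d x = (inner ℝ x (unitVec d 0), inner ℝ x (eZ d)) := by
  rw [real_inner_comm, real_inner_comm (eZ d)]; rfl

theorem planeProj_planeEmb {d : ℕ} (hd : 3 ≤ d) (p : ℝ × ℝ) : planeProj d (planeEmb d p) = p := by
  rw [planeProj_apply, planeEmb_apply, meridian]
  simp only [inner_add_left, inner_smul_left, inner_radial_self hd, inner_axial_self hd,
    inner_radial_axial hd, inner_axial_radial hd]
  simp

theorem zCoord_meridian {d : ℕ} (hd : 3 ≤ d) (ρ z : ℝ) : zCoord (meridian d ρ z) = z := by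
  have := planeProj_planeEmb hd (ρ, z)
  rw [planeProj_apply, planeEmb_apply] at this
  exact congrArg Prod.snd this

theorem offAxis_meridian {d : ℕ} (hd : 3 ≤ d) (ρ z : ℝ) :
    offAxis (meridian d ρ z) = ρ • unitVec d 0 := by
  rw [offAxis, zCoord_meridian hd, meridian, add_sub_cancel_right]

theorem rCoord_meridian {d : ℕ} (hd : 3 ≤ d) (ρ z : ℝ) : rCoord (meridian d ρ z) = |ρ| := by
  rw [rCoord, offAxis_meridian hd, norm_smul, norm_unitVec (by omega), mul_one, Real.norm_eq_abs]

/-- The restriction of a field to the meridional plane, with both components. The coordinate `ρ`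
ranges over the whole line: negative values describe the opposite half plane. -/
noncomputable def planarField {d : ℕ} (v : Euc d → Euc d) (p : ℝ × ℝ) : ℝ × ℝ :=
  (radialComp v p.1 p.2, axialComp v p.1 p.2)

theorem planarField_eq {d : ℕ} (v : Euc d → Euc d) (p : ℝ × ℝ) :
    planarField v p = planeProj d (v (planeEmb d p)) := by
  rw [planeProj_apply, planeEmb_apply]; rfl

/-- The values on the meridional plane, on both sides of the axis: the factor `|ρ|⁻¹ * ρ` is the
sign of `ρ`. -/
theorem IsAxisymmetricNoSwirl.eq_meridian {d : ℕ} (hd : 3 ≤ d) {v : Euc d → Euc d}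
    (hv : IsAxisymmetricNoSwirl v) (ρ z : ℝ) :
    v (meridian d ρ z) = meridian d (radialComp v |ρ| z * (|ρ|⁻¹ * ρ)) (axialComp v |ρ| z) := by
  rw [hv, eR, zCoord_meridian hd, rCoord_meridian hd, offAxis_meridian hd, meridian, smul_smul,
    smul_smul, mul_assoc]

/-- The meridional plane is invariant under an axisymmetric field without swirl. -/
theorem IsAxisymmetricNoSwirl.planeEmb_planarField {d : ℕ} (hd : 3 ≤ d) {v : Euc d → Euc d}
    (hv : IsAxisymmetricNoSwirl v) (p : ℝ × ℝ) :
    planeEmb d (planarField v p) = v (planeEmb d p) := by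
  rw [planarField_eq]
  have h := hv.eq_meridian hd p.1 p.2
  rw [planeEmb_apply p, h]
  exact congrArg (planeEmb d) (planeProj_planeEmb hd (_, _))

/-- The reflection of the meridional plane in the axis. -/
def axisReflection : ℝ × ℝ →L[ℝ] ℝ × ℝ :=
  (-ContinuousLinearMap.fst ℝ ℝ ℝ).prod (ContinuousLinearMap.snd ℝ ℝ ℝ)

theorem axisReflection_apply (p : ℝ × ℝ) : axisReflection p = (-p.1, p.2) := rfl

theorem IsAxisymmetricNoSwirl.planarField_reflection {d : ℕ} (hd : 3 ≤ d) {v : Euc d → Euc d}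
    (hv : IsAxisymmetricNoSwirl v) (p : ℝ × ℝ) :
    planarField v (axisReflection p) = axisReflection (planarField v p) := by
  have key : ∀ q : ℝ × ℝ, planarField v q =
      (radialComp v |q.1| q.2 * (|q.1|⁻¹ * q.1), axialComp v |q.1| q.2) := fun q => by
    rw [planarField_eq, planeEmb_apply, hv.eq_meridian hd]
    exact planeProj_planeEmb hd (_, _)
  rw [key, key, axisReflection_apply, axisReflection_apply]
  simp

/-- The curl `∂₂ w₁ - ∂₁ w₂` of a planar field with derivative `A`. -/
def planarCurl (A : ℝ × ℝ →L[ℝ] ℝ × ℝ) : ℝ := (A (0, 1)).1 - (A (1, 0)).2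

theorem continuous_planarCurl : Continuous planarCurl := by
  unfold planarCurl; fun_prop

/-- The derivative of the planar field, in terms of the derivative of the field. -/
noncomputable def planarDeriv (d : ℕ) :
    (Euc d →L[ℝ] Euc d) →L[ℝ] (ℝ × ℝ →L[ℝ] ℝ × ℝ) :=
  (ContinuousLinearMap.compL ℝ (ℝ × ℝ) (Euc d) (ℝ × ℝ) (planeProj d)).comp
    ((ContinuousLinearMap.compL ℝ (ℝ × ℝ) (Euc d) (Euc d)).flip (planeEmb d))

theorem planarDeriv_apply {d : ℕ} (A : Euc d →L[ℝ] Euc d) (p : ℝ × ℝ) :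
    planarDeriv d A p = planeProj d (A (planeEmb d p)) := rfl

theorem hasFDerivAt_planarField {d : ℕ} {v : Euc d → Euc d} {A : Euc d →L[ℝ] Euc d} {p : ℝ × ℝ}
    (h : HasFDerivAt v A (planeEmb d p)) :
    HasFDerivAt (planarField v) (planarDeriv d A) p := by
  have h2 := (planeProj d).hasFDerivAt.comp p (h.comp p (planeEmb d).hasFDerivAt)
  have : planarField v = planeProj d ∘ v ∘ planeEmb d := funext fun q => planarField_eq v q
  rw [this]
  exact h2

theorem vorticity_eq_planarCurl {d : ℕ} {v : Euc d → Euc d} {B : ℝ × ℝ →L[ℝ] ℝ × ℝ} {p : ℝ × ℝ}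
    (h : HasFDerivAt (planarField v) B p) : vorticity v p.1 p.2 = planarCurl B := by
  have h1 : HasDerivAt (fun ζ => radialComp v p.1 ζ) (B (0, 1)).1 p.2 := by
    exact (h.fst).comp_hasDerivAt p.2 ((hasDerivAt_const p.2 p.1).prodMk (hasDerivAt_id p.2))
  have h2 : HasDerivAt (fun ρ => axialComp v ρ p.2) (B (1, 0)).2 p.1 := by
    exact (h.snd).comp_hasDerivAt p.1 ((hasDerivAt_id p.1).prodMk (hasDerivAt_const p.1 p.2))
  rw [vorticity, h1.deriv, h2.deriv, planarCurl]

/-- The vorticity of an axisymmetric field without swirl is an odd function of the radius. -/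
theorem IsAxisymmetricNoSwirl.vorticity_neg {d : ℕ} (hd : 3 ≤ d) {v : Euc d → Euc d}
    (hv : IsAxisymmetricNoSwirl v) (hdiff : Differentiable ℝ v) (ρ z : ℝ) :
    vorticity v (-ρ) z = -vorticity v ρ z := by
  have hD : ∀ p, HasFDerivAt (planarField v) (planarDeriv d (fderiv ℝ v (planeEmb d p))) p :=
    fun p => hasFDerivAt_planarField (hdiff _).hasFDerivAt
  have h1 := (hD (axisReflection (ρ, z))).comp (ρ, z) axisReflection.hasFDerivAt
  have h2 := axisReflection.hasFDerivAt.comp (ρ, z) (hD (ρ, z))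
  have h3 : planarField v ∘ axisReflection = axisReflection ∘ planarField v :=
    funext fun p => hv.planarField_reflection hd p
  rw [h3] at h1
  have h4 := h1.unique h2
  have e1 := congrArg Prod.fst (DFunLike.congr_fun h4 (0, 1))
  have e2 := congrArg Prod.snd (DFunLike.congr_fun h4 (1, 0))
  rw [vorticity_eq_planarCurl (hD (ρ, z)),
    vorticity_eq_planarCurl (p := (-ρ, z)) (hD (axisReflection (ρ, z))), planarCurl, planarCurl]
  have e3 : ((-1 : ℝ), (0 : ℝ)) = -((1 : ℝ), (0 : ℝ)) := by simp
  simp only [ContinuousLinearMap.comp_apply, axisReflection_apply, neg_zero, e3, map_neg,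
    Prod.snd_neg] at e1 e2 ⊢
  linarith

/-- The projection to the orthogonal complement of the axis. -/
noncomputable def offAxisL (d : ℕ) : Euc d →L[ℝ] Euc d :=
  ContinuousLinearMap.id ℝ (Euc d) - (innerSL ℝ (eZ d)).smulRight (eZ d)

theorem offAxisL_apply {d : ℕ} (x : Euc d) : offAxisL d x = offAxis x := by
  simp [offAxisL, offAxis, zCoord, real_inner_comm]

theorem inner_offAxis_axial {d : ℕ} (hd : 3 ≤ d) (x : Euc d) :
    inner ℝ (offAxis x) (eZ d) = (0 : ℝ) := by
  rw [offAxis, inner_sub_left, inner_smul_left, inner_axial_self hd]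
  simp [zCoord]

theorem inner_offAxis_offAxis {d : ℕ} (hd : 3 ≤ d) (x y : Euc d) :
    (inner ℝ (offAxis x) (offAxis y) : ℝ) = inner ℝ (offAxis x) y := by
  conv_lhs => rw [offAxis.eq_1 y, inner_sub_right, inner_smul_right, inner_offAxis_axial hd,
    mul_zero, sub_zero]

theorem continuous_offAxis {d : ℕ} : Continuous (offAxis : Euc d → Euc d) := by
  have : (offAxis : Euc d → Euc d) = offAxisL d := funext fun y => (offAxisL_apply y).symm
  rw [this]; exact (offAxisL d).continuous

theorem continuous_rCoord {d : ℕ} : Continuous (rCoord : Euc d → ℝ) :=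
  continuous_offAxis.norm

theorem continuous_zCoord {d : ℕ} : Continuous (zCoord : Euc d → ℝ) := by
  unfold zCoord; fun_prop

theorem hasFDerivAt_rCoord {d : ℕ} (hd : 3 ≤ d) {x : Euc d} (hx : rCoord x ≠ 0) :
    HasFDerivAt (rCoord : Euc d → ℝ) ((rCoord x)⁻¹ • innerSL ℝ (offAxis x)) x := by
  have h0 : HasFDerivAt (offAxisL d : Euc d → Euc d) (offAxisL d) x := (offAxisL d).hasFDerivAt
  have h1 : HasFDerivAt (fun y => ‖offAxisL d y‖ ^ 2)
    (2 • (innerSL ℝ (offAxisL d x)).comp (offAxisL d)) x := h0.norm_sq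
  have h := HasFDerivAt.sqrt h1 (by rw [offAxisL_apply]; exact pow_ne_zero 2 hx)
  have e : (fun y => Real.sqrt (‖offAxisL d y‖ ^ 2)) = (rCoord : Euc d → ℝ) := by
    funext y
    rw [Real.sqrt_sq (norm_nonneg _), offAxisL_apply]; rfl
  rw [e] at h
  refine h.congr_fderiv (ContinuousLinearMap.ext fun a => ?_)
  rw [Real.sqrt_sq (norm_nonneg _), offAxisL_apply]
  change 1 / (2 * rCoord x) * (2 • inner ℝ (offAxis x) (offAxisL d a)) =
    (rCoord x)⁻¹ * (inner ℝ (offAxis x) a)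
  rw [offAxisL_apply, inner_offAxis_offAxis hd, nsmul_eq_mul]
  field_simp
  norm_num

/-- Off the axis, the antisymmetric part of the derivative of an axisymmetric field without swirl
is determined by its scalar vorticity. -/
theorem IsAxisymmetricNoSwirl.inner_fderiv_sub {d : ℕ} (hd : 3 ≤ d) {v : Euc d → Euc d}
    (hv : IsAxisymmetricNoSwirl v) (hdiff : Differentiable ℝ v) {x : Euc d} (hx : rCoord x ≠ 0)
    (a b : Euc d) :
    (inner ℝ (fderiv ℝ v x a) b - inner ℝ (fderiv ℝ v x b) a : ℝ) =
      vorticityOn v x / rCoord x *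
        (inner ℝ (offAxis x) b * zCoord a - inner ℝ (offAxis x) a * zCoord b) := by
  set B := planarDeriv d (fderiv ℝ v (planeEmb d (rCoord x, zCoord x))) with hB
  have hw : HasFDerivAt (planarField v) B (rCoord x, zCoord x) :=
    hasFDerivAt_planarField (hdiff _).hasFDerivAt
  have hz : HasFDerivAt (zCoord : Euc d → ℝ) (innerSL ℝ (eZ d)) x := by
    have : (zCoord : Euc d → ℝ) = innerSL ℝ (eZ d) := funext fun y => real_inner_comm _ _
    rw [this]; exact (innerSL ℝ (eZ d)).hasFDerivAt
  have hr := hasFDerivAt_rCoord hd hx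
  have hc := HasFDerivAt.comp (f := fun y : Euc d => (rCoord y, zCoord y)) x hw (hr.prodMk hz)
  have ho : HasFDerivAt (offAxis : Euc d → Euc d) (offAxisL d) x := by
    have : (offAxis : Euc d → Euc d) = offAxisL d := funext fun y => (offAxisL_apply y).symm
    rw [this]; exact (offAxisL d).hasFDerivAt
  have hinv := HasFDerivAt.comp x (hasDerivAt_inv hx).hasFDerivAt hr
  have hv' := ((hc.fst.mul hinv).smul ho).add (hc.snd.smul_const (eZ d))
  have hve : v = fun y => ((planarField v (rCoord y, zCoord y)).1 * (rCoord y)⁻¹) • offAxis y +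
      (planarField v (rCoord y, zCoord y)).2 • eZ d := by
    funext y
    conv_lhs => rw [hv y, eR, smul_smul]
    rfl
  have hB2 : ∀ α β : ℝ, B (α, β) = α • B (1, 0) + β • B (0, 1) := fun α β => by
    rw [← map_smul, ← map_smul, ← map_add]; simp
  have hza : ∀ e, (inner ℝ (eZ d) e : ℝ) = zCoord e := fun e => real_inner_comm _ _
  have hfd : ∀ e, fderiv ℝ v x e =
      ((planarField v (rCoord x, zCoord x)).1 * (-(rCoord x ^ 2)⁻¹ *
        ((rCoord x)⁻¹ * inner ℝ (offAxis x) e)) + (rCoord x)⁻¹ *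
          (B ((rCoord x)⁻¹ * inner ℝ (offAxis x) e, zCoord e)).1) • offAxis x +
      ((planarField v (rCoord x, zCoord x)).1 * (rCoord x)⁻¹) • offAxis e +
      (B ((rCoord x)⁻¹ * inner ℝ (offAxis x) e, zCoord e)).2 • eZ d := fun e => by
    have h : fderiv ℝ v x = _ := (congrArg (fderiv ℝ · x) hve).trans hv'.fderiv
    rw [h, ← hza e, ← offAxisL_apply e]
    change ((planarField v (rCoord x, zCoord x)).1 * (rCoord x)⁻¹) • offAxisL d e +
      ((planarField v (rCoord x, zCoord x)).1 * (((rCoord x)⁻¹ * inner ℝ (offAxis x) e) *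
        (-(rCoord x ^ 2)⁻¹)) + (rCoord x)⁻¹ *
          (B ((rCoord x)⁻¹ * inner ℝ (offAxis x) e, inner ℝ (eZ d) e)).1) • offAxis x +
      (B ((rCoord x)⁻¹ * inner ℝ (offAxis x) e, inner ℝ (eZ d) e)).2 • eZ d = _
    rw [mul_comm (_ * inner ℝ _ _) (-_), add_comm (_ • offAxisL d e)]
  have hvort : vorticityOn v x = (B (0, 1)).1 - (B (1, 0)).2 :=
    vorticity_eq_planarCurl (p := (rCoord x, zCoord x)) hw
  have hsym : (inner ℝ (offAxis a) b : ℝ) = inner ℝ (offAxis b) a := by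
    rw [← inner_offAxis_offAxis hd a b, ← inner_offAxis_offAxis hd b a, real_inner_comm]
  rw [hvort, hfd a, hfd b, hB2 _ (zCoord a), hB2 _ (zCoord b)]
  simp only [inner_add_left, real_inner_smul_left, hsym, hza, Prod.fst_add, Prod.snd_add,
    Prod.smul_fst, Prod.smul_snd, smul_eq_mul]
  field_simp
  ring

/-! ### Transport of the vorticity of a planar flow -/

/-- A (not necessarily solenoidal) planar velocity field `w`, with time derivative `w'` and space
derivative `D`, that satisfies the momentum equation on `[0, t₁]`. The curves are continuous on the
whole line, for the topology of uniform convergence; only `[0, t₁]` matters. -/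
structure PlanarFlow (t₁ : ℝ) (w w' : ℝ → BoundedContinuousFunction (ℝ × ℝ) (ℝ × ℝ))
    (D : ℝ → BoundedContinuousFunction (ℝ × ℝ) (ℝ × ℝ →L[ℝ] ℝ × ℝ)) : Prop where
  cont : Continuous w
  cont_deriv : Continuous w'
  cont_fderiv : Continuous D
  hasDerivWithinAt : ∀ t ∈ Icc 0 t₁, HasDerivWithinAt w (w' t) (Icc 0 t₁) t
  hasFDerivAt : ∀ t p, HasFDerivAt (w t) (D t p) p
  momentum : ∀ t, ∃ q : ℝ × ℝ → ℝ, Differentiable ℝ q ∧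
    ∀ p, w' t p + D t p (w t p) = -(fderiv ℝ q p (1, 0), fderiv ℝ q p (0, 1))

/-- Differentiation along a moving point of a curve of functions that is differentiable for the
topology of uniform convergence. -/
theorem hasDerivAt_eval_moving {E F : Type*} [NormedAddCommGroup E] [NormedSpace ℝ E]
    [NormedAddCommGroup F] [NormedSpace ℝ F] {f : ℝ → BoundedContinuousFunction E F}
    {f' : BoundedContinuousFunction E F} {t : ℝ} (hf : HasDerivAt f f' t)
    {X : ℝ → E} {X' : E} (hX : HasDerivAt X X' t) {A : E →L[ℝ] F}
    (hA : HasFDerivAt (f t) A (X t)) :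
    HasDerivAt (fun τ => f τ (X τ)) (f' (X t) + A X') t := by
  have h2 : HasDerivAt (fun τ => f t (X τ)) (A X') t := hA.comp_hasDerivAt t hX
  have h1 : HasDerivAt (fun τ => f τ (X τ) - f t (X τ)) (f' (X t)) t := by
    rw [hasDerivAt_iff_tendsto_slope]
    have hs := hasDerivAt_iff_tendsto_slope.1 hf
    have hXt : Filter.Tendsto X (nhdsWithin t {t}ᶜ) (nhds (X t)) :=
      hX.continuousAt.tendsto.mono_left nhdsWithin_le_nhds
    have := ((continuous_eval (F := BoundedContinuousFunction E F)).tendsto (f', X t)).comp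
      (hs.prodMk_nhds hXt)
    refine this.congr fun τ => ?_
    simp [slope_def_module]
  have := h1.add h2
  refine this.congr_of_eventuallyEq (.of_forall fun τ => ?_)
  simp

theorem HasCompactSupport.mul_prod {g h : ℝ → ℝ} (hg : HasCompactSupport g)
    (hh : HasCompactSupport h) : HasCompactSupport fun p : ℝ × ℝ => g p.1 * h p.2 := by
  refine HasCompactSupport.intro (hg.isCompact.prod hh.isCompact) fun p hp => ?_
  by_cases h1 : p.1 ∈ tsupport g
  · rw [image_eq_zero_of_notMem_tsupport (f := h) fun h2 => hp ⟨h1, h2⟩, mul_zero]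
  · rw [image_eq_zero_of_notMem_tsupport h1, zero_mul]

theorem integrable_mul_mul_prod {Q : ℝ × ℝ → ℝ} (hQ : Continuous Q) {g h : ℝ → ℝ}
    (hg : Continuous g) (hh : Continuous h) (hgc : HasCompactSupport g)
    (hhc : HasCompactSupport h) : Integrable fun p : ℝ × ℝ => Q p * (g p.1 * h p.2) :=
  Continuous.integrable_of_hasCompactSupport (by fun_prop) (hgc.mul_prod hhc).mul_left

theorem integral_fderiv_fst_mul {Q : ℝ × ℝ → ℝ} (hQ : ContDiff ℝ 1 Q) {g h : ℝ → ℝ}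
    (hg : ContDiff ℝ 1 g) (hh : Continuous h) (hgc : HasCompactSupport g)
    (hhc : HasCompactSupport h) :
    ∫ p : ℝ × ℝ, fderiv ℝ Q p (1, 0) * (g p.1 * h p.2) =
      -∫ p : ℝ × ℝ, Q p * (deriv g p.1 * h p.2) := by
  have hQ' : Continuous fun p => fderiv ℝ Q p (1, 0) :=
    (hQ.continuous_fderiv one_ne_zero).clm_apply continuous_const
  have hg' : Continuous (deriv g) := hg.continuous_deriv le_rfl
  have key := integral_bilinear_hasLineDerivAt_right_eq_neg_left_of_integrable
    (μ := (volume : Measure (ℝ × ℝ))) (B := ContinuousLinearMap.mul ℝ ℝ) (v := ((1 : ℝ), (0 : ℝ)))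
    (g := fun p : ℝ × ℝ => g p.1 * h p.2) (g' := fun p : ℝ × ℝ => deriv g p.1 * h p.2)
    (f := Q) (f' := fun p => fderiv ℝ Q p (1, 0))
    (integrable_mul_mul_prod hQ' hg.continuous hh hgc hhc)
    (integrable_mul_mul_prod hQ.continuous hg' hh hgc.deriv hhc)
    (integrable_mul_mul_prod hQ.continuous hg.continuous hh hgc hhc)
    (fun p _ => ((hQ.differentiable (by norm_num)) p).hasFDerivAt.hasLineDerivAt _)
    (fun p _ => by
      have h1 : HasDerivAt (fun t : ℝ => p.1 + t) 1 0 := (hasDerivAt_id 0).const_add p.1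
      have h2 : HasDerivAt g (deriv g p.1) (p.1 + 0) := by
        rw [add_zero]; exact ((hg.differentiable (by norm_num)) _).hasDerivAt
      have := (h2.comp (0 : ℝ) h1).mul_const (h p.2)
      simpa [HasLineDerivAt, Function.comp_def] using this)
  simp only [ContinuousLinearMap.mul_apply'] at key
  rw [key, neg_neg]

theorem integral_fderiv_snd_mul {Q : ℝ × ℝ → ℝ} (hQ : ContDiff ℝ 1 Q) {g h : ℝ → ℝ}
    (hg : Continuous g) (hh : ContDiff ℝ 1 h) (hgc : HasCompactSupport g)
    (hhc : HasCompactSupport h) :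
    ∫ p : ℝ × ℝ, fderiv ℝ Q p (0, 1) * (g p.1 * h p.2) =
      -∫ p : ℝ × ℝ, Q p * (g p.1 * deriv h p.2) := by
  have hQ' : Continuous fun p => fderiv ℝ Q p (0, 1) :=
    (hQ.continuous_fderiv one_ne_zero).clm_apply continuous_const
  have hh' : Continuous (deriv h) := hh.continuous_deriv le_rfl
  have key := integral_bilinear_hasLineDerivAt_right_eq_neg_left_of_integrable
    (μ := (volume : Measure (ℝ × ℝ))) (B := ContinuousLinearMap.mul ℝ ℝ) (v := ((0 : ℝ), (1 : ℝ)))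
    (g := fun p : ℝ × ℝ => g p.1 * h p.2) (g' := fun p : ℝ × ℝ => g p.1 * deriv h p.2)
    (f := Q) (f' := fun p => fderiv ℝ Q p (0, 1))
    (integrable_mul_mul_prod hQ' hg hh.continuous hgc hhc)
    (integrable_mul_mul_prod hQ.continuous hg hh' hgc hhc.deriv)
    (integrable_mul_mul_prod hQ.continuous hg hh.continuous hgc hhc)
    (fun p _ => ((hQ.differentiable (by norm_num)) p).hasFDerivAt.hasLineDerivAt _)
    (fun p _ => by
      have h1 : HasDerivAt (fun t : ℝ => p.2 + t) 1 0 := (hasDerivAt_id 0).const_add p.2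
      have h2 : HasDerivAt h (deriv h p.2) (p.2 + 0) := by
        rw [add_zero]; exact ((hh.differentiable (by norm_num)) _).hasDerivAt
      have := (h2.comp (0 : ℝ) h1).const_mul (g p.1)
      simpa [HasLineDerivAt, Function.comp_def] using this)
  simp only [ContinuousLinearMap.mul_apply'] at key
  rw [key, neg_neg]

/-- Gradients are orthogonal to rotated gradients of test functions in product form. Only first
derivatives of the factors are needed, because each is differentiated in its own variable. -/
theorem integral_gradient_cross {Q : ℝ × ℝ → ℝ} (hQ : ContDiff ℝ 1 Q) {g h : ℝ → ℝ}
    (hg : ContDiff ℝ 1 g) (hh : ContDiff ℝ 1 h) (hgc : HasCompactSupport g)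
    (hhc : HasCompactSupport h) :
    ∫ p : ℝ × ℝ, (fderiv ℝ Q p (1, 0) * (g p.1 * deriv h p.2) -
      fderiv ℝ Q p (0, 1) * (deriv g p.1 * h p.2)) = 0 := by
  have hQ1 : Continuous fun p => fderiv ℝ Q p (1, 0) :=
    (hQ.continuous_fderiv one_ne_zero).clm_apply continuous_const
  have hQ2 : Continuous fun p => fderiv ℝ Q p (0, 1) :=
    (hQ.continuous_fderiv one_ne_zero).clm_apply continuous_const
  have hg' : Continuous (deriv g) := hg.continuous_deriv le_rfl
  have hh' : Continuous (deriv h) := hh.continuous_deriv le_rfl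
  rw [integral_sub (integrable_mul_mul_prod hQ1 hg.continuous hh' hgc hhc.deriv)
    (integrable_mul_mul_prod hQ2 hg' hh.continuous hgc.deriv hhc),
    integral_fderiv_fst_mul hQ hg hh' hgc hhc.deriv,
    integral_fderiv_snd_mul hQ hg' hh hgc.deriv hhc, sub_self]

/-- The vorticity of a `C¹` planar field, tested against a function in product form. -/
theorem integral_planarCurl_mul {w : ℝ × ℝ → ℝ × ℝ} {D : ℝ × ℝ → ℝ × ℝ →L[ℝ] ℝ × ℝ}
    (hD : Continuous D) (hw : ∀ p, HasFDerivAt w (D p) p) {g h : ℝ → ℝ}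
    (hg : ContDiff ℝ 1 g) (hh : ContDiff ℝ 1 h) (hgc : HasCompactSupport g)
    (hhc : HasCompactSupport h) :
    ∫ p : ℝ × ℝ, planarCurl (D p) * (g p.1 * h p.2) =
      ∫ p : ℝ × ℝ, ((w p).2 * (deriv g p.1 * h p.2) - (w p).1 * (g p.1 * deriv h p.2)) := by
  have hfd : fderiv ℝ w = D := funext fun p => (hw p).fderiv
  have hwC : ContDiff ℝ 1 w := contDiff_one_iff_fderiv.2
    ⟨fun p => (hw p).differentiableAt, by rwa [hfd]⟩
  have h1 : ContDiff ℝ 1 fun p => (w p).1 := hwC.fst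
  have h2 : ContDiff ℝ 1 fun p => (w p).2 := hwC.snd
  have f1 : ∀ p v, fderiv ℝ (fun p => (w p).1) p v = (D p v).1 := fun p v => by
    rw [(hw p).fst.fderiv]; rfl
  have f2 : ∀ p v, fderiv ℝ (fun p => (w p).2) p v = (D p v).2 := fun p v => by
    rw [(hw p).snd.fderiv]; rfl
  have hg' : Continuous (deriv g) := hg.continuous_deriv le_rfl
  have hh' : Continuous (deriv h) := hh.continuous_deriv le_rfl
  have e1 := integral_fderiv_snd_mul h1 hg.continuous hh hgc hhc
  have e2 := integral_fderiv_fst_mul h2 hg hh.continuous hgc hhc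
  simp only [f1, f2] at e1 e2
  simp only [planarCurl, sub_mul]
  have c1 : Continuous fun p => (D p (0, 1)).1 := by fun_prop
  have c2 : Continuous fun p => (D p (1, 0)).2 := by fun_prop
  rw [integral_sub (integrable_mul_mul_prod c1 hg.continuous hh.continuous hgc hhc)
    (integrable_mul_mul_prod c2 hg.continuous hh.continuous hgc hhc), e1, e2,
    integral_sub (integrable_mul_mul_prod h2.continuous hg' hh.continuous hgc.deriv hhc)
    (integrable_mul_mul_prod h1.continuous hg.continuous hh' hgc hhc.deriv)]
  ring

/-- Continuity of the norm, stated for a general codomain, which keeps the instance search for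
spaces of operator-valued functions short. -/
theorem continuous_norm_boundedContinuousFunction {T E F : Type*} [TopologicalSpace T]
    [TopologicalSpace E] [SeminormedAddCommGroup F] {f : T → BoundedContinuousFunction E F}
    (hf : Continuous f) : Continuous fun t => ‖f t‖ := hf.norm

section

variable {t₁ : ℝ} {w w' : ℝ → BoundedContinuousFunction (ℝ × ℝ) (ℝ × ℝ)}
  {D : ℝ → BoundedContinuousFunction (ℝ × ℝ) (ℝ × ℝ →L[ℝ] ℝ × ℝ)}

theorem clm_prod_apply (A : ℝ × ℝ →L[ℝ] ℝ × ℝ) (v : ℝ × ℝ) :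
    A v = v.1 • A (1, 0) + v.2 • A (0, 1) := by
  rw [← map_smul, ← map_smul, ← map_add]; simp

/-- In a frame moving with velocity `c`, the acceleration of the flow is the sum of a gradient and
of the rotation of the relative velocity by the vorticity. -/
theorem PlanarFlow.integral_acceleration (hW : PlanarFlow t₁ w w' D) (t : ℝ) (x c : ℝ × ℝ)
    {g h : ℝ → ℝ} (hg : ContDiff ℝ 1 g) (hh : ContDiff ℝ 1 h) (hgc : HasCompactSupport g)
    (hhc : HasCompactSupport h) :
    ∫ p : ℝ × ℝ, ((w' t (x + p) + D t (x + p) c).2 * (deriv g p.1 * h p.2) -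
        (w' t (x + p) + D t (x + p) c).1 * (g p.1 * deriv h p.2)) =
      ∫ p : ℝ × ℝ, planarCurl (D t (x + p)) *
        ((w t (x + p) - c).1 * (deriv g p.1 * h p.2) +
          (w t (x + p) - c).2 * (g p.1 * deriv h p.2)) := by
  obtain ⟨q, hq, hmom⟩ := hW.momentum t
  have hg' : Continuous (deriv g) := hg.continuous_deriv le_rfl
  have hh' : Continuous (deriv h) := hh.continuous_deriv le_rfl
  have hgc0 := hg.continuous
  have hhc0 := hh.continuous
  have hq1 : ∀ p, fderiv ℝ q p (1, 0) = -(w' t p + D t p (w t p)).1 := fun p => by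
    rw [hmom p]; simp
  have hq2 : ∀ p, fderiv ℝ q p (0, 1) = -(w' t p + D t p (w t p)).2 := fun p => by
    rw [hmom p]; simp
  -- `(D w) c = (D w) w - (D w) (w - c)`, and the last term is the gradient of `|w - c|² / 2` up to
  -- the rotation of `w - c` by the vorticity; so `Q` is the potential of the gradient part.
  set Q : ℝ × ℝ → ℝ := fun p => q (x + p) +
    ((w t (x + p) - c).1 ^ 2 + (w t (x + p) - c).2 ^ 2) / 2 with hQdef
  have hadd : ∀ p : ℝ × ℝ, HasFDerivAt (fun p => x + p) (ContinuousLinearMap.id ℝ (ℝ × ℝ)) p :=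
    fun p => (hasFDerivAt_id p).const_add x
  have hQd : ∀ p, HasFDerivAt Q (fderiv ℝ q (x + p) +
      ((w t (x + p) - c).1 • (ContinuousLinearMap.fst ℝ ℝ ℝ).comp (D t (x + p)) +
        (w t (x + p) - c).2 • (ContinuousLinearMap.snd ℝ ℝ ℝ).comp (D t (x + p)))) p := fun p => by
    have h1 : HasFDerivAt (fun p => q (x + p)) (fderiv ℝ q (x + p)) p :=
      (hq (x + p)).hasFDerivAt.comp p (hadd p)
    have h2 : HasFDerivAt (fun p => w t (x + p) - c) (D t (x + p)) p :=
      ((hW.hasFDerivAt t (x + p)).comp p (hadd p)).sub_const c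
    refine (h1.add (((h2.fst.pow 2).add (h2.snd.pow 2)).mul_const (1 / 2))).congr_fderiv ?_
      |>.congr_of_eventuallyEq (.of_forall fun y => ?_)
    · refine ContinuousLinearMap.ext fun v => ?_
      simp
      ring
    · simp [hQdef]
      ring
  have hqc : Continuous fun p => fderiv ℝ q p := by
    have : (fun p => fderiv ℝ q p) = fun p =>
        (-(w' t p + D t p (w t p)).1) • ContinuousLinearMap.fst ℝ ℝ ℝ +
        (-(w' t p + D t p (w t p)).2) • ContinuousLinearMap.snd ℝ ℝ ℝ := by
      funext p
      refine ContinuousLinearMap.ext fun v => ?_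
      have : v = v.1 • ((1 : ℝ), (0 : ℝ)) + v.2 • ((0 : ℝ), (1 : ℝ)) := by simp
      rw [this, map_add, map_smul, map_smul, hq1, hq2]
      simp
      ring
    rw [this]
    fun_prop
  have hQC : ContDiff ℝ 1 Q := by
    refine contDiff_one_iff_fderiv.2 ⟨fun p => (hQd p).differentiableAt, ?_⟩
    have : fderiv ℝ Q = _ := funext fun p => (hQd p).fderiv
    rw [this]
    have : Continuous fun p => fderiv ℝ q (x + p) := hqc.comp (by fun_prop)
    fun_prop
  have hcross := integral_gradient_cross hQC hg hh hgc hhc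
  have hQ1 : Continuous fun p => fderiv ℝ Q p (1, 0) :=
    (hQC.continuous_fderiv one_ne_zero).clm_apply continuous_const
  have hQ2 : Continuous fun p => fderiv ℝ Q p (0, 1) :=
    (hQC.continuous_fderiv one_ne_zero).clm_apply continuous_const
  have hcurl : Continuous fun p => planarCurl (D t (x + p)) :=
    continuous_planarCurl.comp (by fun_prop)
  have hcs1 := hgc.deriv.mul_prod hhc
  have hcs2 := hgc.mul_prod hhc.deriv
  have hint1 : Integrable fun p : ℝ × ℝ => planarCurl (D t (x + p)) *
        ((w t (x + p) - c).1 * (deriv g p.1 * h p.2) +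
          (w t (x + p) - c).2 * (g p.1 * deriv h p.2)) := by
    refine Continuous.integrable_of_hasCompactSupport (by fun_prop) ?_
    exact ((hcs1.mul_left).add (hcs2.mul_left)).mul_left
  have hint2 : Integrable fun p : ℝ × ℝ => (fderiv ℝ Q p (1, 0) * (g p.1 * deriv h p.2) -
      fderiv ℝ Q p (0, 1) * (deriv g p.1 * h p.2)) :=
    (integrable_mul_mul_prod hQ1 hg.continuous hh' hgc hhc.deriv).sub
    (integrable_mul_mul_prod hQ2 hg' hh.continuous hgc.deriv hhc)
  rw [← add_zero (∫ p : ℝ × ℝ, planarCurl (D t (x + p)) * _), ← hcross, ← integral_add hint1 hint2]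
  congr 1
  funext p
  rw [(hQd p).fderiv]
  simp only [add_apply, smul_apply, ContinuousLinearMap.comp_apply,
    ContinuousLinearMap.coe_fst', ContinuousLinearMap.coe_snd', hq1, hq2, planarCurl]
  rw [clm_prod_apply (D t (x + p)) c, clm_prod_apply (D t (x + p)) (w t (x + p))]
  simp only [Prod.fst_add, Prod.snd_add, Prod.smul_fst, Prod.smul_snd, smul_eq_mul, Prod.fst_sub,
    Prod.snd_sub]
  ring

/-- The weak form of the vorticity equation `∂ₜω + div (ω w) = 0`, in a moving frame, for test
functions in product form. -/
theorem PlanarFlow.integral_planarCurl_sub (hW : PlanarFlow t₁ w w' D) {X X' : ℝ → ℝ × ℝ}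
    (hXc : Continuous X) (hX'c : Continuous X')
    (hX : ∀ t ∈ Icc 0 t₁, HasDerivWithinAt X (X' t) (Icc 0 t₁) t)
    {g h : ℝ → ℝ} (hg : ContDiff ℝ 1 g) (hh : ContDiff ℝ 1 h) (hgc : HasCompactSupport g)
    (hhc : HasCompactSupport h) {t : ℝ} (ht : t ∈ Icc 0 t₁) :
    (∫ p : ℝ × ℝ, planarCurl (D t (X t + p)) * (g p.1 * h p.2)) -
        ∫ p : ℝ × ℝ, planarCurl (D 0 (X 0 + p)) * (g p.1 * h p.2) =
      ∫ τ in (0 : ℝ)..t, ∫ p : ℝ × ℝ, planarCurl (D τ (X τ + p)) *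
        ((w τ (X τ + p) - X' τ).1 * (deriv g p.1 * h p.2) +
          (w τ (X τ + p) - X' τ).2 * (g p.1 * deriv h p.2)) := by
  have hg' : Continuous (deriv g) := hg.continuous_deriv le_rfl
  have hh' : Continuous (deriv h) := hh.continuous_deriv le_rfl
  have hgc0 := hg.continuous
  have hhc0 := hh.continuous
  have hwc := hW.cont
  have hwc' := hW.cont_deriv
  have hDc := hW.cont_fderiv
  have hcs1 := hgc.deriv.mul_prod hhc
  have hcs2 := hgc.mul_prod hhc.deriv
  -- `∫ F τ` is the tested vorticity after an integration by parts, and is differentiable in time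
  -- although the vorticity is not.
  set F : ℝ → ℝ × ℝ → ℝ := fun τ p => (w τ (X τ + p)).2 * (deriv g p.1 * h p.2) -
    (w τ (X τ + p)).1 * (g p.1 * deriv h p.2) with hF
  set E : ℝ → ℝ × ℝ → ℝ × ℝ := fun τ p => w' τ (X τ + p) + D τ (X τ + p) (X' τ) with hE
  set F' : ℝ → ℝ × ℝ → ℝ := fun τ p => (E τ p).2 * (deriv g p.1 * h p.2) -
    (E τ p).1 * (g p.1 * deriv h p.2) with hF'
  have hEc : Continuous fun z : ℝ × (ℝ × ℝ) => E z.1 z.2 := by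
    simp only [hE]; fun_prop
  have hFc : Continuous fun z : ℝ × (ℝ × ℝ) => F z.1 z.2 := by
    simp only [hF]; fun_prop
  have hF'c : Continuous fun z : ℝ × (ℝ × ℝ) => F' z.1 z.2 := by
    simp only [hF']; fun_prop
  set K : Set (ℝ × ℝ) := tsupport (fun p : ℝ × ℝ => deriv g p.1 * h p.2) ∪
    tsupport (fun p : ℝ × ℝ => g p.1 * deriv h p.2) with hK
  have hKc : IsCompact K := hcs1.isCompact.union hcs2.isCompact
  have hzero : ∀ p ∉ K, deriv g p.1 * h p.2 = 0 ∧ g p.1 * deriv h p.2 = 0 := fun p hp =>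
    ⟨image_eq_zero_of_notMem_tsupport (f := fun p : ℝ × ℝ => deriv g p.1 * h p.2)
      fun hh => hp (.inl hh),
    image_eq_zero_of_notMem_tsupport (f := fun p : ℝ × ℝ => g p.1 * deriv h p.2)
      fun hh => hp (.inr hh)⟩
  have hJc : Continuous fun τ => ∫ p, F τ p := by
    rw [← continuousOn_univ]
    refine continuousOn_integral_of_compact_support hKc hFc.continuousOn fun τ p _ hp => ?_
    simp [hF, hzero p hp]
  have hJ'c : Continuous fun τ => ∫ p, F' τ p := by
    rw [← continuousOn_univ]
    refine continuousOn_integral_of_compact_support hKc hF'c.continuousOn fun τ p _ hp => ?_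
    simp [hF', hzero p hp]
  have hDn : Continuous fun τ => ‖D τ‖ := continuous_norm_boundedContinuousFunction hDc
  obtain ⟨C, hC⟩ := (isCompact_Icc (a := 0) (b := t₁)).exists_bound_of_continuousOn
    (f := fun τ => ‖w' τ‖ + ‖D τ‖ * ‖X' τ‖) ((hwc'.norm).add (hDn.mul hX'c.norm)).continuousOn
  have hEb : ∀ τ ∈ Icc 0 t₁, ∀ p, ‖E τ p‖ ≤ C := fun τ hτ p => by
    refine le_trans ?_ ((le_abs_self _).trans (hC τ hτ))
    refine (norm_add_le _ _).trans (add_le_add ((w' τ).norm_coe_le_norm _) ?_)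
    exact ((D τ (X τ + p)).le_opNorm _).trans
      (mul_le_mul_of_nonneg_right ((D τ).norm_coe_le_norm _) (norm_nonneg _))
  have hdF : ∀ τ ∈ Ioo 0 t₁, ∀ p, HasDerivAt (fun σ => F σ p) (F' τ p) τ := fun τ hτ p => by
    have hnhds : Icc 0 t₁ ∈ nhds τ := Icc_mem_nhds hτ.1 hτ.2
    have h1 := (hW.hasDerivWithinAt τ (Ioo_subset_Icc_self hτ)).hasDerivAt hnhds
    have h2 := ((hX τ (Ioo_subset_Icc_self hτ)).hasDerivAt hnhds).add_const p
    have h3 := hasDerivAt_eval_moving h1 h2 (hW.hasFDerivAt τ (X τ + p))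
    have h4 := (ContinuousLinearMap.fst ℝ ℝ ℝ).hasFDerivAt.comp_hasDerivAt τ h3
    have h5 := (ContinuousLinearMap.snd ℝ ℝ ℝ).hasFDerivAt.comp_hasDerivAt τ h3
    exact (h5.mul_const _).sub (h4.mul_const _)
  have hdJ : ∀ τ ∈ Ioo 0 t₁, HasDerivAt (fun σ => ∫ p, F σ p) (∫ p, F' τ p) τ := fun τ hτ => by
    have hcF : ∀ σ, Continuous (F σ) := fun σ =>
      hFc.comp (by fun_prop : Continuous fun p : ℝ × ℝ => (σ, p))
    have hcF' : ∀ σ, Continuous (F' σ) := fun σ =>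
      hF'c.comp (by fun_prop : Continuous fun p : ℝ × ℝ => (σ, p))
    refine (hasDerivAt_integral_of_dominated_loc_of_deriv_le (s := Ioo 0 t₁)
      (bound := fun p => C * |deriv g p.1 * h p.2| + C * |g p.1 * deriv h p.2|)
      (Ioo_mem_nhds hτ.1 hτ.2) (.of_forall fun σ => (hcF σ).aestronglyMeasurable) ?_
      (hcF' τ).aestronglyMeasurable (.of_forall fun p σ hσ => ?_) ?_
      (.of_forall fun p σ hσ => hdF σ hσ p)).2
    · refine (hcF τ).integrable_of_hasCompactSupport ?_
      exact (hcs1.mul_left).sub (hcs2.mul_left)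
    · have hb := hEb σ (Ioo_subset_Icc_self hσ) p
      refine (norm_sub_le _ _).trans (add_le_add ?_ ?_)
      · rw [norm_mul]
        exact mul_le_mul_of_nonneg_right ((norm_snd_le _).trans hb) (norm_nonneg _)
      · rw [norm_mul]
        exact mul_le_mul_of_nonneg_right ((norm_fst_le _).trans hb) (norm_nonneg _)
    · refine Integrable.add (Integrable.const_mul ?_ C) (Integrable.const_mul ?_ C)
      · exact (Continuous.integrable_of_hasCompactSupport (by fun_prop) hcs1).abs
      · exact (Continuous.integrable_of_hasCompactSupport (by fun_prop) hcs2).abs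
  have hFTC := intervalIntegral.integral_eq_sub_of_hasDerivAt_of_le ht.1 hJc.continuousOn
    (fun τ hτ => hdJ τ ⟨hτ.1, hτ.2.trans_le ht.2⟩) (hJ'c.intervalIntegrable 0 t)
  have hadd : ∀ x p : ℝ × ℝ, HasFDerivAt (fun p => x + p) (ContinuousLinearMap.id ℝ (ℝ × ℝ)) p :=
    fun x p => (hasFDerivAt_id p).const_add x
  have hrep : ∀ τ, ∫ p : ℝ × ℝ, planarCurl (D τ (X τ + p)) * (g p.1 * h p.2) = ∫ p, F τ p :=
    fun τ => integral_planarCurl_mul (w := fun p => w τ (X τ + p)) (D := fun p => D τ (X τ + p))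
      (by fun_prop) (fun p => (hW.hasFDerivAt τ (X τ + p)).comp p (hadd _ p)) hg hh hgc hhc
  rw [hrep, hrep, ← hFTC]
  refine intervalIntegral.integral_congr fun τ _ => ?_
  exact hW.integral_acceleration τ (X τ) (X' τ) hg hh hgc hhc

end

/-! ### Trajectories -/

/-- A continuous solution of the integral form of `κ' = b κ` is a positive multiple of its initial
value. -/
theorem eq_mul_exp_of_eq_integral {κ b : ℝ → ℝ} {t₁ : ℝ} (hκ : Continuous κ) (hb : Continuous b)
    (h : ∀ t ∈ Icc 0 t₁, κ t - κ 0 = ∫ τ in (0 : ℝ)..t, b τ * κ τ) {t : ℝ} (ht : t ∈ Icc 0 t₁) :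
    κ t = κ 0 * Real.exp (∫ τ in (0 : ℝ)..t, b τ) := by
  set φ : ℝ → ℝ := fun t => κ 0 + ∫ τ in (0 : ℝ)..t, b τ * κ τ with hφ
  set B : ℝ → ℝ := fun t => ∫ τ in (0 : ℝ)..t, b τ with hB
  have hφd : ∀ t, HasDerivAt φ (b t * κ t) t := fun t =>
    ((hb.mul hκ).integral_hasStrictDerivAt 0 t).hasDerivAt.const_add _
  have hBd : ∀ t, HasDerivAt B (b t) t := fun t => (hb.integral_hasStrictDerivAt 0 t).hasDerivAt
  have hφκ : ∀ t ∈ Icc 0 t₁, φ t = κ t := fun t ht => by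
    rw [hφ]; dsimp only; rw [← h t ht]; ring
  have hd : ∀ t ∈ Icc 0 t₁, HasDerivAt (fun t => φ t * Real.exp (-B t)) 0 t := fun t ht => by
    refine ((hφd t).mul ((hBd t).neg.exp)).congr_deriv ?_
    rw [hφκ t ht]; ring
  have hc := constant_of_has_deriv_right_zero (f := fun t => φ t * Real.exp (-B t))
    (fun t ht => (hd t ht).continuousAt.continuousWithinAt)
    (fun t ht => (hd t (Ico_subset_Icc_self ht)).hasDerivWithinAt) t ht
  have hB0 : B 0 = 0 := by simp [hB]
  have hφ0 : φ 0 = κ 0 := by simp [hφ]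
  simp only [hB0, hφ0, hφκ t ht, neg_zero, Real.exp_zero, mul_one] at hc
  rw [← hc, mul_assoc, ← Real.exp_add, neg_add_cancel, Real.exp_zero, mul_one]

/-- A smooth compactly supported function of integral `1` on the line. -/
theorem exists_mollifier : ∃ θ : ℝ → ℝ, ContDiff ℝ 1 θ ∧ HasCompactSupport θ ∧ ∫ x, θ x = 1 := by
  let f : ContDiffBump (0 : ℝ) := ⟨1, 2, by norm_num, by norm_num⟩
  exact ⟨f.normed volume, f.contDiff_normed, f.hasCompactSupport_normed, f.integral_normed⟩

section

variable {t₁ : ℝ} {w w' : ℝ → BoundedContinuousFunction (ℝ × ℝ) (ℝ × ℝ)}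
  {D : ℝ → BoundedContinuousFunction (ℝ × ℝ) (ℝ × ℝ →L[ℝ] ℝ × ℝ)}

/-- Through every point of space-time passes a trajectory of the flow, defined on all of `[0, t₁]`;
its speed is bounded by that of the flow. -/
theorem PlanarFlow.exists_trajectory (hW : PlanarFlow t₁ w w' D) {M : ℝ}
    (hM : ∀ τ ∈ Icc 0 t₁, ‖w τ‖ ≤ M) {t : ℝ} (ht : t ∈ Icc 0 t₁) (p : ℝ × ℝ) :
    ∃ X : ℝ → ℝ × ℝ, Continuous X ∧ X t = p ∧ ‖X t - X 0‖ ≤ M * t ∧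
      ∀ τ ∈ Icc 0 t₁, HasDerivWithinAt X (w τ (X τ)) (Icc 0 t₁) τ := by
  have hM0 : 0 ≤ M := (norm_nonneg _).trans (hM t ht)
  have h0 : (0 : ℝ) ≤ t₁ := ht.1.trans ht.2
  obtain ⟨C, hC⟩ := (isCompact_Icc (a := 0) (b := t₁)).exists_bound_of_continuousOn
    (f := fun τ => ‖D τ‖) (continuous_norm_boundedContinuousFunction hW.cont_fderiv).continuousOn
  have hwc := hW.cont
  have hP : IsPicardLindelof (fun τ p => w τ p) (⟨t, ht⟩ : Icc 0 t₁) p (M * t₁).toNNReal 0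
      M.toNNReal C.toNNReal := by
    refine ⟨fun τ hτ => ?_, fun x _ => Continuous.continuousOn (by fun_prop),
      fun τ hτ x _ => ?_, ?_⟩
    · refine LipschitzWith.lipschitzOnWith ?_
      refine lipschitzWith_of_nnnorm_fderiv_le (fun x => (hW.hasFDerivAt τ x).differentiableAt)
        fun x => ?_
      rw [(hW.hasFDerivAt τ x).fderiv, ← NNReal.coe_le_coe, coe_nnnorm]
      refine ((D τ).norm_coe_le_norm x).trans (((le_abs_self _).trans (hC τ hτ)).trans ?_)
      exact Real.le_coe_toNNReal C
    · rw [Real.coe_toNNReal _ hM0]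
      exact ((w τ).norm_coe_le_norm x).trans (hM τ hτ)
    · rw [Real.coe_toNNReal _ hM0, Real.coe_toNNReal _ (mul_nonneg hM0 h0)]
      simp only [NNReal.coe_zero, sub_zero]
      refine mul_le_mul_of_nonneg_left (max_le ?_ ?_) hM0
      · linarith [ht.1]
      · linarith [ht.2]
  obtain ⟨α, hα0, hα⟩ := hP.exists_eq_forall_mem_Icc_hasDerivWithinAt₀
  -- Constant extension outside `[0, t₁]` gives a continuous curve on the line.
  set X : ℝ → ℝ × ℝ := fun τ => α (projIcc 0 t₁ h0 τ) with hXdef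
  have hXα : ∀ τ ∈ Icc 0 t₁, X τ = α τ := fun τ hτ => by
    rw [hXdef]; dsimp only; rw [projIcc_of_mem h0 hτ]
  have hαc : ContinuousOn α (Icc 0 t₁) := fun τ hτ => (hα τ hτ).continuousWithinAt
  have hXd : ∀ τ ∈ Icc 0 t₁, HasDerivWithinAt X (w τ (X τ)) (Icc 0 t₁) τ := fun τ hτ => by
    rw [hXα τ hτ]
    exact (hα τ hτ).congr hXα (hXα τ hτ)
  refine ⟨X, ?_, (hXα t ht).trans hα0, ?_, hXd⟩
  · exact (continuousOn_iff_continuous_domRestrict.1 hαc).comp continuous_projIcc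
  · have := (convex_Icc 0 t₁).norm_image_sub_le_of_norm_hasDerivWithin_le hXd
      (fun τ hτ => ((w τ).norm_coe_le_norm _).trans (hM τ hτ)) ⟨le_rfl, h0⟩ ht
    rwa [sub_zero, Real.norm_of_nonneg ht.1] at this

/-- The rescaled weak form of the vorticity equation, in the frame moving with a trajectory. -/
theorem PlanarFlow.integral_planarCurl_trajectory (hW : PlanarFlow t₁ w w' D) {X : ℝ → ℝ × ℝ}
    (hXc : Continuous X) (hX : ∀ t ∈ Icc 0 t₁, HasDerivWithinAt X (w t (X t)) (Icc 0 t₁) t)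
    {θ : ℝ → ℝ} (hθ : ContDiff ℝ 1 θ) (hθc : HasCompactSupport θ) {t : ℝ} (ht : t ∈ Icc 0 t₁)
    {ε : ℝ} (hε : 0 < ε) :
    (∫ v : ℝ × ℝ, planarCurl (D t (X t + ε • v)) * (θ v.1 * θ v.2)) -
        ∫ v : ℝ × ℝ, planarCurl (D 0 (X 0 + ε • v)) * (θ v.1 * θ v.2) =
      ∫ τ in (0 : ℝ)..t, ∫ v : ℝ × ℝ, planarCurl (D τ (X τ + ε • v)) *
        ((ε⁻¹ • (w τ (X τ + ε • v) - w τ (X τ))).1 * (deriv θ v.1 * θ v.2) +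
          (ε⁻¹ • (w τ (X τ + ε • v) - w τ (X τ))).2 * (θ v.1 * deriv θ v.2)) := by
  have hwc := hW.cont
  have hsc : ContDiff ℝ 1 fun x => θ (ε⁻¹ * x) := hθ.comp (contDiff_const.mul contDiff_id)
  have hsc' : HasCompactSupport fun x => θ (ε⁻¹ * x) :=
    hθc.comp_homeomorph (Homeomorph.mulLeft₀ ε⁻¹ (inv_ne_zero hε.ne'))
  have hder : ∀ x, deriv (fun x => θ (ε⁻¹ * x)) x = ε⁻¹ * deriv θ (ε⁻¹ * x) := fun x => by
    rw [deriv_comp_mul_left, smul_eq_mul]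
  have key := hW.integral_planarCurl_sub hXc (X' := fun τ => w τ (X τ)) (by fun_prop) hX hsc hsc
    hsc' hsc' ht
  have hscale : ∀ f : ℝ × ℝ → ℝ, ∫ p, f p = ε ^ 2 * ∫ v, f (ε • v) := fun f => by
    rw [Measure.integral_comp_smul]
    simp only [Module.finrank_prod, Module.finrank_self, smul_eq_mul]
    rw [abs_of_pos (by positivity)]
    field_simp
  have h1 : ∀ x, ε⁻¹ * (ε * x) = x := fun x => by field_simp
  rw [hscale fun p => planarCurl (D t (X t + p)) * _,
    hscale fun p => planarCurl (D 0 (X 0 + p)) * _,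
    intervalIntegral.integral_congr (fun τ _ => hscale fun p => planarCurl (D τ (X τ + p)) * _)]
    at key
  simp only [hder] at key
  rw [intervalIntegral.integral_const_mul, ← mul_sub] at key
  have key2 := mul_left_cancel₀ (pow_ne_zero 2 hε.ne') key
  simp only [Prod.smul_fst, Prod.smul_snd, smul_eq_mul, h1] at key2 ⊢
  rw [key2]
  refine intervalIntegral.integral_congr fun τ _ => ?_
  congr 1
  funext v
  simp only [Prod.fst_sub, Prod.snd_sub]
  ring

end

theorem abs_planarCurl_le (A : ℝ × ℝ →L[ℝ] ℝ × ℝ) : |planarCurl A| ≤ 2 * ‖A‖ := by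
  have h1 : |(A (0, 1)).1| ≤ ‖A‖ := by
    have := (norm_fst_le (A (0, 1))).trans (A.le_opNorm _)
    simpa [Prod.norm_def] using this
  have h2 : |(A (1, 0)).2| ≤ ‖A‖ := by
    have := (norm_snd_le (A (1, 0))).trans (A.le_opNorm _)
    simpa [Prod.norm_def] using this
  have := abs_sub (A (0, 1)).1 (A (1, 0)).2
  rw [planarCurl]
  linarith

section

variable {t₁ : ℝ} {w w' : ℝ → BoundedContinuousFunction (ℝ × ℝ) (ℝ × ℝ)}
  {D : ℝ → BoundedContinuousFunction (ℝ × ℝ) (ℝ × ℝ →L[ℝ] ℝ × ℝ)}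

/-- Along a trajectory the vorticity is multiplied by a positive factor. Concentrating the test
function of the weak form at the moving point gives `κ' = b κ` for the vorticity `κ` at that
point. -/
theorem PlanarFlow.exists_planarCurl_eq_mul (hW : PlanarFlow t₁ w w' D) {X : ℝ → ℝ × ℝ}
    (hXc : Continuous X) (hX : ∀ t ∈ Icc 0 t₁, HasDerivWithinAt X (w t (X t)) (Icc 0 t₁) t)
    {t : ℝ} (ht : t ∈ Icc 0 t₁) :
    ∃ c : ℝ, 0 < c ∧ planarCurl (D t (X t)) = c * planarCurl (D 0 (X 0)) := by
  obtain ⟨θ, hθ, hθc, hθ1⟩ := exists_mollifier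
  have hDc := hW.cont_fderiv
  have hwc := hW.cont
  have hθ0 := hθ.continuous
  have hθ' : Continuous (deriv θ) := hθ.continuous_deriv le_rfl
  have hcc := continuous_planarCurl
  have hcs1 := hθc.deriv.mul_prod hθc
  have hcs2 := hθc.mul_prod hθc.deriv
  have hcs0 := hθc.mul_prod hθc
  set κ : ℝ → ℝ := fun τ => planarCurl (D τ (X τ)) with hκ
  have hκc : Continuous κ := by simp only [hκ]; fun_prop
  set b : ℝ → ℝ := fun τ => ∫ v : ℝ × ℝ, ((D τ (X τ) v).1 * (deriv θ v.1 * θ v.2) +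
    (D τ (X τ) v).2 * (θ v.1 * deriv θ v.2)) with hb
  set K : Set (ℝ × ℝ) := tsupport (fun p : ℝ × ℝ => deriv θ p.1 * θ p.2) ∪
    tsupport (fun p : ℝ × ℝ => θ p.1 * deriv θ p.2) with hK
  have hKc : IsCompact K := hcs1.isCompact.union hcs2.isCompact
  have hzero : ∀ p ∉ K, deriv θ p.1 * θ p.2 = 0 ∧ θ p.1 * deriv θ p.2 = 0 := fun p hp =>
    ⟨image_eq_zero_of_notMem_tsupport (f := fun p : ℝ × ℝ => deriv θ p.1 * θ p.2)
      fun hh => hp (.inl hh),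
    image_eq_zero_of_notMem_tsupport (f := fun p : ℝ × ℝ => θ p.1 * deriv θ p.2)
      fun hh => hp (.inr hh)⟩
  have hbc : Continuous b := by
    rw [← continuousOn_univ]
    refine continuousOn_integral_of_compact_support hKc ?_ fun τ p _ hp => ?_
    · refine Continuous.continuousOn ?_
      simp only [Function.uncurry_def]
      fun_prop
    · simp [hzero p hp]
  obtain ⟨C, hC⟩ := (isCompact_Icc (a := 0) (b := t₁)).exists_bound_of_continuousOn
    (f := fun τ => ‖D τ‖) (continuous_norm_boundedContinuousFunction hDc).continuousOn
  have hDb : ∀ τ ∈ Icc 0 t₁, ∀ p, ‖D τ p‖ ≤ C := fun τ hτ p =>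
    ((D τ).norm_coe_le_norm p).trans ((le_abs_self _).trans (hC τ hτ))
  have hC0 : 0 ≤ C := (norm_nonneg _).trans (hDb t ht 0)
  have hquot : ∀ ε : ℝ, 0 < ε → ∀ τ ∈ Icc 0 t₁, ∀ v,
      ‖ε⁻¹ • (w τ (X τ + ε • v) - w τ (X τ))‖ ≤ C * ‖v‖ := fun ε hε τ hτ v => by
    have := (convex_univ (𝕜 := ℝ) (E := ℝ × ℝ)).norm_image_sub_le_of_norm_hasFDerivWithin_le
      (fun p _ => (hW.hasFDerivAt τ p).hasFDerivWithinAt) (fun p _ => hDb τ hτ p)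
      (mem_univ (X τ)) (mem_univ (X τ + ε • v))
    rw [add_sub_cancel_left, norm_smul, Real.norm_of_nonneg hε.le] at this
    rw [norm_smul, norm_inv, Real.norm_of_nonneg hε.le, inv_mul_le_iff₀ hε]
    linarith
  -- The integrand of the rescaled weak form, and a bound on it that is uniform in `ε` and `τ`.
  set G : ℝ → ℝ → ℝ × ℝ → ℝ := fun ε τ v => planarCurl (D τ (X τ + ε • v)) *
        ((ε⁻¹ • (w τ (X τ + ε • v) - w τ (X τ))).1 * (deriv θ v.1 * θ v.2) +
          (ε⁻¹ • (w τ (X τ + ε • v) - w τ (X τ))).2 * (θ v.1 * deriv θ v.2)) with hG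
  set β : ℝ × ℝ → ℝ := fun v => (2 * C) * ((C * ‖v‖) * |deriv θ v.1 * θ v.2| +
    (C * ‖v‖) * |θ v.1 * deriv θ v.2|) with hβ
  have hβi : Integrable β := by
    refine Continuous.integrable_of_hasCompactSupport (by fun_prop) ?_
    exact ((hcs1.abs.mul_left).add (hcs2.abs.mul_left)).mul_left
  have hGβ : ∀ ε : ℝ, 0 < ε → ∀ τ ∈ Icc 0 t₁, ∀ v, ‖G ε τ v‖ ≤ β v := fun ε hε τ hτ v => by
    have hq := hquot ε hε τ hτ v
    rw [hG, hβ]; dsimp only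
    rw [norm_mul]
    refine mul_le_mul ((abs_planarCurl_le _).trans ?_) ((norm_add_le _ _).trans
      (add_le_add ?_ ?_)) (norm_nonneg _) (by positivity)
    · exact mul_le_mul_of_nonneg_left (hDb τ hτ _) (by norm_num)
    · rw [norm_mul]
      exact mul_le_mul_of_nonneg_right ((norm_fst_le _).trans hq) (norm_nonneg _)
    · rw [norm_mul]
      exact mul_le_mul_of_nonneg_right ((norm_snd_le _).trans hq) (norm_nonneg _)
  have hGc : ∀ ε, Continuous fun z : ℝ × (ℝ × ℝ) => G ε z.1 z.2 := fun ε => by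
    simp only [hG]; fun_prop
  have hinner : ∀ τ, τ ∈ Icc 0 t₁ → Filter.Tendsto (fun ε => ∫ v, G ε τ v)
      (nhdsWithin 0 (Ioi 0)) (nhds (b τ * κ τ)) := fun τ hτ => by
    have hlim : ∫ v : ℝ × ℝ, κ τ * ((D τ (X τ) v).1 * (deriv θ v.1 * θ v.2) +
        (D τ (X τ) v).2 * (θ v.1 * deriv θ v.2)) = b τ * κ τ := by
      rw [integral_const_mul, mul_comm]
    rw [← hlim]
    refine tendsto_integral_filter_of_dominated_convergence β
      (.of_forall fun ε => ((hGc ε).comp (by fun_prop : Continuous fun v : ℝ × ℝ =>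
        (τ, v))).aestronglyMeasurable) ?_ hβi (.of_forall fun v => ?_)
    · filter_upwards [self_mem_nhdsWithin] with ε hε
      exact .of_forall fun v => hGβ ε hε τ hτ v
    · have h1 : Filter.Tendsto (fun ε : ℝ => planarCurl (D τ (X τ + ε • v)))
          (nhdsWithin 0 (Ioi 0)) (nhds (κ τ)) := by
        have : Continuous fun ε : ℝ => planarCurl (D τ (X τ + ε • v)) := by fun_prop
        have := this.tendsto 0
        rw [zero_smul, add_zero] at this
        exact this.mono_left nhdsWithin_le_nhds
      have h2 : Filter.Tendsto (fun ε : ℝ => ε⁻¹ • (w τ (X τ + ε • v) - w τ (X τ)))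
          (nhdsWithin 0 (Ioi 0)) (nhds (D τ (X τ) v)) := by
        have hl : HasDerivAt (fun ε : ℝ => w τ (X τ + ε • v)) (D τ (X τ) v) 0 :=
          (hW.hasFDerivAt τ (X τ)).hasLineDerivAt v
        have := hl.tendsto_slope_zero_right
        simpa using this
      exact h1.mul (((continuous_fst.tendsto _).comp h2 |>.mul_const _).add
        ((continuous_snd.tendsto _).comp h2 |>.mul_const _))
  have hode : ∀ t ∈ Icc 0 t₁, κ t - κ 0 = ∫ τ in (0 : ℝ)..t, b τ * κ τ := fun t ht => by
    have hsub : ∀ τ ∈ uIoc 0 t, τ ∈ Icc 0 t₁ := fun τ hτ => by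
      rw [uIoc_of_le ht.1] at hτ
      exact ⟨hτ.1.le, hτ.2.trans ht.2⟩
    have hR : Filter.Tendsto (fun ε => ∫ τ in (0 : ℝ)..t, ∫ v, G ε τ v) (nhdsWithin 0 (Ioi 0))
        (nhds (∫ τ in (0 : ℝ)..t, b τ * κ τ)) := by
      refine intervalIntegral.tendsto_integral_filter_of_dominated_convergence
        (fun _ => ∫ v, β v) (.of_forall fun ε => ?_) ?_ intervalIntegrable_const
        (.of_forall fun τ hτ => hinner τ (hsub τ hτ))
      · refine Continuous.aestronglyMeasurable ?_
        rw [← continuousOn_univ]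
        refine continuousOn_integral_of_compact_support hKc (hGc ε).continuousOn
          fun τ p _ hp => ?_
        simp [hG, hzero p hp]
      · filter_upwards [self_mem_nhdsWithin] with ε hε
        exact .of_forall fun τ hτ => norm_integral_le_of_norm_le hβi
          (.of_forall fun v => hGβ ε hε τ (hsub τ hτ) v)
    have hL : ∀ s, Filter.Tendsto (fun ε : ℝ => ∫ v : ℝ × ℝ,
        planarCurl (D s (X s + ε • v)) * (θ v.1 * θ v.2)) (nhdsWithin 0 (Ioi 0))
        (nhds (κ s)) := fun s => by
      have hc : Continuous fun ε : ℝ => ∫ v : ℝ × ℝ,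
          planarCurl (D s (X s + ε • v)) * (θ v.1 * θ v.2) := by
        rw [← continuousOn_univ]
        refine continuousOn_integral_of_compact_support hcs0.isCompact
          (Continuous.continuousOn (by simp only [Function.uncurry_def]; fun_prop))
          fun ε p _ hp => ?_
        have := image_eq_zero_of_notMem_tsupport (f := fun p : ℝ × ℝ => θ p.1 * θ p.2) hp
        simp only [this, mul_zero]
      have := hc.tendsto 0
      simp only [zero_smul, add_zero] at this
      rw [integral_const_mul] at this
      have h1 : ∫ v : ℝ × ℝ, θ v.1 * θ v.2 = 1 := by
        have := integral_prod_mul (μ := (volume : Measure ℝ)) (ν := (volume : Measure ℝ)) θ θ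
        rw [hθ1, mul_one] at this
        exact this
      rw [h1, mul_one] at this
      exact this.mono_left nhdsWithin_le_nhds
    refine tendsto_nhds_unique ((hL t).sub (hL 0)) (hR.congr' ?_)
    filter_upwards [self_mem_nhdsWithin] with ε hε
    exact (hW.integral_planarCurl_trajectory hXc hX hθ hθc ht hε).symm
  exact ⟨_, Real.exp_pos _, (eq_mul_exp_of_eq_integral hκc hbc hode ht).trans (mul_comm _ _)⟩

end

section

variable {t₁ : ℝ} {w w' : ℝ → BoundedContinuousFunction (ℝ × ℝ) (ℝ × ℝ)}
  {D : ℝ → BoundedContinuousFunction (ℝ × ℝ) (ℝ × ℝ →L[ℝ] ℝ × ℝ)}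

theorem PlanarFlow.continuous_planarCurl (hW : PlanarFlow t₁ w w' D) :
    Continuous fun q : ℝ × (ℝ × ℝ) => planarCurl (D q.1 q.2) := by
  have hDc := hW.cont_fderiv
  have hcc := _root_.continuous_planarCurl
  fun_prop

/-- If the vorticity vanishes on the axis and is initially nonnegative in the half plane `ρ ≥ 0`,
then it stays nonnegative there: a trajectory that enters the half plane carries zero vorticity. -/
theorem PlanarFlow.planarCurl_nonneg (hW : PlanarFlow t₁ w w' D)
    (haxis : ∀ t ∈ Icc 0 t₁, ∀ p : ℝ × ℝ, p.1 = 0 → planarCurl (D t p) = 0)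
    (h0 : ∀ p : ℝ × ℝ, 0 ≤ p.1 → 0 ≤ planarCurl (D 0 p)) {t : ℝ} (ht : t ∈ Icc 0 t₁) {p : ℝ × ℝ}
    (hp : 0 ≤ p.1) : 0 ≤ planarCurl (D t p) := by
  obtain ⟨M, hM⟩ := (isCompact_Icc (a := 0) (b := t₁)).exists_bound_of_continuousOn
    (f := fun τ => ‖w τ‖) hW.cont.norm.continuousOn
  obtain ⟨X, hXc, hXt, -, hX⟩ := hW.exists_trajectory (M := M)
    (fun τ hτ => (le_abs_self _).trans (hM τ hτ)) ht p
  obtain ⟨c, hc, hct⟩ := hW.exists_planarCurl_eq_mul hXc hX ht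
  rw [← hXt, hct]
  rcases le_or_gt 0 (X 0).1 with h | h
  · exact mul_nonneg hc.le (h0 _ h)
  -- A trajectory that starts in the opposite half plane crosses the axis at some time `τ`.
  · obtain ⟨τ, hτ, hτ0⟩ : (0 : ℝ) ∈ (fun τ => (X τ).1) '' Icc 0 t :=
      intermediate_value_Icc ht.1 (continuous_fst.comp hXc).continuousOn
        ⟨h.le, by rw [Function.comp_apply, hXt]; exact hp⟩
    have hτ' : τ ∈ Icc 0 t₁ := ⟨hτ.1, hτ.2.trans ht.2⟩
    obtain ⟨c', hc', hcτ⟩ := hW.exists_planarCurl_eq_mul hXc hX hτ'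
    rw [haxis τ hτ' _ hτ0] at hcτ
    rcases mul_eq_zero.1 hcτ.symm with h1 | h1
    · exact absurd h1 hc'.ne'
    · rw [h1, mul_zero]

/-- A vorticity with bounded support keeps bounded support on a bounded time interval. -/
theorem PlanarFlow.exists_planarCurl_eq_zero (hW : PlanarFlow t₁ w w' D) {R₀ : ℝ}
    (h0 : ∀ p : ℝ × ℝ, R₀ < ‖p‖ → planarCurl (D 0 p) = 0) :
    ∃ R, 0 < R ∧ ∀ t ∈ Icc 0 t₁, ∀ p : ℝ × ℝ, R < ‖p‖ → planarCurl (D t p) = 0 := by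
  obtain ⟨M, hM⟩ := (isCompact_Icc (a := 0) (b := t₁)).exists_bound_of_continuousOn
    (f := fun τ => ‖w τ‖) hW.cont.norm.continuousOn
  refine ⟨|R₀| + |M| * |t₁| + 1, by positivity, fun t ht p hp => ?_⟩
  obtain ⟨X, hXc, hXt, hdist, hX⟩ := hW.exists_trajectory (M := M)
    (fun τ hτ => (le_abs_self _).trans (hM τ hτ)) ht p
  obtain ⟨c, hc, hct⟩ := hW.exists_planarCurl_eq_mul hXc hX ht
  rw [← hXt, hct, h0, mul_zero]
  have h1 : M * t ≤ |M| * |t₁| :=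
    mul_le_mul (le_abs_self _) (ht.2.trans (le_abs_self _)) ht.1 (abs_nonneg _)
  have h2 := norm_sub_norm_le (X t) (X 0)
  rw [hXt] at h2 hdist
  linarith [le_abs_self R₀]

end

/-! ### Restriction of a solution to the meridional plane -/

/-- Composition on the right with the embedding of the meridional plane and on the left with a
linear map, as an operator between spaces of bounded continuous functions. -/
noncomputable def restrictPlane (d : ℕ) {F G : Type*} [NormedAddCommGroup F] [NormedSpace ℝ F]
    [NormedAddCommGroup G] [NormedSpace ℝ G] (L : F →L[ℝ] G) :
    BoundedContinuousFunction (Euc d) F →L[ℝ] BoundedContinuousFunction (ℝ × ℝ) G :=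
  (L.compLeftContinuousBounded (ℝ × ℝ)).comp
    (LinearMap.mkContinuous
      ({ toFun := fun f => f.compContinuous ⟨planeEmb d, (planeEmb d).continuous⟩
         map_add' := fun _ _ => rfl
         map_smul' := fun _ _ => rfl } :
        BoundedContinuousFunction (Euc d) F →ₗ[ℝ] BoundedContinuousFunction (ℝ × ℝ) F) 1 fun f => by
      rw [one_mul]
      exact (BoundedContinuousFunction.norm_le (norm_nonneg _)).2 fun p => f.norm_coe_le_norm _)

theorem restrictPlane_apply (d : ℕ) {F G : Type*} [NormedAddCommGroup F] [NormedSpace ℝ F]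
    [NormedAddCommGroup G] [NormedSpace ℝ G] (L : F →L[ℝ] G)
    (f : BoundedContinuousFunction (Euc d) F) (p : ℝ × ℝ) :
    restrictPlane d L f p = L (f (planeEmb d p)) := rfl

theorem Icc_subset_timeInterval {T : EReal} {t₁ : ℝ} (h : t₁ ∈ timeInterval T) :
    Icc 0 t₁ ⊆ timeInterval T := fun _ hτ =>
  ⟨hτ.1, (EReal.coe_le_coe_iff.2 hτ.2).trans_lt h.2⟩

/-- The restriction of an axisymmetric solution without swirl to the meridional plane is a planar
flow. -/
theorem IsEulerSolution.exists_planarFlow {d : ℕ} (hd : 3 ≤ d) {s : ℝ} {T : EReal}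
    {u : ℝ → Euc d → Euc d} (hs : 1 + (d : ℝ) / 2 < s) (hT : 0 < T) (hu : IsEulerSolution d s T u)
    (hax : ∀ t ∈ timeInterval T, IsAxisymmetricNoSwirl (u t)) {t₁ : ℝ}
    (ht₁ : t₁ ∈ timeInterval T) :
    ∃ (w w' : ℝ → BoundedContinuousFunction (ℝ × ℝ) (ℝ × ℝ))
      (D : ℝ → BoundedContinuousFunction (ℝ × ℝ) (ℝ × ℝ →L[ℝ] ℝ × ℝ)), PlanarFlow t₁ w w' D ∧
      ∀ t ∈ Icc 0 t₁, ∀ p, w t p = planarField (u t) p := by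
  obtain ⟨U, U', D, hU, hU', hUc', hD, hDc, -, -⟩ := hu.exists_uniform_curves hs hT
  obtain ⟨π, hπ⟩ := hu.momentum
  have hsub := Icc_subset_timeInterval ht₁
  -- Clamping the time to `[0, t₁]` makes all curves continuous on the whole line.
  set cl : ℝ → ℝ := fun τ => (projIcc 0 t₁ ht₁.1 τ : ℝ) with hcl
  have hclc : Continuous cl := continuous_subtype_val.comp continuous_projIcc
  have hclm : ∀ τ, cl τ ∈ timeInterval T := fun τ => hsub (projIcc 0 t₁ ht₁.1 τ).2
  have hcle : ∀ τ ∈ Icc 0 t₁, cl τ = τ := fun τ hτ => by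
    rw [hcl]; dsimp only; rw [projIcc_of_mem _ hτ]
  have hUc : ContinuousOn U (timeInterval T) := fun t ht => (hU' t ht).continuousWithinAt
  set L : (Euc d →L[ℝ] Euc d) →L[ℝ] (ℝ × ℝ →L[ℝ] ℝ × ℝ) := planarDeriv d
  have hval : ∀ t, t ∈ timeInterval T → ∀ p,
      restrictPlane d (planeProj d) (U t) p = planarField (u t) p := fun t ht p => by
    rw [restrictPlane_apply, planarField_eq, hU t ht]
  refine ⟨fun t => restrictPlane d (planeProj d) (U (cl t)),
    fun t => restrictPlane d (planeProj d) (U' (cl t)),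
    fun t => restrictPlane d (planarDeriv d) (D (cl t)), ⟨?_, ?_, ?_, ?_, ?_, ?_⟩, ?_⟩
  · exact (restrictPlane d _).continuous.comp (hUc.comp_continuous hclc hclm)
  · exact (restrictPlane d _).continuous.comp (hUc'.comp_continuous hclc hclm)
  · exact (restrictPlane d _).continuous.comp (hDc.comp_continuous hclc hclm)
  · intro t ht
    have h1 := ((restrictPlane d (planeProj d)).hasFDerivAt (x := U t)).comp_hasDerivWithinAt t
      ((hU' t (hsub ht)).mono hsub)
    rw [hcle t ht]
    refine h1.congr (fun τ hτ => ?_) ?_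
    · rw [hcle τ hτ]; rfl
    · rw [hcle t ht]; rfl
  · intro t p
    have h1 := hasFDerivAt_planarField (p := p) (hD (cl t) (hclm t) (planeEmb d p))
    refine h1.congr_of_eventuallyEq (.of_forall fun q => ?_)
    exact hval _ (hclm t) q
  · intro t
    obtain ⟨hπd, hπt⟩ := hπ (cl t) (hclm t)
    have ht := hclm t
    refine ⟨fun p => π (cl t) (planeEmb d p), hπd.comp (planeEmb d).differentiable, fun p => ?_⟩
    set x := planeEmb d p with hx
    have e1 : U' (cl t) x = -(D (cl t) x (u (cl t) x)) - gradient (π (cl t)) x := by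
      have h1 := hπt x
      rw [(hD (cl t) ht x).fderiv] at h1
      have h2 : HasDerivWithinAt (fun τ => u τ x) (U' (cl t) x) (timeInterval T) (cl t) := by
        have := ((BoundedContinuousFunction.evalCLM ℝ x).hasFDerivAt
          (x := U (cl t))).comp_hasDerivWithinAt (cl t) (hU' (cl t) ht)
        refine this.congr (fun τ hτ => ?_) ?_
        · rw [← hU τ hτ]; rfl
        · rw [← hU _ ht]; rfl
      exact (uniqueDiffOn_timeInterval T hT _ ht).eq_deriv _ h2 h1
    -- The convection term restricts to the plane because the velocity is tangent to it.
    have e2 : planarDeriv d (D (cl t) x) (restrictPlane d (planeProj d) (U (cl t)) p) =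
        planeProj d (D (cl t) x (u (cl t) x)) := by
      rw [hval _ ht, planarDeriv_apply, (hax _ ht).planeEmb_planarField hd]
    have e3 : ∀ a : ℝ × ℝ, fderiv ℝ (fun p => π (cl t) (planeEmb d p)) p a =
        inner ℝ (gradient (π (cl t)) x) (planeEmb d a) := fun a => by
      have := ((hπd x).hasFDerivAt.comp p (planeEmb d).hasFDerivAt).fderiv
      rw [Function.comp_def] at this
      rw [this, inner_gradient_left]; rfl
    change planeProj d (U' (cl t) x) + planarDeriv d (D (cl t) x) _ = _
    rw [e2, e1, ← map_add, e3, e3, planeProj_apply]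
    have : -(D (cl t) x) (u (cl t) x) - gradient (π (cl t)) x + (D (cl t) x) (u (cl t) x) =
        -gradient (π (cl t)) x := by abel
    rw [this, inner_neg_left, inner_neg_left]
    simp [planeEmb_apply, meridian]
  · intro t ht p
    simp only [hcle t ht]
    exact hval t (hsub ht) p

/-- The data of an axisymmetric solution on `[0, t₁]` in the meridional plane: the planar flow,
whose vorticity is nonnegative on the half plane and vanishes outside a fixed ball. -/
theorem IsEulerSolution.exists_planarFlow_support {d : ℕ} (hd : 3 ≤ d) {s : ℝ} {T : EReal}
    {u : ℝ → Euc d → Euc d} (hs : 1 + (d : ℝ) / 2 < s) (hT : 0 < T) (hu : IsEulerSolution d s T u)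
    (hax : ∀ t ∈ timeInterval T, IsAxisymmetricNoSwirl (u t))
    (hpos : ∀ x, 0 ≤ vorticityOn (u 0) x) (hsupp : HasCompactSupport (vorticityOn (u 0))) {t₁ : ℝ}
    (ht₁ : t₁ ∈ timeInterval T) :
    ∃ (w w' : ℝ → BoundedContinuousFunction (ℝ × ℝ) (ℝ × ℝ))
      (D : ℝ → BoundedContinuousFunction (ℝ × ℝ) (ℝ × ℝ →L[ℝ] ℝ × ℝ)), PlanarFlow t₁ w w' D ∧
      (∀ t ∈ Icc 0 t₁, ∀ p, w t p = planarField (u t) p) ∧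
      (∀ t ∈ Icc 0 t₁, ∀ p : ℝ × ℝ, vorticity (u t) p.1 p.2 = planarCurl (D t p)) ∧
      (∀ t ∈ Icc 0 t₁, ∀ p : ℝ × ℝ, 0 ≤ p.1 → 0 ≤ planarCurl (D t p)) ∧
      ∃ R, 0 < R ∧ ∀ t ∈ Icc 0 t₁, ∀ p : ℝ × ℝ, R < ‖p‖ → planarCurl (D t p) = 0 := by
  obtain ⟨w, w', D, hW, hw⟩ := hu.exists_planarFlow hd hs hT hax ht₁
  have hsub := Icc_subset_timeInterval ht₁
  have hcurl : ∀ t ∈ Icc 0 t₁, ∀ p : ℝ × ℝ, vorticity (u t) p.1 p.2 = planarCurl (D t p) :=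
    fun t ht p => vorticity_eq_planarCurl
      ((hW.hasFDerivAt t p).congr_of_eventuallyEq (.of_forall fun q => (hw t ht q).symm))
  have h0 : (0 : ℝ) ∈ Icc 0 t₁ := ⟨le_rfl, ht₁.1⟩
  have hodd : ∀ t ∈ Icc 0 t₁, ∀ ρ z, vorticity (u t) (-ρ) z = -vorticity (u t) ρ z :=
    fun t ht => (hax t (hsub ht)).vorticity_neg hd (hu.differentiable t (hsub ht))
  have hon : ∀ ρ z, vorticityOn (u 0) (meridian d ρ z) = vorticity (u 0) |ρ| z := fun ρ z => by
    rw [vorticityOn, rCoord_meridian hd, zCoord_meridian hd]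
  refine ⟨w, w', D, hW, hw, hcurl, fun t ht p hp => ?_, ?_⟩
  · refine hW.planarCurl_nonneg (fun t ht p hp => ?_) (fun p hp => ?_) ht hp
    · rw [← hcurl t ht, hp]
      have := hodd t ht 0 p.2
      rw [neg_zero] at this
      linarith
    · rw [← hcurl 0 h0]
      have := hpos (meridian d p.1 p.2)
      rwa [hon, abs_of_nonneg hp] at this
  · obtain ⟨R₀, hR₀⟩ := hsupp.isCompact.isBounded.exists_norm_le
    refine hW.exists_planarCurl_eq_zero (R₀ := R₀) fun p hp => ?_
    have hz : vorticityOn (u 0) (meridian d p.1 p.2) = 0 := by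
      refine image_eq_zero_of_notMem_tsupport fun hm => ?_
      have h1 := hR₀ _ hm
      have h2 := planeProj_planeEmb hd p
      rw [planeProj_apply, planeEmb_apply] at h2
      have h3 := abs_real_inner_le_norm (meridian d p.1 p.2) (unitVec d 0)
      have h4 := abs_real_inner_le_norm (meridian d p.1 p.2) (eZ d)
      rw [norm_unitVec (by omega), mul_one] at h3
      rw [eZ, norm_unitVec (by omega), mul_one] at h4
      have h5 := max_le h3 h4
      rw [← eZ, ← Real.norm_eq_abs, ← Real.norm_eq_abs] at h5
      have h6 : ‖p‖ = max ‖(inner ℝ (meridian d p.1 p.2) (unitVec d 0) : ℝ)‖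
          ‖(inner ℝ (meridian d p.1 p.2) (eZ d) : ℝ)‖ := by
        conv_lhs => rw [← h2, Prod.norm_def]
      linarith
    rw [hon] at hz
    rw [← hcurl 0 h0]
    rcases le_total 0 p.1 with h | h
    · rwa [abs_of_nonneg h] at hz
    · rw [abs_of_nonpos h, hodd 0 h0] at hz
      linarith

/-! ### The regularised Biot–Savart law -/

/-- Integration by parts for differentiable functions in `H¹`; no compact support is needed. -/
theorem integral_mul_lineDeriv_of_memLp {E : Type*} [NormedAddCommGroup E] [NormedSpace ℝ E]
    [FiniteDimensional ℝ E] [MeasurableSpace E] [BorelSpace E] {μ : Measure E}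
    [μ.IsAddHaarMeasure] {f f' g g' : E → ℝ} {e : E} (hf : MemLp f 2 μ) (hf' : MemLp f' 2 μ)
    (hg : MemLp g 2 μ) (hg' : MemLp g' 2 μ) (hff' : ∀ x, HasLineDerivAt ℝ f (f' x) x e)
    (hgg' : ∀ x, HasLineDerivAt ℝ g (g' x) x e) :
    ∫ x, f x * g' x ∂μ = -∫ x, f' x * g x ∂μ :=
  integral_bilinear_hasLineDerivAt_right_eq_neg_left_of_integrable
    (B := ContinuousLinearMap.mul ℝ ℝ) (hf'.integrable_mul hg) (hf.integrable_mul hg')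
    (hf.integrable_mul hg) (fun x _ => hff' x) (fun x _ => hgg' x)

/-- For a solenoidal field `v` and a gradient field `A`, the divergence of `A` tested with a
component of `v` is the antisymmetric part of the derivative of `v` tested with `A`. -/
theorem integral_inner_mul_divergence {d : ℕ} {v A : Euc d → Euc d}
    {v' A' : Euc d → Euc d →L[ℝ] Euc d} (hv : ∀ x, HasFDerivAt v (v' x) x)
    (hA : ∀ x, HasFDerivAt A (A' x) x) (hv2 : MemLp v 2) (hv'2 : MemLp v' 2) (hA2 : MemLp A 2)
    (hA'2 : MemLp A' 2) (hsymm : ∀ y a b, (inner ℝ (A' y a) b : ℝ) = inner ℝ (A' y b) a)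
    (hdiv : ∀ x, ∑ i, v' x (EuclideanSpace.single i 1) i = 0) (e : Euc d) :
    ∫ y, inner ℝ (v y) e * ∑ i, A' y (EuclideanSpace.single i 1) i =
      -∫ y, (inner ℝ (v' y (A y)) e - inner ℝ (v' y e) (A y)) := by
  set b : Fin d → Euc d := fun i => EuclideanSpace.single i 1 with hb
  have hib : ∀ (x : Euc d) i, (inner ℝ x (b i) : ℝ) = x i := fun x i => by
    rw [real_inner_comm, hb, EuclideanSpace.inner_single_left]; simp
  have hsum : ∀ x : Euc d, x = ∑ i, x i • b i := fun x => by
    ext j; simp [hb, Pi.single_apply]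
  have hinner : ∀ x y : Euc d, (inner ℝ x y : ℝ) = ∑ i, x i * y i := fun x y => by
    rw [PiLp.inner_apply]; simp [mul_comm]
  have m1 : ∀ a, MemLp (fun y => (inner ℝ (v y) a : ℝ)) 2 := fun a => hv2.inner_const a
  have m2 : ∀ a, MemLp (fun y => (inner ℝ (A y) a : ℝ)) 2 := fun a => hA2.inner_const a
  have m3 : ∀ a c, MemLp (fun y => (inner ℝ (v' y a) c : ℝ)) 2 := fun a c =>
    MemLp.inner_const ((ContinuousLinearMap.apply ℝ (Euc d) a).comp_memLp' hv'2) c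
  have m4 : ∀ a c, MemLp (fun y => (inner ℝ (A' y a) c : ℝ)) 2 := fun a c =>
    MemLp.inner_const ((ContinuousLinearMap.apply ℝ (Euc d) a).comp_memLp' hA'2) c
  have l1 : ∀ a c x, HasLineDerivAt ℝ (fun y => (inner ℝ (v y) a : ℝ)) (inner ℝ (v' x c) a) x c :=
    fun a c x => by
      have := (((innerSL ℝ a).hasFDerivAt).comp x (hv x)).hasLineDerivAt c
      simpa [Function.comp_def, real_inner_comm] using this
  have l2 : ∀ a c x, HasLineDerivAt ℝ (fun y => (inner ℝ (A y) a : ℝ)) (inner ℝ (A' x c) a) x c :=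
    fun a c x => by
      have := (((innerSL ℝ a).hasFDerivAt).comp x (hA x)).hasLineDerivAt c
      simpa [Function.comp_def, real_inner_comm] using this
  have msum : ∀ F G : Fin d → Euc d → ℝ, (∀ i, MemLp (F i) 2) → (∀ i, MemLp (G i) 2) →
      ∫ y, ∑ i, F i y * G i y = ∑ i, ∫ y, F i y * G i y := fun F G hF hG =>
    integral_finsetSum _ fun i _ => (hF i).integrable_mul (hG i)
  -- `h1` is the main integration by parts. The remaining terms, `h2` and `h3`, show that
  -- `∫ ⟨v' e, A⟩ = ∫ (div v) ⟨A, e⟩ = 0`, because the derivative of `A` is symmetric.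
  have h1 : ∀ i, ∫ y, inner ℝ (v y) e * inner ℝ (A' y (b i)) (b i) =
      -∫ y, inner ℝ (v' y (b i)) e * inner ℝ (A y) (b i) := fun i =>
    integral_mul_lineDeriv_of_memLp (m1 e) (m3 _ _) (m2 _) (m4 _ _) (l1 _ _) (l2 _ _)
  have h2 : ∀ i, ∫ y, inner ℝ (v y) (b i) * inner ℝ (A' y (b i)) e =
      -∫ y, inner ℝ (v' y (b i)) (b i) * inner ℝ (A y) e := fun i =>
    integral_mul_lineDeriv_of_memLp (m1 _) (m3 _ _) (m2 _) (m4 _ _) (l1 _ _) (l2 _ _)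
  have h3 : ∀ i, ∫ y, inner ℝ (v y) (b i) * inner ℝ (A' y e) (b i) =
      -∫ y, inner ℝ (v' y e) (b i) * inner ℝ (A y) (b i) := fun i =>
    integral_mul_lineDeriv_of_memLp (m1 _) (m3 _ _) (m2 _) (m4 _ _) (l1 _ _) (l2 _ _)
  have s1 : ∫ y, inner ℝ (v y) e * ∑ i, A' y (b i) i = -∫ y, inner ℝ (v' y (A y)) e := by
    have e1 : ∀ y, inner ℝ (v y) e * ∑ i, A' y (b i) i =
        ∑ i, inner ℝ (v y) e * inner ℝ (A' y (b i)) (b i) := fun y => by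
      rw [Finset.mul_sum]; simp only [hib]
    have e2 : ∀ y, (inner ℝ (v' y (A y)) e : ℝ) =
        ∑ i, inner ℝ (v' y (b i)) e * inner ℝ (A y) (b i) := fun y => by
      conv_lhs => rw [hsum (A y)]
      simp only [map_sum, map_smul, sum_inner, real_inner_smul_left, hib, mul_comm]
    simp only [e1, e2]
    rw [msum _ _ (fun i => m1 e) fun i => m4 (b i) (b i),
      msum _ _ (fun i => m3 (b i) e) fun i => m2 (b i),
      ← Finset.sum_neg_distrib]
    exact Finset.sum_congr rfl fun i _ => h1 i
  have s2 : ∫ y, inner ℝ (v' y e) (A y) = (0 : ℝ) := by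
    have e1 : ∀ y, (inner ℝ (v' y e) (A y) : ℝ) =
        ∑ i, inner ℝ (v' y e) (b i) * inner ℝ (A y) (b i) := fun y => by
      rw [hinner]; simp only [hib]
    simp only [e1]
    rw [msum _ _ (fun i => m3 e (b i)) fun i => m2 (b i)]
    have e2 : ∀ i, ∫ y, inner ℝ (v' y e) (b i) * inner ℝ (A y) (b i) =
        ∫ y, inner ℝ (v' y (b i)) (b i) * inner ℝ (A y) e := fun i => by
      have h2' := h2 i
      simp only [fun y => hsymm y (b i) e] at h2'
      linarith [h3 i]
    rw [Finset.sum_congr rfl fun i _ => e2 i,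
      ← msum _ _ (fun i => m3 (b i) (b i)) fun i => m2 e]
    have e3 : ∀ y, ∑ i, inner ℝ (v' y (b i)) (b i) * inner ℝ (A y) e = (0 : ℝ) := fun y => by
      rw [← Finset.sum_mul]
      simp only [hib]
      exact mul_eq_zero_of_left (hdiv y) _
    simp only [e3, integral_zero]
  have i1 : Integrable fun y => (inner ℝ (v' y (A y)) e : ℝ) := by
    have : (fun y => (inner ℝ (v' y (A y)) e : ℝ)) =
        fun y => ∑ i, inner ℝ (v' y (b i)) e * inner ℝ (A y) (b i) := funext fun y => by
      conv_lhs => rw [hsum (A y)]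
      simp only [map_sum, map_smul, sum_inner, real_inner_smul_left, hib, mul_comm]
    rw [this]
    exact integrable_finsetSum _ fun i _ => (m3 (b i) e).integrable_mul (m2 (b i))
  have i2 : Integrable fun y => (inner ℝ (v' y e) (A y) : ℝ) := by
    have : (fun y => (inner ℝ (v' y e) (A y) : ℝ)) =
        fun y => ∑ i, inner ℝ (v' y e) (b i) * inner ℝ (A y) (b i) := funext fun y => by
      rw [hinner]; simp only [hib]
    rw [this]
    exact integrable_finsetSum _ fun i _ => (m3 e (b i)).integrable_mul (m2 (b i))
  rw [s1, integral_sub i1 i2, s2, sub_zero]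

/-- The regularised gradient `y ↦ (ε² + |y|²)^{-d/2} y` of the Newtonian potential. -/
noncomputable def regNewton (d : ℕ) (ε : ℝ) (y : Euc d) : Euc d :=
  (ε ^ 2 + ‖y‖ ^ 2) ^ (-(d : ℝ) / 2) • y

/-- The derivative of `regNewton`. -/
noncomputable def regNewtonDeriv (d : ℕ) (ε : ℝ) (y : Euc d) : Euc d →L[ℝ] Euc d :=
  (ε ^ 2 + ‖y‖ ^ 2) ^ (-(d : ℝ) / 2) • ContinuousLinearMap.id ℝ (Euc d) -
    ((d : ℝ) * (ε ^ 2 + ‖y‖ ^ 2) ^ (-(d : ℝ) / 2 - 1)) • (innerSL ℝ y).smulRight y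

theorem regNewtonDeriv_apply {d : ℕ} {ε : ℝ} (y a : Euc d) : regNewtonDeriv d ε y a =
    (ε ^ 2 + ‖y‖ ^ 2) ^ (-(d : ℝ) / 2) • a -
      ((d : ℝ) * (ε ^ 2 + ‖y‖ ^ 2) ^ (-(d : ℝ) / 2 - 1)) • (inner ℝ y a : ℝ) • y := rfl

theorem hasFDerivAt_regNewton {d : ℕ} {ε : ℝ} (hε : 0 < ε) (y : Euc d) :
    HasFDerivAt (regNewton d ε) (regNewtonDeriv d ε y) y := by
  have hpos : (0 : ℝ) < ε ^ 2 + ‖y‖ ^ 2 := by positivity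
  have h1 : HasFDerivAt (fun y : Euc d => ε ^ 2 + ‖y‖ ^ 2) (2 • innerSL ℝ y) y :=
    ((hasStrictFDerivAt_norm_sq y).hasFDerivAt).const_add _
  have h2 := (h1.rpow_const (p := -(d : ℝ) / 2) (.inl hpos.ne')).smul (hasFDerivAt_id y)
  refine h2.congr_fderiv (ContinuousLinearMap.ext fun a => ?_)
  rw [regNewtonDeriv_apply]
  change (ε ^ 2 + ‖y‖ ^ 2) ^ (-(d : ℝ) / 2) • a + ((-(d : ℝ) / 2 * (ε ^ 2 + ‖y‖ ^ 2) ^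
    (-(d : ℝ) / 2 - 1)) * (2 • inner ℝ y a)) • y = _
  rw [sub_eq_add_neg (_ • a), ← neg_smul, smul_smul]
  congr 2
  rw [nsmul_eq_mul]; push_cast; ring

theorem inner_regNewtonDeriv {d : ℕ} {ε : ℝ} (y a b : Euc d) :
    (inner ℝ (regNewtonDeriv d ε y a) b : ℝ) = inner ℝ (regNewtonDeriv d ε y b) a := by
  simp only [regNewtonDeriv_apply, inner_sub_left, real_inner_smul_left]
  rw [real_inner_comm a b]; ring

/-- The divergence of the regularised gradient is an approximate identity, up to a factor. -/
theorem sum_regNewtonDeriv {d : ℕ} {ε : ℝ} (hε : 0 < ε) (y : Euc d) :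
    ∑ i, regNewtonDeriv d ε y (EuclideanSpace.single i 1) i =
      d * ε ^ 2 * (ε ^ 2 + ‖y‖ ^ 2) ^ (-(d : ℝ) / 2 - 1) := by
  have hpos : (0 : ℝ) < ε ^ 2 + ‖y‖ ^ 2 := by positivity
  have h1 : ∀ i, regNewtonDeriv d ε y (EuclideanSpace.single i 1) i =
      (ε ^ 2 + ‖y‖ ^ 2) ^ (-(d : ℝ) / 2) -
        (d : ℝ) * (ε ^ 2 + ‖y‖ ^ 2) ^ (-(d : ℝ) / 2 - 1) * y i ^ 2 := fun i => by
    have h : (EuclideanSpace.single i (1 : ℝ) : Euc d) i = 1 := by simp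
    rw [regNewtonDeriv_apply, real_inner_comm, EuclideanSpace.inner_single_left, map_one, one_mul]
    simp only [PiLp.sub_apply, PiLp.smul_apply, smul_eq_mul, h]
    ring
  have h2 : ‖y‖ ^ 2 = ∑ i, y i ^ 2 := EuclideanSpace.real_norm_sq_eq y
  have h3 : (ε ^ 2 + ‖y‖ ^ 2) ^ (-(d : ℝ) / 2) =
      (ε ^ 2 + ‖y‖ ^ 2) * (ε ^ 2 + ‖y‖ ^ 2) ^ (-(d : ℝ) / 2 - 1) := by
    rw [Real.rpow_sub_one hpos.ne']; field_simp
  simp only [h1]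
  rw [Finset.sum_sub_distrib, ← Finset.mul_sum, ← h2, h3]
  simp; ring

theorem integrable_rpow_add_norm_sq {d : ℕ} {ε r : ℝ} (hε : 0 < ε) (hr : (d : ℝ) < r) :
    Integrable fun y : Euc d => (ε ^ 2 + ‖y‖ ^ 2) ^ (-r / 2) := by
  have hr0 : 0 ≤ r := (Nat.cast_nonneg d).trans hr.le
  set c : ℝ := min 1 (ε ^ 2) with hc
  have hc0 : 0 < c := by positivity
  refine ((integrable_rpow_neg_one_add_norm_sq (μ := (volume : Measure (Euc d))) (r := r)
    (by simpa using hr)).const_mul (c ^ (-r / 2))).mono' ?_ (.of_forall fun y => ?_)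
  · exact (Measurable.aestronglyMeasurable (by fun_prop))
  · rw [Real.norm_of_nonneg (by positivity), ← Real.mul_rpow hc0.le (by positivity)]
    refine Real.rpow_le_rpow_of_nonpos (by positivity) ?_ (by linarith)
    have h1 : c ≤ 1 := min_le_left _ _
    have h2 : c ≤ ε ^ 2 := min_le_right _ _
    nlinarith [sq_nonneg ‖y‖]

theorem memLp_two_of_norm_le_rpow {d : ℕ} {F : Type*} [NormedAddCommGroup F] {f : Euc d → F}
    (hf : AEStronglyMeasurable f) {ε r C : ℝ} (hε : 0 < ε) (hr : (d : ℝ) < 2 * r)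
    (h : ∀ y, ‖f y‖ ≤ C * (ε ^ 2 + ‖y‖ ^ 2) ^ (-r / 2)) : MemLp f 2 := by
  rw [memLp_two_iff_integrable_sq_norm hf]
  refine ((integrable_rpow_add_norm_sq hε hr).const_mul (C ^ 2)).mono' (by fun_prop)
    (.of_forall fun y => ?_)
  have hpos : (0 : ℝ) < ε ^ 2 + ‖y‖ ^ 2 := by positivity
  rw [Real.norm_of_nonneg (by positivity)]
  refine (pow_le_pow_left₀ (norm_nonneg _) (h y) 2).trans_eq ?_
  rw [mul_pow, ← Real.rpow_natCast (_ ^ _), ← Real.rpow_mul hpos.le]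
  congr 2; push_cast; ring

theorem continuous_regNewton {d : ℕ} {ε : ℝ} (hε : 0 < ε) : Continuous (regNewton d ε) :=
  continuous_iff_continuousAt.2 fun y => (hasFDerivAt_regNewton hε y).continuousAt

theorem memLp_regNewton {d : ℕ} (hd : 3 ≤ d) {ε : ℝ} (hε : 0 < ε) : MemLp (regNewton d ε) 2 := by
  have hd' : (3 : ℝ) ≤ d := by exact_mod_cast hd
  refine memLp_two_of_norm_le_rpow (continuous_regNewton hε).aestronglyMeasurable (C := 1)
    (r := d - 1) hε (by linarith) fun y => ?_
  have hpos : (0 : ℝ) < ε ^ 2 + ‖y‖ ^ 2 := by positivity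
  have h1 : ‖y‖ ≤ (ε ^ 2 + ‖y‖ ^ 2) ^ (1 / 2 : ℝ) := by
    rw [← Real.sqrt_eq_rpow]; exact Real.le_sqrt_of_sq_le (by nlinarith)
  rw [regNewton, norm_smul, Real.norm_of_nonneg (by positivity), one_mul]
  refine (mul_le_mul_of_nonneg_left h1 (by positivity)).trans_eq ?_
  rw [← Real.rpow_add hpos]
  congr 1; ring

theorem memLp_regNewtonDeriv {d : ℕ} (hd : 3 ≤ d) {ε : ℝ} (hε : 0 < ε) :
    MemLp (regNewtonDeriv d ε) 2 := by
  have hd' : (3 : ℝ) ≤ d := by exact_mod_cast hd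
  have hpos : ∀ y : Euc d, (0 : ℝ) < ε ^ 2 + ‖y‖ ^ 2 := fun y => by positivity
  have hc : Continuous (regNewtonDeriv d ε) := by
    have h1 : ∀ p : ℝ, Continuous fun y : Euc d => (ε ^ 2 + ‖y‖ ^ 2) ^ p := fun p =>
      Continuous.rpow_const (by fun_prop) fun y => .inl (hpos y).ne'
    have h2 := h1 (-(d : ℝ) / 2)
    have h3 := h1 (-(d : ℝ) / 2 - 1)
    have h4 : Continuous fun y : Euc d => (innerSL ℝ y).smulRight y :=
      ((ContinuousLinearMap.smulRightL ℝ (Euc d) (Euc d)).continuous.comp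
        (innerSL ℝ).continuous).clm_apply continuous_id
    exact (h2.smul continuous_const).sub ((continuous_const.mul h3).smul h4)
  refine memLp_two_of_norm_le_rpow hc.aestronglyMeasurable (C := 1 + d) (r := d) hε (by linarith)
    fun y => ?_
  refine ContinuousLinearMap.opNorm_le_bound _
    (mul_nonneg (by positivity) (Real.rpow_nonneg (hpos y).le _)) fun a => ?_
  rw [regNewtonDeriv_apply]
  set P := (ε ^ 2 + ‖y‖ ^ 2) ^ (-(d : ℝ) / 2) with hP
  have hP0 : 0 ≤ P := Real.rpow_nonneg (hpos y).le _
  have h3 : (ε ^ 2 + ‖y‖ ^ 2) ^ (-(d : ℝ) / 2 - 1) * ‖y‖ ^ 2 ≤ P := by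
    rw [Real.rpow_sub_one (hpos y).ne', ← hP, div_mul_eq_mul_div, div_le_iff₀ (hpos y)]
    exact mul_le_mul_of_nonneg_left (by nlinarith) hP0
  have hQ0 : 0 ≤ (ε ^ 2 + ‖y‖ ^ 2) ^ (-(d : ℝ) / 2 - 1) := Real.rpow_nonneg (hpos y).le _
  refine (norm_sub_le _ _).trans ?_
  rw [norm_smul, norm_smul, norm_smul, Real.norm_of_nonneg hP0,
    Real.norm_of_nonneg (mul_nonneg (Nat.cast_nonneg d) hQ0)]
  have h4 : ‖(inner ℝ y a : ℝ)‖ * ‖y‖ ≤ ‖y‖ ^ 2 * ‖a‖ := by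
    nlinarith [norm_inner_le_norm (𝕜 := ℝ) y a, norm_nonneg y]
  calc _ ≤ P * ‖a‖ + d * (ε ^ 2 + ‖y‖ ^ 2) ^ (-(d : ℝ) / 2 - 1) * (‖y‖ ^ 2 * ‖a‖) := by
        gcongr
    _ = P * ‖a‖ + d * ((ε ^ 2 + ‖y‖ ^ 2) ^ (-(d : ℝ) / 2 - 1) * ‖y‖ ^ 2) * ‖a‖ := by ring
    _ ≤ P * ‖a‖ + d * P * ‖a‖ := by gcongr
    _ = _ := by ring

theorem zCoord_sub {d : ℕ} (x y : Euc d) : zCoord (x - y) = zCoord x - zCoord y :=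
  inner_sub_left _ _ _

theorem zCoord_smul {d : ℕ} (c : ℝ) (x : Euc d) : zCoord (c • x) = c * zCoord x :=
  real_inner_smul_left _ _ _

/-- The axis of symmetry is a null set. -/
theorem ae_rCoord_ne_zero {d : ℕ} (hd : 3 ≤ d) : ∀ᵐ y : Euc d, rCoord y ≠ 0 := by
  have h := Measure.addHaar_submodule (volume : Measure (Euc d))
    (LinearMap.ker (offAxisL d : Euc d →ₗ[ℝ] Euc d)) fun htop => by
      have hm : unitVec d 0 ∈ LinearMap.ker (offAxisL d : Euc d →ₗ[ℝ] Euc d) := by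
        rw [htop]; trivial
      have h1 : offAxisL d (unitVec d 0) = 0 := hm
      have h2 := offAxis_meridian hd 1 0
      rw [meridian, one_smul, zero_smul, add_zero, ← offAxisL_apply, h1] at h2
      have h3 := norm_unitVec (d := d) (k := 0) (by omega)
      rw [← h2, norm_zero] at h3
      exact zero_ne_one h3
  refine measure_mono_null (fun y hy => ?_) h
  have h0 : rCoord y = 0 := by simpa using hy
  have : offAxis y = 0 := norm_eq_zero.1 h0
  rw [← offAxisL_apply] at this
  exact this

/-- The Biot–Savart law for an axisymmetric solenoidal field without swirl, mollified at scale
`ε`. -/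
theorem IsAxisymmetricNoSwirl.integral_mollified {d : ℕ} (hd : 3 ≤ d) {v : Euc d → Euc d}
    {v' : Euc d → Euc d →L[ℝ] Euc d} (hax : IsAxisymmetricNoSwirl v)
    (hv : ∀ x, HasFDerivAt v (v' x) x) (hv2 : MemLp v 2) (hv'2 : MemLp v' 2)
    (hdiv : ∀ x, divergence v x = 0) {ε : ℝ} (hε : 0 < ε) (x e : Euc d) (he : zCoord e = 0) :
    ∫ y, inner ℝ (v y) e * (d * ε ^ 2 * (ε ^ 2 + ‖y - x‖ ^ 2) ^ (-(d : ℝ) / 2 - 1)) =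
      ∫ y, vorticityOn v y / rCoord y * inner ℝ (offAxis y) e * zCoord (x - y) *
        (ε ^ 2 + ‖y - x‖ ^ 2) ^ (-(d : ℝ) / 2) := by
  have hmp := measurePreserving_sub_right (volume : Measure (Euc d)) x
  have hA : ∀ y, HasFDerivAt (fun y => regNewton d ε (y - x)) (regNewtonDeriv d ε (y - x)) y :=
    fun y => by
      have h := HasFDerivAt.comp (f := fun y => y - x) y (hasFDerivAt_regNewton hε (y - x))
        ((hasFDerivAt_id y).sub_const x)
      exact h.congr_fderiv (ContinuousLinearMap.comp_id _)
  have key := integral_inner_mul_divergence (A := fun y => regNewton d ε (y - x))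
    (A' := fun y => regNewtonDeriv d ε (y - x)) hv
    hA hv2 hv'2
    ((memLp_regNewton hd hε).comp_measurePreserving hmp)
    ((memLp_regNewtonDeriv hd hε).comp_measurePreserving hmp)
    (fun y a b => inner_regNewtonDeriv _ _ _)
    (fun y => by rw [← (hv y).fderiv]; exact hdiv y) e
  simp only [sum_regNewtonDeriv hε] at key
  rw [key, ← integral_neg]
  refine integral_congr_ae ?_
  filter_upwards [ae_rCoord_ne_zero hd] with y hy
  rw [← (hv y).fderiv, hax.inner_fderiv_sub hd (fun z => (hv z).differentiableAt) hy, he, regNewton,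
    zCoord_smul, zCoord_sub, zCoord_sub]
  ring

/-- The mass of the mollifier `d (1 + |y|²)^{-d/2-1}`. -/
noncomputable def mollifierMass (d : ℕ) : ℝ :=
  ∫ y : Euc d, d * (1 + ‖y‖ ^ 2) ^ (-(d : ℝ) / 2 - 1)

theorem integrable_mollifier (d : ℕ) :
    Integrable fun y : Euc d => (d : ℝ) * (1 + ‖y‖ ^ 2) ^ (-(d : ℝ) / 2 - 1) := by
  have h := integrable_rpow_add_norm_sq (d := d) (ε := 1) (r := d + 2) one_pos (by linarith)
  have e : -((d : ℝ) + 2) / 2 = -(d : ℝ) / 2 - 1 := by ring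
  rw [e, one_pow] at h
  exact h.const_mul _

theorem mollifierMass_pos {d : ℕ} (hd : 3 ≤ d) : 0 < mollifierMass d := by
  have hd' : (3 : ℝ) ≤ d := by exact_mod_cast hd
  have hp : ∀ y : Euc d, 0 < (d : ℝ) * (1 + ‖y‖ ^ 2) ^ (-(d : ℝ) / 2 - 1) := fun y => by positivity
  refine (integral_pos_iff_support_of_nonneg (fun y => (hp y).le) (integrable_mollifier d)).2 ?_
  have : Function.support (fun y : Euc d => (d : ℝ) * (1 + ‖y‖ ^ 2) ^ (-(d : ℝ) / 2 - 1)) = univ :=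
    eq_univ_of_forall fun y => (hp y).ne'
  rw [this]
  exact isOpen_univ.measure_pos _ univ_nonempty

/-- The mollifier at scale `ε`, centred at `x`, is a translate and rescaling of the one at scale
`1`. -/
theorem integral_mul_mollifier {d : ℕ} {g : Euc d → ℝ} {ε : ℝ} (hε : 0 < ε) (x : Euc d) :
    ∫ y, g y * (d * ε ^ 2 * (ε ^ 2 + ‖y - x‖ ^ 2) ^ (-(d : ℝ) / 2 - 1)) =
      ∫ y, g (x + ε • y) * (d * (1 + ‖y‖ ^ 2) ^ (-(d : ℝ) / 2 - 1)) := by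
  have h1 := integral_add_left_eq_self (μ := (volume : Measure (Euc d)))
    (fun y => g y * (d * ε ^ 2 * (ε ^ 2 + ‖y - x‖ ^ 2) ^ (-(d : ℝ) / 2 - 1))) x
  have h2 := Measure.integral_comp_smul_of_nonneg (volume : Measure (Euc d))
    (fun y => g (x + y) * (d * ε ^ 2 * (ε ^ 2 + ‖x + y - x‖ ^ 2) ^ (-(d : ℝ) / 2 - 1))) ε
    (hR := hε.le)
  rw [h1, finrank_euclideanSpace_fin, smul_eq_mul] at h2
  have h3 : ∀ y : Euc d, (ε ^ 2 + ‖x + ε • y - x‖ ^ 2) ^ (-(d : ℝ) / 2 - 1) =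
      (ε ^ d)⁻¹ * (ε ^ 2)⁻¹ * (1 + ‖y‖ ^ 2) ^ (-(d : ℝ) / 2 - 1) := fun y => by
    have e1 : ε ^ 2 + ‖x + ε • y - x‖ ^ 2 = ε ^ 2 * (1 + ‖y‖ ^ 2) := by
      rw [add_sub_cancel_left, norm_smul, Real.norm_of_nonneg hε.le]; ring
    have e2 : (ε ^ 2) ^ (-(d : ℝ) / 2 - 1) = (ε ^ d)⁻¹ * (ε ^ 2)⁻¹ := by
      rw [Real.rpow_sub_one (by positivity), ← Real.rpow_natCast ε 2, ← Real.rpow_mul hε.le,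
        ← Real.rpow_natCast ε d, ← Real.rpow_neg hε.le, div_eq_mul_inv]
      congr 2; push_cast; ring
    rw [e1, Real.mul_rpow (by positivity) (by positivity), e2]
  have h4 : ∫ y, g (x + ε • y) * (d * (1 + ‖y‖ ^ 2) ^ (-(d : ℝ) / 2 - 1)) =
      ε ^ d * ∫ y, g (x + ε • y) *
        (d * ε ^ 2 * (ε ^ 2 + ‖x + ε • y - x‖ ^ 2) ^ (-(d : ℝ) / 2 - 1)) := by
    rw [← integral_const_mul]
    refine integral_congr_ae (.of_forall fun y => ?_)
    simp only [h3]
    field_simp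
  rw [h4, h2, mul_inv_cancel_left₀ (by positivity)]

theorem tendsto_integral_mollifier {d : ℕ} {g : Euc d → ℝ} (hg : Continuous g) {M : ℝ}
    (hM : ∀ y, |g y| ≤ M) (x : Euc d) :
    Filter.Tendsto (fun ε : ℝ => ∫ y, g y *
        (d * ε ^ 2 * (ε ^ 2 + ‖y - x‖ ^ 2) ^ (-(d : ℝ) / 2 - 1))) (nhdsWithin 0 (Ioi 0))
      (nhds (mollifierMass d * g x)) := by
  have h0 : mollifierMass d * g x =
      ∫ y : Euc d, g x * (d * (1 + ‖y‖ ^ 2) ^ (-(d : ℝ) / 2 - 1)) := by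
    rw [integral_const_mul, mul_comm, mollifierMass]
  have hc : Continuous fun y : Euc d => (d : ℝ) * (1 + ‖y‖ ^ 2) ^ (-(d : ℝ) / 2 - 1) :=
    continuous_const.mul (Continuous.rpow_const (by fun_prop) fun y => .inl (by positivity))
  rw [h0]
  refine Filter.Tendsto.congr' (f₁ := fun ε : ℝ => ∫ y : Euc d, g (x + ε • y) *
    (d * (1 + ‖y‖ ^ 2) ^ (-(d : ℝ) / 2 - 1))) ?_ ?_
  · filter_upwards [self_mem_nhdsWithin] with ε hε
    exact (integral_mul_mollifier hε x).symm
  · refine tendsto_integral_filter_of_dominated_convergence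
      (fun y => M * (d * (1 + ‖y‖ ^ 2) ^ (-(d : ℝ) / 2 - 1)))
      (.of_forall fun ε => ?_) (.of_forall fun ε => .of_forall fun y => ?_)
      ((integrable_mollifier d).const_mul M) (.of_forall fun y => ?_)
    · exact Continuous.aestronglyMeasurable ((hg.comp (by fun_prop)).mul hc)
    · rw [norm_mul, Real.norm_of_nonneg (show 0 ≤ (d : ℝ) * (1 + ‖y‖ ^ 2) ^ (-(d : ℝ) / 2 - 1) by
        positivity)]
      exact mul_le_mul_of_nonneg_right (hM _) (by positivity)
    · have h1 : Continuous fun ε : ℝ => g (x + ε • y) * (d * (1 + ‖y‖ ^ 2) ^ (-(d : ℝ) / 2 - 1)) :=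
        (hg.comp (by fun_prop)).mul continuous_const
      have h2 := h1.tendsto 0
      rw [zero_smul, add_zero] at h2
      exact h2.mono_left nhdsWithin_le_nhds

theorem abs_integral_mollifier_le {d : ℕ} {g : Euc d → ℝ} {M : ℝ} (hM : ∀ y, |g y| ≤ M) {ε : ℝ}
    (hε : 0 < ε) (x : Euc d) :
    |∫ y, g y * (d * ε ^ 2 * (ε ^ 2 + ‖y - x‖ ^ 2) ^ (-(d : ℝ) / 2 - 1))| ≤
      M * mollifierMass d := by
  rw [integral_mul_mollifier hε, mollifierMass, ← integral_const_mul, ← Real.norm_eq_abs]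
  refine norm_integral_le_of_norm_le ((integrable_mollifier d).const_mul M) (.of_forall fun y => ?_)
  rw [norm_mul, Real.norm_of_nonneg (show 0 ≤ (d : ℝ) * (1 + ‖y‖ ^ 2) ^ (-(d : ℝ) / 2 - 1) by
        positivity)]
  exact mul_le_mul_of_nonneg_right (hM _) (by positivity)

/-! ### Cylindrical coordinates -/

/-- The surface measure of the unit sphere of `ℝⁿ`. -/
noncomputable abbrev sphereMeasure (n : ℕ) : Measure (Metric.sphere (0 : Euc n) 1) :=
  (volume : Measure (Euc n)).toSphere

/-- The measure `ρ^{n-1} dρ dz` on the half plane `ρ > 0`: up to the area of the unit sphere, the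
image of the Lebesgue measure of `ℝ^{n+1}` in the half plane of cylindrical coordinates. -/
noncomputable def halfPlaneMeasure (n : ℕ) : Measure (ℝ × ℝ) :=
  ((volume : Measure (ℝ × ℝ)).restrict (Ioi 0 ×ˢ univ)).withDensity
    fun p => ENNReal.ofReal (p.1 ^ (n - 1))

/-- The point of `ℝ^{n+1}` with cylindrical coordinates `p = (ρ, z)` and angle `σ`. -/
noncomputable def cylMap (n : ℕ) (q : (ℝ × ℝ) × Metric.sphere (0 : Euc n) 1) : Euc (n + 1) :=
  WithLp.toLp 2 (Fin.snoc (α := fun _ => ℝ) (fun i => q.1.1 * (q.2 : Euc n) i) q.1.2)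

theorem measurePreserving_snoc (n : ℕ) :
    MeasurePreserving (fun q : Euc n × ℝ =>
      (WithLp.toLp 2 (Fin.snoc (α := fun _ => ℝ) (fun i => q.1 i) q.2) : Euc (n + 1))) := by
  have h1 := (volume_preserving_piFinSuccAbove (fun _ : Fin (n + 1) => ℝ) (Fin.last n)).symm
  have h2 := (PiLp.volume_preserving_toLp (Fin (n + 1))).comp h1
  have h3 : MeasurePreserving (fun q : Euc n × ℝ => (q.2, fun i => q.1 i)) :=
    (((MeasurePreserving.id volume).prod (PiLp.volume_preserving_ofLp (Fin n)))).comp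
      (Measure.measurePreserving_swap (μ := (volume : Measure (Euc n)))
        (ν := (volume : Measure ℝ)))
  have h4 := h2.comp h3
  convert h4 using 1
  funext q
  simp only [Function.comp_apply]
  congr 1
  exact (Fin.insertNth_last (α := fun _ => ℝ) q.2 (fun i => q.1 i)).symm

theorem measurePreserving_volumeIoiPow (k : ℕ) :
    MeasurePreserving (Subtype.val : Ioi (0 : ℝ) → ℝ) (Measure.volumeIoiPow k)
      ((volume.restrict (Ioi (0 : ℝ))).withDensity fun r => ENNReal.ofReal (r ^ k)) := by
  refine ⟨measurable_subtype_coe, Measure.ext fun s hs => ?_⟩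
  rw [Measure.map_apply measurable_subtype_coe hs, Measure.volumeIoiPow,
    withDensity_apply _ (measurable_subtype_coe hs), withDensity_apply _ hs,
    setLIntegral_subtype measurableSet_Ioi _ fun a : ℝ => ENNReal.ofReal (a ^ k),
    Subtype.image_preimage_coe, Measure.restrict_restrict hs, inter_comm]

theorem measurePreserving_polar {n : ℕ} (hn : 2 ≤ n) :
    MeasurePreserving (fun q : Metric.sphere (0 : Euc n) 1 × Ioi (0 : ℝ) =>
        (q.2 : ℝ) • (q.1 : Euc n))
      ((sphereMeasure n).prod (Measure.volumeIoiPow (n - 1))) volume := by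
  have : Nonempty (Fin n) := ⟨⟨0, by omega⟩⟩
  have h1 := (volume : Measure (Euc n)).measurePreserving_homeomorphUnitSphereProd
  rw [finrank_euclideanSpace_fin] at h1
  have h2 : MeasurePreserving (homeomorphUnitSphereProd (Euc n)).symm
      ((sphereMeasure n).prod (Measure.volumeIoiPow (n - 1))) (Measure.comap Subtype.val volume) :=
    MeasurePreserving.symm (homeomorphUnitSphereProd (Euc n)).toMeasurableEquiv h1
  have h3 := measurePreserving_subtype_coe (μa := (volume : Measure (Euc n)))
    (s := {(0 : Euc n)}ᶜ) (measurableSet_singleton _).compl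
  rw [restrict_compl_singleton] at h3
  have h4 := h3.comp h2
  convert h4 using 1
  exact funext fun q => (homeomorphUnitSphereProd_symm_apply_coe _ q).symm

theorem halfPlaneMeasure_eq_prod (n : ℕ) : halfPlaneMeasure n =
    ((volume.restrict (Ioi (0 : ℝ))).withDensity fun r => ENNReal.ofReal (r ^ (n - 1))).prod
      volume := by
  rw [prod_withDensity_left (by fun_prop), halfPlaneMeasure, Measure.volume_eq_prod,
    ← Measure.prod_restrict, Measure.restrict_univ]

instance (n : ℕ) : SigmaFinite (halfPlaneMeasure n) :=
  SigmaFinite.withDensity_ofReal _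

theorem measurable_cylMap (n : ℕ) : Measurable (cylMap n) := by
  have h1 := (measurePreserving_snoc n).measurable
  have h2 : Measurable fun q : (ℝ × ℝ) × Metric.sphere (0 : Euc n) 1 =>
      (q.1.1 • (q.2 : Euc n), q.1.2) := by fun_prop
  exact h1.comp h2

/-- Integration in cylindrical coordinates. -/
theorem measurePreserving_cylMap {n : ℕ} (hn : 2 ≤ n) :
    MeasurePreserving (cylMap n) ((halfPlaneMeasure n).prod (sphereMeasure n)) volume := by
  have hG := (measurePreserving_snoc n).comp
    ((measurePreserving_polar hn).prod (MeasurePreserving.id (volume : Measure ℝ)))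
  have hH := ((Measure.measurePreserving_swap).comp ((MeasurePreserving.id (sphereMeasure n)).prod
    ((measurePreserving_volumeIoiPow (n - 1)).prod
      (MeasurePreserving.id (volume : Measure ℝ))))).comp
    (measurePreserving_prodAssoc (sphereMeasure n) (Measure.volumeIoiPow (n - 1)) volume)
  rw [← halfPlaneMeasure_eq_prod] at hH
  refine ⟨measurable_cylMap n, ?_⟩
  rw [← hH.map_eq, Measure.map_map (measurable_cylMap n) hH.measurable, ← hG.map_eq]
  rfl

theorem inner_unitVec_right {d k : ℕ} (hk : k < d) (x : Euc d) :
    (inner ℝ x (unitVec d k) : ℝ) = x ⟨k, hk⟩ := by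
  have : unitVec d k = EuclideanSpace.single (⟨k, hk⟩ : Fin d) (1 : ℝ) := by
    ext i
    simp [unitVec, Fin.ext_iff]
  rw [this, real_inner_comm, EuclideanSpace.inner_single_left]; simp

theorem cylMap_castSucc (n : ℕ) (p : ℝ × ℝ) (σ : Metric.sphere (0 : Euc n) 1) (i : Fin n) :
    cylMap n (p, σ) i.castSucc = p.1 * (σ : Euc n) i := by
  simp [cylMap]

theorem cylMap_last (n : ℕ) (p : ℝ × ℝ) (σ : Metric.sphere (0 : Euc n) 1) :
    cylMap n (p, σ) (Fin.last n) = p.2 := by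
  simp [cylMap]

theorem zCoord_cylMap (n : ℕ) (p : ℝ × ℝ) (σ : Metric.sphere (0 : Euc n) 1) :
    zCoord (cylMap n (p, σ)) = p.2 := by
  rw [zCoord, eZ, inner_unitVec_right (by omega)]
  exact cylMap_last n p σ

theorem inner_cylMap_radial {n : ℕ} (hn : 2 ≤ n) (p : ℝ × ℝ) (σ : Metric.sphere (0 : Euc n) 1) :
    (inner ℝ (cylMap n (p, σ)) (unitVec (n + 1) 0) : ℝ) =
      p.1 * inner ℝ (σ : Euc n) (unitVec n 0) := by
  rw [inner_unitVec_right (by omega), inner_unitVec_right (by omega)]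
  exact cylMap_castSucc n p σ ⟨0, by omega⟩

theorem norm_cylMap_sq (n : ℕ) (p : ℝ × ℝ) (σ : Metric.sphere (0 : Euc n) 1) :
    ‖cylMap n (p, σ)‖ ^ 2 = p.1 ^ 2 + p.2 ^ 2 := by
  rw [EuclideanSpace.real_norm_sq_eq, Fin.sum_univ_castSucc]
  have h3 : ∑ i, (σ : Euc n) i ^ 2 = 1 := by
    rw [← EuclideanSpace.real_norm_sq_eq, norm_eq_of_mem_sphere σ, one_pow]
  simp only [cylMap_castSucc, cylMap_last, mul_pow]
  rw [← Finset.mul_sum, h3, mul_one]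

theorem norm_sq_eq_rCoord {d : ℕ} (hd : 3 ≤ d) (x : Euc d) :
    ‖x‖ ^ 2 = rCoord x ^ 2 + zCoord x ^ 2 := by
  have h : x = offAxis x + zCoord x • eZ d := by rw [offAxis, sub_add_cancel]
  conv_lhs => rw [h, ← real_inner_self_eq_norm_sq]
  rw [inner_add_left, inner_add_right, inner_add_right, real_inner_smul_left, real_inner_smul_left,
    real_inner_smul_right, real_inner_smul_right, real_inner_comm (offAxis x) (eZ d),
    inner_offAxis_axial hd, inner_axial_self hd, real_inner_self_eq_norm_sq, rCoord]
  ring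

theorem rCoord_cylMap {n : ℕ} (hn : 2 ≤ n) {p : ℝ × ℝ} (hp : 0 ≤ p.1)
    (σ : Metric.sphere (0 : Euc n) 1) : rCoord (cylMap n (p, σ)) = p.1 := by
  have h := norm_sq_eq_rCoord (by omega) (cylMap n (p, σ))
  rw [norm_cylMap_sq, zCoord_cylMap, add_left_inj] at h
  exact ((pow_left_inj₀ hp (norm_nonneg _) two_ne_zero).1 h).symm

/-- The squared distance between points with an angle between their radial directions; the last term
measures the angle. -/
theorem norm_cylMap_sub_sq {n : ℕ} (hn : 2 ≤ n) (p q : ℝ × ℝ) (σ : Metric.sphere (0 : Euc n) 1) :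
    ‖cylMap n (q, σ) - planeEmb (n + 1) p‖ ^ 2 = (p.1 - q.1) ^ 2 + (p.2 - q.2) ^ 2 +
      2 * (p.1 * q.1) * (1 - inner ℝ (σ : Euc n) (unitVec n 0)) := by
  have h1 : ‖planeEmb (n + 1) p‖ ^ 2 = p.1 ^ 2 + p.2 ^ 2 := by
    rw [norm_sq_eq_rCoord (by omega), planeEmb_apply, rCoord_meridian (by omega),
      zCoord_meridian (by omega), sq_abs]
  have h2 : (inner ℝ (cylMap n (q, σ)) (planeEmb (n + 1) p) : ℝ) =
      p.1 * (q.1 * inner ℝ (σ : Euc n) (unitVec n 0)) + p.2 * q.2 := by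
    rw [planeEmb_apply, meridian, inner_add_right, real_inner_smul_right, real_inner_smul_right,
      inner_cylMap_radial hn]
    congr 2
    exact zCoord_cylMap n q σ
  rw [norm_sub_sq_real, norm_cylMap_sq, h1, h2]
  ring

/-! ### Integrals over the sphere -/

theorem abs_coord_le_norm {n : ℕ} (y : Euc n) (i : Fin n) : |y i| ≤ ‖y‖ := by
  simpa using PiLp.norm_apply_le y i

open scoped Pointwise in
/-- The area of a spherical cap: the cone over the cap lies in a box with half-sides
`1, t, …, t`. -/
theorem sphereMeasure_cap_le {n : ℕ} (hn : 2 ≤ n) {t : ℝ} (ht : 0 ≤ t) :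
    (sphereMeasure n).real {σ | ‖(σ : Euc n) - unitVec n 0‖ < t} ≤ n * 2 ^ n * t ^ (n - 1) := by
  obtain ⟨m, rfl⟩ : ∃ m, n = m + 1 := ⟨n - 1, by omega⟩
  set S := {σ : Metric.sphere (0 : Euc (m + 1)) 1 | ‖(σ : Euc (m + 1)) - unitVec (m + 1) 0‖ < t}
    with hS
  have hSm : MeasurableSet S := by
    refine measurableSet_lt ?_ measurable_const
    fun_prop
  set c : Fin (m + 1) → ℝ := Fin.cons 1 fun _ => t with hc
  set box : Set (Fin (m + 1) → ℝ) := Icc (fun i => -c i) c with hbox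
  have hsub : Ioo (0 : ℝ) 1 • ((↑) '' S : Set (Euc (m + 1))) ⊆ WithLp.ofLp ⁻¹' box := by
    rintro _ ⟨s, hs, _, ⟨σ, hσ, rfl⟩, rfl⟩
    have h1 : ∀ i, |(s • (σ : Euc (m + 1))) i| ≤ c i := fun i => by
      rw [PiLp.smul_apply, smul_eq_mul, abs_mul, abs_of_pos hs.1]
      refine Fin.cases ?_ (fun j => ?_) i
      · have h2 : |(σ : Euc (m + 1)) 0| ≤ ‖(σ : Euc (m + 1))‖ := abs_coord_le_norm _ 0
        rw [norm_eq_of_mem_sphere σ] at h2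
        change _ ≤ (1 : ℝ)
        nlinarith [hs.1, hs.2, abs_nonneg ((σ : Euc (m + 1)) 0)]
      · have h2 : |((σ : Euc (m + 1)) - unitVec (m + 1) 0) j.succ| ≤ _ :=
          abs_coord_le_norm _ _
        have h3 : ((σ : Euc (m + 1)) - unitVec (m + 1) 0) j.succ = (σ : Euc (m + 1)) j.succ := by
          simp [unitVec]
        rw [h3] at h2
        have h4 : ‖(σ : Euc (m + 1)) - unitVec (m + 1) 0‖ < t := hσ
        change _ ≤ t
        nlinarith [hs.1, hs.2, abs_nonneg ((σ : Euc (m + 1)) j.succ)]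
    exact ⟨fun i => (abs_le.1 (h1 i)).1, fun i => (abs_le.1 (h1 i)).2⟩
  have hvol : volume (WithLp.ofLp ⁻¹' box : Set (Euc (m + 1))) =
      ENNReal.ofReal (2 ^ (m + 1) * t ^ m) := by
    rw [(PiLp.volume_preserving_ofLp (Fin (m + 1))).measure_preimage
      measurableSet_Icc.nullMeasurableSet, Real.volume_Icc_pi,
      ← ENNReal.ofReal_prod_of_nonneg]
    · congr 1
      rw [Fin.prod_univ_succ]
      simp only [hc, Fin.cons_zero, Fin.cons_succ, Finset.prod_const, Finset.card_univ,
        Fintype.card_fin]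
      ring
    · intro i _
      refine Fin.cases ?_ (fun j => ?_) i
      · simp [hc]
      · simp only [hc, Fin.cons_succ]; linarith
  have h := (volume : Measure (Euc (m + 1))).toSphere_apply' hSm
  rw [finrank_euclideanSpace_fin] at h
  refine ENNReal.toReal_le_of_le_ofReal (by positivity) ?_
  rw [h]
  refine (mul_le_mul_right (measure_mono hsub) _).trans_eq ?_
  rw [hvol, mul_assoc, ENNReal.ofReal_mul (Nat.cast_nonneg _), ENNReal.ofReal_natCast,
    Nat.add_sub_cancel]

theorem norm_sphere_sub_sq {n : ℕ} (hn : 2 ≤ n) (σ : Metric.sphere (0 : Euc n) 1) :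
    ‖(σ : Euc n) - unitVec n 0‖ ^ 2 = 2 * (1 - inner ℝ (σ : Euc n) (unitVec n 0)) := by
  rw [norm_sub_sq_real, norm_eq_of_mem_sphere σ, norm_unitVec (by omega)]
  ring

theorem abs_inner_sphere_le {n : ℕ} (hn : 2 ≤ n) (σ : Metric.sphere (0 : Euc n) 1) :
    |(inner ℝ (σ : Euc n) (unitVec n 0) : ℝ)| ≤ 1 := by
  have := abs_real_inner_le_norm (σ : Euc n) (unitVec n 0)
  rwa [norm_eq_of_mem_sphere σ, norm_unitVec (by omega), mul_one] at this

theorem continuous_sphere_rpow {n : ℕ} (hn : 2 ≤ n) {a B : ℝ} (ha : 0 < a) (hB : 0 ≤ B) (r : ℝ) :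
    Continuous fun σ : Metric.sphere (0 : Euc n) 1 =>
      (a + 2 * B * (1 - inner ℝ (σ : Euc n) (unitVec n 0))) ^ r := by
  refine Continuous.rpow_const (by fun_prop) fun σ => .inl ?_
  have := (abs_le.1 (abs_inner_sphere_le hn σ)).2
  have : 0 ≤ 2 * B * (1 - inner ℝ (σ : Euc n) (unitVec n 0)) :=
    mul_nonneg (by positivity) (by linarith)
  linarith

/-- The integral is concentrated on a cap of size `√(a / B)` around `unitVec n 0`. -/
theorem integral_sphere_rpow_le {n : ℕ} (hn : 2 ≤ n) {a B : ℝ} (ha : 0 < a) (hB : 0 < B) :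
    ∫ σ, (a + 2 * B * (1 - inner ℝ (σ : Euc n) (unitVec n 0))) ^ (-((n : ℝ) + 1) / 2)
      ∂(sphereMeasure n) ≤
      n * 2 ^ n * ((n + 1) / 2) * (a⁻¹ * B ^ (-((n : ℝ) - 1) / 2)) := by
  have hn' : (2 : ℝ) ≤ n := by exact_mod_cast hn
  have hbase : ∀ σ : Metric.sphere (0 : Euc n) 1,
      a ≤ a + 2 * B * (1 - inner ℝ (σ : Euc n) (unitVec n 0)) := fun σ => by
    have := (abs_le.1 (abs_inner_sphere_le hn σ)).2
    have : 0 ≤ 2 * B * (1 - inner ℝ (σ : Euc n) (unitVec n 0)) :=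
      mul_nonneg (by positivity) (by linarith)
    linarith
  set f : Metric.sphere (0 : Euc n) 1 → ℝ := fun σ =>
    (a + 2 * B * (1 - inner ℝ (σ : Euc n) (unitVec n 0))) ^ (-((n : ℝ) + 1) / 2) with hf
  have hfi : Integrable f (sphereMeasure n) := by
    have : CompactSpace (Metric.sphere (0 : Euc n) 1) :=
      isCompact_iff_compactSpace.1 (isCompact_sphere _ _)
    exact (continuous_sphere_rpow hn ha hB.le _).integrable_of_hasCompactSupport
      (HasCompactSupport.of_compactSpace _)
  have hf0 : ∀ σ, 0 ≤ f σ := fun σ => Real.rpow_nonneg (ha.le.trans (hbase σ)) _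
  -- Layer-cake formula: the superlevel sets of `f` are caps, and are empty above the bound `L`.
  rw [hfi.integral_eq_integral_meas_lt (.of_forall hf0)]
  set L : ℝ := a ^ (-((n : ℝ) + 1) / 2) with hL
  set c : ℝ := n * 2 ^ n * B ^ (-((n : ℝ) - 1) / 2) with hc
  have hL0 : 0 < L := by positivity
  have hc0 : 0 ≤ c := by positivity
  set q : ℝ := -((n : ℝ) - 1) / (n + 1) with hq
  have hq1 : -1 < q := by rw [hq, lt_div_iff₀ (by positivity)]; linarith
  have hint : IntervalIntegrable (fun s : ℝ => c * s ^ q) volume 0 L :=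
    (intervalIntegral.intervalIntegrable_rpow' hq1).const_mul c
  rw [intervalIntegrable_iff_integrableOn_Ioc_of_le hL0.le] at hint
  have hle : ∀ s ∈ Ioi (0 : ℝ), (sphereMeasure n).real {σ | s < f σ} ≤
      (Ioc 0 L).indicator (fun s : ℝ => c * s ^ q) s := fun s hs => by
    have hs0 : (0 : ℝ) < s := hs
    by_cases hsL : s ≤ L
    · rw [indicator_of_mem (show s ∈ Ioc 0 L from ⟨hs, hsL⟩)]
      set t : ℝ := Real.sqrt (s ^ (-2 / ((n : ℝ) + 1)) / B) with ht
      have hsubset : {σ | s < f σ} ⊆ {σ | ‖(σ : Euc n) - unitVec n 0‖ < t} := fun σ hσ => by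
        have h1 : s < f σ := hσ
        have hb := ha.trans_le (hbase σ)
        have h2 : a + 2 * B * (1 - inner ℝ (σ : Euc n) (unitVec n 0)) <
            s ^ (-2 / ((n : ℝ) + 1)) := by
          have h3 := Real.rpow_lt_rpow_of_neg hs0 h1
            (z := -2 / ((n : ℝ) + 1)) (div_neg_of_neg_of_pos (by norm_num) (by positivity))
          have h4 : f σ ^ (-2 / ((n : ℝ) + 1)) =
              a + 2 * B * (1 - inner ℝ (σ : Euc n) (unitVec n 0)) := by
            simp only [hf]
            rw [← Real.rpow_mul hb.le]
            have : -((n : ℝ) + 1) / 2 * (-2 / (n + 1)) = 1 := by field_simp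
            rw [this, Real.rpow_one]
          rwa [h4] at h3
        refine Real.lt_sqrt_of_sq_lt ?_
        rw [norm_sphere_sub_sq hn, lt_div_iff₀ hB]
        linarith
      refine (measureReal_mono hsubset).trans
        ((sphereMeasure_cap_le hn (Real.sqrt_nonneg _)).trans_eq ?_)
      have e1 : t ^ (n - 1) = (s ^ (-2 / ((n : ℝ) + 1)) / B) ^ (((n : ℝ) - 1) / 2) := by
        rw [ht, Real.sqrt_eq_rpow, ← Real.rpow_natCast, ← Real.rpow_mul (by positivity),
          Nat.cast_sub (by omega)]
        congr 1; push_cast; ring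
      rw [e1, Real.div_rpow (by positivity) hB.le, ← Real.rpow_mul hs0.le, hc,
        show -((n : ℝ) - 1) / 2 = -(((n : ℝ) - 1) / 2) by ring, Real.rpow_neg hB.le, hq]
      have e2 : -2 / ((n : ℝ) + 1) * (((n : ℝ) - 1) / 2) = -((n : ℝ) - 1) / (n + 1) := by
        field_simp
      rw [e2]; ring
    · rw [indicator_of_notMem fun h => hsL h.2]
      have : {σ | s < f σ} = ∅ := eq_empty_of_forall_notMem fun σ hσ => by
        have h1 : s < f σ := hσ
        have h2 : f σ ≤ L := Real.rpow_le_rpow_of_nonpos ha (hbase σ) (by linarith)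
        exact hsL (h1.le.trans h2)
      rw [this, measureReal_empty]
  refine (integral_mono_of_nonneg (.of_forall fun _ => measureReal_nonneg) ?_
    ((ae_restrict_iff' measurableSet_Ioi).2 (.of_forall hle))).trans_eq ?_
  · exact ((integrable_indicator_iff measurableSet_Ioc).2 hint).integrableOn
  · rw [setIntegral_indicator measurableSet_Ioc,
      show Ioi (0 : ℝ) ∩ Ioc 0 L = Ioc 0 L from inter_eq_right.2 fun x hx => hx.1,
      ← intervalIntegral.integral_of_le hL0.le, intervalIntegral.integral_const_mul,
      integral_rpow (.inl hq1), Real.zero_rpow (by linarith), sub_zero, hL, ← Real.rpow_mul ha.le]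
    have e1 : q + 1 = 2 / (n + 1) := by rw [hq]; field_simp; ring
    have e2 : -((n : ℝ) + 1) / 2 * (q + 1) = -1 := by rw [e1]; field_simp
    rw [e2, e1, Real.rpow_neg_one, hc]
    field_simp

open scoped Pointwise in
theorem measurePreserving_neg_sphere (n : ℕ) :
    MeasurePreserving (fun σ : Metric.sphere (0 : Euc n) 1 => -σ) (sphereMeasure n)
      (sphereMeasure n) := by
  refine ⟨continuous_neg.measurable, Measure.ext fun s hs => ?_⟩
  rw [Measure.map_apply continuous_neg.measurable hs, Measure.toSphere_apply' _ hs,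
    Measure.toSphere_apply' _ (continuous_neg.measurable hs)]
  congr 1
  rw [← Measure.measure_preimage_neg]
  congr 1
  ext y
  constructor
  · rintro ⟨r, hr, _, ⟨σ, hσ, rfl⟩, h⟩
    refine ⟨r, hr, _, ⟨-σ, hσ, rfl⟩, ?_⟩
    have h' : y = -(r • (σ : Euc n)) := by rw [← neg_neg y]; exact congrArg Neg.neg h.symm
    rw [h', ← smul_neg]; rfl
  · rintro ⟨r, hr, _, ⟨σ, hσ, rfl⟩, rfl⟩
    refine ⟨r, hr, _, ⟨-σ, ?_, rfl⟩, smul_neg r (σ : Euc n)⟩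
    change - -σ ∈ s
    rwa [neg_neg]

theorem integral_sphere_inner (n : ℕ) (e : Euc n) :
    ∫ σ, (inner ℝ (σ : Euc n) e : ℝ) ∂(sphereMeasure n) = 0 := by
  have h := (measurePreserving_neg_sphere n).integral_comp
    (Homeomorph.neg (Metric.sphere (0 : Euc n) 1)).measurableEmbedding
    (fun σ => (inner ℝ (σ : Euc n) e : ℝ))
  have h2 : ∀ σ : Metric.sphere (0 : Euc n) 1, ((-σ : Metric.sphere (0 : Euc n) 1) : Euc n) = -σ :=
    fun _ => rfl
  simp only [h2, inner_neg_left, integral_neg] at h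
  linarith

theorem integrable_sphere {n : ℕ} {f : Metric.sphere (0 : Euc n) 1 → ℝ} (hf : Continuous f) :
    Integrable f (sphereMeasure n) := by
  have : CompactSpace (Metric.sphere (0 : Euc n) 1) :=
    isCompact_iff_compactSpace.1 (isCompact_sphere _ _)
  exact hf.integrable_of_hasCompactSupport (HasCompactSupport.of_compactSpace _)

/-- The contributions of antipodal points cancel to leading order when `B` is small compared
to `a`. -/
theorem abs_integral_sphere_mul_rpow_le {n : ℕ} (hn : 2 ≤ n) {a B : ℝ} (ha : 0 < a) (hB : 0 < B) :
    |∫ σ, (inner ℝ (σ : Euc n) (unitVec n 0) : ℝ) *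
        (a + 2 * B * (1 - inner ℝ (σ : Euc n) (unitVec n 0))) ^ (-((n : ℝ) + 1) / 2)
      ∂(sphereMeasure n)| ≤
      (sphereMeasure n).real univ * (n + 1) * (B * a ^ (-((n : ℝ) + 1) / 2 - 1)) := by
  set r : ℝ := -((n : ℝ) + 1) / 2 with hr
  have hr0 : r ≤ 0 := by rw [hr]; linarith [(Nat.cast_nonneg n : (0 : ℝ) ≤ n)]
  have hin : Continuous fun σ : Metric.sphere (0 : Euc n) 1 =>
      (inner ℝ (σ : Euc n) (unitVec n 0) : ℝ) := by fun_prop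
  -- The constant `(a + 2 B) ^ r`, the value of the power on the equator, integrates to zero against
  -- the odd factor.
  have hsplit : ∫ σ, (inner ℝ (σ : Euc n) (unitVec n 0) : ℝ) *
        (a + 2 * B * (1 - inner ℝ (σ : Euc n) (unitVec n 0))) ^ r ∂(sphereMeasure n) =
      ∫ σ, (inner ℝ (σ : Euc n) (unitVec n 0) : ℝ) *
        ((a + 2 * B * (1 - inner ℝ (σ : Euc n) (unitVec n 0))) ^ r - (a + 2 * B) ^ r)
        ∂(sphereMeasure n) := by
    simp only [mul_sub ((inner ℝ _ _ : ℝ))]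
    have i1 : Integrable (fun σ : Metric.sphere (0 : Euc n) 1 =>
        (inner ℝ (σ : Euc n) (unitVec n 0) : ℝ) *
        (a + 2 * B * (1 - inner ℝ (σ : Euc n) (unitVec n 0))) ^ r) (sphereMeasure n) :=
      integrable_sphere (hin.mul (continuous_sphere_rpow hn ha hB.le r))
    have i2 : Integrable (fun σ : Metric.sphere (0 : Euc n) 1 =>
        (inner ℝ (σ : Euc n) (unitVec n 0) : ℝ) * (a + 2 * B) ^ r)
        (sphereMeasure n) := integrable_sphere (hin.mul continuous_const)
    rw [integral_sub i1 i2, integral_mul_const, integral_sphere_inner,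
      zero_mul, sub_zero]
  have hlip : ∀ x ∈ Ici a, ∀ y ∈ Ici a,
      ‖y ^ r - x ^ r‖ ≤ (n + 1) / 2 * a ^ (r - 1) * ‖y - x‖ := fun x hx y hy => by
    refine (convex_Ici a).norm_image_sub_le_of_norm_hasDerivWithin_le (f := fun x : ℝ => x ^ r)
      (f' := fun x : ℝ => r * x ^ (r - 1)) (fun z hz => ?_) (fun z hz => ?_) hx hy
    · exact (Real.hasDerivAt_rpow_const (.inl (ha.trans_le hz).ne')).hasDerivWithinAt
    · rw [norm_mul, Real.norm_of_nonpos hr0,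
        Real.norm_of_nonneg (Real.rpow_nonneg (ha.le.trans hz) _)]
      refine mul_le_mul (by rw [hr]; linarith)
        (Real.rpow_le_rpow_of_nonpos ha hz (by linarith))
        (Real.rpow_nonneg (ha.le.trans hz) _) (by positivity)
  rw [hsplit, ← Real.norm_eq_abs]
  refine (norm_integral_le_of_norm_le_const (C := (n + 1) * (B * a ^ (r - 1)))
    (.of_forall fun σ => ?_)).trans_eq (by ring)
  have hσ := abs_inner_sphere_le hn σ
  have hσ' := abs_le.1 hσ
  have h0 : 0 ≤ 2 * B * (1 - inner ℝ (σ : Euc n) (unitVec n 0)) :=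
    mul_nonneg (by positivity) (by linarith)
  have h1 := hlip (a + 2 * B) (by simp only [mem_Ici]; linarith)
    (a + 2 * B * (1 - inner ℝ (σ : Euc n) (unitVec n 0))) (by simp only [mem_Ici]; linarith)
  have h2 : ‖a + 2 * B * (1 - inner ℝ (σ : Euc n) (unitVec n 0)) - (a + 2 * B)‖ ≤ 2 * B := by
    rw [show a + 2 * B * (1 - inner ℝ (σ : Euc n) (unitVec n 0)) - (a + 2 * B) =
      -(2 * B * inner ℝ (σ : Euc n) (unitVec n 0)) by ring, norm_neg, norm_mul,
      Real.norm_of_nonneg (by positivity), Real.norm_eq_abs]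
    nlinarith
  rw [norm_mul, Real.norm_eq_abs (inner ℝ _ _ : ℝ)]
  calc _ ≤ 1 * ((n + 1) / 2 * a ^ (r - 1) * (2 * B)) := by
        refine mul_le_mul hσ (h1.trans ?_) (norm_nonneg _) zero_le_one
        exact mul_le_mul_of_nonneg_left h2 (by positivity)
    _ = _ := by ring

/-- The regularised kernel that gives the radial velocity in terms of the vorticity, in the half
plane. -/
noncomputable def cylKernel (n : ℕ) (ε : ℝ) (p q : ℝ × ℝ) : ℝ :=
  ∫ σ, (p.2 - q.2) * inner ℝ (σ : Euc n) (unitVec n 0) *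
    (ε ^ 2 + ((p.1 - q.1) ^ 2 + (p.2 - q.2) ^ 2) +
      2 * (p.1 * q.1) * (1 - inner ℝ (σ : Euc n) (unitVec n 0))) ^ (-((n : ℝ) + 1) / 2)
    ∂(sphereMeasure n)

theorem cylKernel_comm (n : ℕ) (ε : ℝ) (p q : ℝ × ℝ) :
    cylKernel n ε q p = -cylKernel n ε p q := by
  rw [cylKernel, cylKernel, ← integral_neg]
  congr 1
  funext σ
  rw [show (q.1 - p.1) ^ 2 + (q.2 - p.2) ^ 2 = (p.1 - q.1) ^ 2 + (p.2 - q.2) ^ 2 by ring,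
    mul_comm q.1 p.1]
  ring

/-- The constant in the bound for `cylKernel`. -/
noncomputable def kernelConst (n : ℕ) : ℝ :=
  2 ^ n * (n * 2 ^ n * ((n + 1) / 2) + (sphereMeasure n).real univ * (n + 1))

theorem kernelConst_nonneg (n : ℕ) : 0 ≤ kernelConst n := by
  unfold kernelConst; positivity

/-- The bound on the symmetrised kernel, uniform in the regularisation. Near the diagonal it
follows from the concentration of the angular integral, away from it from the antipodal
cancellation. -/
theorem abs_mul_cylKernel_le {n : ℕ} (hn : 2 ≤ n) {ε : ℝ} (hε : 0 < ε) {p q : ℝ × ℝ}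
    (hp : 0 < p.1) (hq : 0 < q.1) :
    |p.1 - q.1| * |cylKernel n ε p q| ≤ kernelConst n * (q.1 / p.1 ^ n) := by
  have hn' : (2 : ℝ) ≤ n := by exact_mod_cast hn
  set a : ℝ := ε ^ 2 + ((p.1 - q.1) ^ 2 + (p.2 - q.2) ^ 2) with ha
  set B : ℝ := p.1 * q.1 with hB
  have ha0 : 0 < a := by positivity
  have hB0 : 0 < B := by positivity
  set K : ℝ := ∫ σ, (inner ℝ (σ : Euc n) (unitVec n 0) : ℝ) *
        (a + 2 * B * (1 - inner ℝ (σ : Euc n) (unitVec n 0))) ^ (-((n : ℝ) + 1) / 2)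
      ∂(sphereMeasure n) with hK
  have hkK : cylKernel n ε p q = (p.2 - q.2) * K := by
    rw [cylKernel, hK, ← integral_const_mul]
    refine integral_congr_ae (.of_forall fun σ => ?_)
    exact mul_assoc _ _ _
  have hda : |p.1 - q.1| * |p.2 - q.2| ≤ a / 2 := by
    rw [← sq_abs (p.1 - q.1), ← sq_abs (p.2 - q.2)] at ha
    nlinarith [sq_nonneg (|p.1 - q.1| - |p.2 - q.2|), sq_nonneg ε]
  set C₁ : ℝ := n * 2 ^ n * ((n + 1) / 2) with hC₁
  set C₂ : ℝ := (sphereMeasure n).real univ * (n + 1) with hC₂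
  have hC₁0 : 0 ≤ C₁ := by positivity
  have hC₂0 : 0 ≤ C₂ := by positivity
  have hqp : 0 ≤ q.1 / p.1 ^ n := by positivity
  have hmain : |p.1 - q.1| * |cylKernel n ε p q| ≤ a / 2 * |K| := by
    rw [hkK, abs_mul, ← mul_assoc]
    exact mul_le_mul_of_nonneg_right hda (abs_nonneg _)
  refine hmain.trans ?_
  have hconst : kernelConst n = 2 ^ n * (C₁ + C₂) := rfl
  rw [hconst]
  -- If `a < ρ_p² / 4`, the two radii are comparable.
  rcases le_or_gt (p.1 ^ 2 / 4) a with hfar | hnear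
  · have h1 := abs_integral_sphere_mul_rpow_le hn ha0 hB0
    rw [← hK, ← hC₂] at h1
    have h2 : a ^ (-((n : ℝ) + 1) / 2) ≤ 2 ^ (n + 1) / p.1 ^ (n + 1) := by
      refine (Real.rpow_le_rpow_of_nonpos (by positivity) hfar (by linarith)).trans_eq ?_
      rw [show p.1 ^ 2 / 4 = (p.1 / 2) ^ (2 : ℝ) by rw [Real.rpow_two]; ring,
        ← Real.rpow_mul (by positivity),
        show 2 * (-((n : ℝ) + 1) / 2) = -((n + 1 : ℕ) : ℝ) by push_cast; ring,
        Real.rpow_neg (by positivity), Real.rpow_natCast, div_pow, inv_div]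
    calc a / 2 * |K| ≤ a / 2 * (C₂ * (B * a ^ (-((n : ℝ) + 1) / 2 - 1))) := by gcongr
      _ = C₂ / 2 * B * a ^ (-((n : ℝ) + 1) / 2) := by
        rw [Real.rpow_sub_one ha0.ne']; field_simp
      _ ≤ C₂ / 2 * B * (2 ^ (n + 1) / p.1 ^ (n + 1)) := by gcongr
      _ = 2 ^ n * C₂ * (q.1 / p.1 ^ n) := by
        rw [hB, pow_succ, pow_succ]; field_simp
      _ ≤ _ := by gcongr; linarith
  · have h1 : |K| ≤ C₁ * (a⁻¹ * B ^ (-((n : ℝ) - 1) / 2)) := by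
      refine le_trans ?_ (integral_sphere_rpow_le hn ha0 hB0)
      rw [hK, ← Real.norm_eq_abs]
      refine norm_integral_le_of_norm_le
        (integrable_sphere (continuous_sphere_rpow hn ha0 hB0.le _)) (.of_forall fun σ => ?_)
      have hσ := abs_inner_sphere_le hn σ
      have h0 : 0 ≤ 2 * B * (1 - inner ℝ (σ : Euc n) (unitVec n 0)) :=
        mul_nonneg (by positivity) (by linarith [(abs_le.1 hσ).2])
      have h3 : 0 ≤ (a + 2 * B * (1 - inner ℝ (σ : Euc n) (unitVec n 0))) ^
        (-((n : ℝ) + 1) / 2) := Real.rpow_nonneg (by linarith) _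
      rw [norm_mul, Real.norm_of_nonneg h3, Real.norm_eq_abs]
      exact mul_le_of_le_one_left h3 hσ
    have hq2 : p.1 / 2 ≤ q.1 := by
      have h2 : (p.1 - q.1) ^ 2 < (p.1 / 2) ^ 2 := by
        have : (p.1 - q.1) ^ 2 ≤ a := by
          rw [ha]; nlinarith [sq_nonneg ε, sq_nonneg (p.2 - q.2)]
        nlinarith
      have := abs_lt_of_sq_lt_sq h2 (by positivity)
      linarith [(abs_lt.1 this).2]
    have h2 : B ^ (-((n : ℝ) - 1) / 2) ≤ 2 ^ n * (p.1 / 2) / p.1 ^ n := by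
      have h3 : (p.1 / 2) ^ (2 : ℝ) ≤ B := by
        rw [Real.rpow_two, hB]; nlinarith
      refine (Real.rpow_le_rpow_of_nonpos (by positivity) h3 (by linarith)).trans_eq ?_
      rw [← Real.rpow_mul (by positivity),
        show 2 * (-((n : ℝ) - 1) / 2) = 1 - (n : ℝ) by ring,
        Real.rpow_sub (by positivity), Real.rpow_natCast, Real.rpow_one, div_pow]
      field_simp
    calc a / 2 * |K| ≤ a / 2 * (C₁ * (a⁻¹ * B ^ (-((n : ℝ) - 1) / 2))) := by gcongr
      _ = C₁ / 2 * B ^ (-((n : ℝ) - 1) / 2) := by field_simp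
      _ ≤ C₁ / 2 * (2 ^ n * (p.1 / 2) / p.1 ^ n) := by gcongr
      _ ≤ C₁ / 2 * (2 ^ n * q.1 / p.1 ^ n) := by gcongr
      _ = 2 ^ n * (C₁ / 2) * (q.1 / p.1 ^ n) := by ring
      _ ≤ _ := by gcongr; linarith

/-! ### The radial flux of the vorticity -/

/-- The scalar vorticity as a function on the plane of the coordinates `(ρ, z)`. -/
noncomputable def planarVorticity {d : ℕ} (v : Euc d → Euc d) (p : ℝ × ℝ) : ℝ :=
  vorticity v p.1 p.2

/-- The properties of the velocity field `v` at one time that determine the radial flux: it is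
axisymmetric without swirl, solenoidal, bounded and in `H¹`, and its scalar vorticity is continuous,
compactly supported and nonnegative in the half plane. -/
structure IsVorticalField (n : ℕ) (v : Euc (n + 1) → Euc (n + 1)) : Prop where
  axisymmetric : IsAxisymmetricNoSwirl v
  differentiable : Differentiable ℝ v
  memLp : MemLp v 2
  memLp_fderiv : MemLp (fderiv ℝ v) 2
  divergence_free : ∀ x, divergence v x = 0
  bounded : ∃ M, ∀ x, ‖v x‖ ≤ M
  continuous_vorticity : Continuous (planarVorticity v)
  hasCompactSupport : HasCompactSupport (planarVorticity v)
  nonneg : ∀ p : ℝ × ℝ, 0 ≤ p.1 → 0 ≤ planarVorticity v p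

instance (n : ℕ) : IsLocallyFiniteMeasure (halfPlaneMeasure n) :=
  IsLocallyFiniteMeasure.withDensity_ofReal (by fun_prop)

theorem integrable_halfPlaneMeasure {n : ℕ} {f : ℝ × ℝ → ℝ} (hf : Continuous f)
    (hfc : HasCompactSupport f) : Integrable f (halfPlaneMeasure n) :=
  hf.integrable_of_hasCompactSupport hfc

theorem ae_halfPlaneMeasure_pos (n : ℕ) : ∀ᵐ p ∂(halfPlaneMeasure n), 0 < p.1 := by
  refine (withDensity_absolutelyContinuous _ _).ae_le ?_
  filter_upwards [ae_restrict_mem (measurableSet_Ioi.prod MeasurableSet.univ)] with p hp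
  exact hp.1

theorem integral_halfPlaneMeasure {n : ℕ} (hn : 2 ≤ n) (f : ℝ × ℝ → ℝ) :
    ∫ p, f p ∂(halfPlaneMeasure n) = ∫ p : ℝ × ℝ, max p.1 0 ^ (n - 1) * f p := by
  have h : ∫ p in Ioi (0 : ℝ) ×ˢ (univ : Set ℝ), max p.1 0 ^ (n - 1) * f p =
      ∫ p : ℝ × ℝ, max p.1 0 ^ (n - 1) * f p :=
    setIntegral_eq_integral_of_forall_compl_eq_zero fun p hp => by
      have hp1 : p.1 ≤ 0 := not_lt.1 fun h => hp ⟨h, mem_univ _⟩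
      rw [max_eq_right hp1, zero_pow (by omega), zero_mul]
  rw [halfPlaneMeasure, integral_withDensity_eq_integral_toReal_smul (by fun_prop)
    (.of_forall fun _ => ENNReal.ofReal_lt_top), ← h]
  refine setIntegral_congr_fun (measurableSet_Ioi.prod MeasurableSet.univ) fun p hp => ?_
  have hp1 : 0 < p.1 := hp.1
  rw [ENNReal.toReal_ofReal (by positivity), max_eq_left hp1.le, smul_eq_mul]

theorem measurable_cylKernel (n : ℕ) (ε : ℝ) :
    StronglyMeasurable fun z : (ℝ × ℝ) × (ℝ × ℝ) => cylKernel n ε z.1 z.2 := by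
  unfold cylKernel
  refine StronglyMeasurable.integral_prod_right' (f := fun z : ((ℝ × ℝ) × (ℝ × ℝ)) ×
    Metric.sphere (0 : Euc n) 1 => (z.1.1.2 - z.1.2.2) * inner ℝ (z.2 : Euc n) (unitVec n 0) *
    (ε ^ 2 + ((z.1.1.1 - z.1.2.1) ^ 2 + (z.1.1.2 - z.1.2.2) ^ 2) +
      2 * (z.1.1.1 * z.1.2.1) * (1 - inner ℝ (z.2 : Euc n) (unitVec n 0))) ^
        (-((n : ℝ) + 1) / 2)) ?_
  refine Measurable.stronglyMeasurable ?_
  fun_prop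

/-- A crude bound on the regularised kernel, which depends on `ε` and serves only for
integrability. -/
theorem abs_cylKernel_le {n : ℕ} (hn : 2 ≤ n) {ε : ℝ} (hε : 0 < ε) {p q : ℝ × ℝ}
    (hp : 0 < p.1) (hq : 0 < q.1) :
    |cylKernel n ε p q| ≤ (sphereMeasure n).real univ * (ε ^ 2) ^ (-((n : ℝ) + 1) / 2) *
      ((1 + |p.2|) * (1 + |q.2|)) := by
  rw [cylKernel, ← Real.norm_eq_abs]
  refine (norm_integral_le_of_norm_le_const (C := (1 + |p.2|) * (1 + |q.2|) *
    (ε ^ 2) ^ (-((n : ℝ) + 1) / 2)) (.of_forall fun σ => ?_)).trans_eq (by ring)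
  have hσ := abs_inner_sphere_le hn σ
  have h0 : 0 ≤ 2 * (p.1 * q.1) * (1 - inner ℝ (σ : Euc n) (unitVec n 0)) :=
    mul_nonneg (by positivity) (by linarith [(abs_le.1 hσ).2])
  have h1 : ε ^ 2 ≤ ε ^ 2 + ((p.1 - q.1) ^ 2 + (p.2 - q.2) ^ 2) +
      2 * (p.1 * q.1) * (1 - inner ℝ (σ : Euc n) (unitVec n 0)) := by
    nlinarith [sq_nonneg (p.1 - q.1), sq_nonneg (p.2 - q.2)]
  have hε2 : 0 < ε ^ 2 := by positivity
  have h2 : |p.2 - q.2| ≤ (1 + |p.2|) * (1 + |q.2|) := by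
    have := abs_sub p.2 q.2
    nlinarith [abs_nonneg p.2, abs_nonneg q.2]
  have hn0 : (0 : ℝ) ≤ n := Nat.cast_nonneg n
  rw [norm_mul, norm_mul, Real.norm_of_nonneg (Real.rpow_nonneg (hε2.le.trans h1) _)]
  refine mul_le_mul ?_ (Real.rpow_le_rpow_of_nonpos hε2 h1 (by linarith))
    (Real.rpow_nonneg (hε2.le.trans h1) _) (by positivity)
  exact (mul_le_of_le_one_right (norm_nonneg _) hσ).trans h2

section

variable {n : ℕ} {v : Euc (n + 1) → Euc (n + 1)}

theorem IsVorticalField.continuous_vorticityOn (hv : IsVorticalField n v) :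
    Continuous (vorticityOn v) := by
  have h1 := hv.continuous_vorticity
  have h2 := continuous_rCoord (d := n + 1)
  have h3 := continuous_zCoord (d := n + 1)
  change Continuous fun x => planarVorticity v (rCoord x, zCoord x)
  fun_prop

theorem IsVorticalField.hasCompactSupport_vorticityOn (hn : 2 ≤ n) (hv : IsVorticalField n v) :
    HasCompactSupport (vorticityOn v) := by
  obtain ⟨R, hR⟩ := hv.hasCompactSupport.isCompact.isBounded.exists_norm_le
  refine HasCompactSupport.intro (isCompact_closedBall 0 (|R| + |R|)) fun x hx => ?_
  refine image_eq_zero_of_notMem_tsupport (f := planarVorticity v) (x := (rCoord x, zCoord x))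
    fun hm => hx ?_
  have h := hR _ hm
  rw [Prod.norm_def, sup_le_iff, Real.norm_eq_abs, Real.norm_eq_abs] at h
  have h2 := norm_sq_eq_rCoord (by omega) x
  rw [mem_closedBall_zero_iff]
  have h3 := le_abs_self R
  have h4 := sq_le_sq' (by linarith [abs_nonneg (rCoord x), neg_abs_le (rCoord x)])
    ((le_abs_self (rCoord x)).trans (h.1.trans h3))
  have h5 := sq_le_sq' (by linarith [abs_nonneg (zCoord x), neg_abs_le (zCoord x)])
    ((le_abs_self (zCoord x)).trans (h.2.trans h3))
  refine (sq_le_sq₀ (norm_nonneg _) (by positivity)).1 ?_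
  nlinarith [abs_nonneg R]

/-- The mollified Biot–Savart law in the half plane. -/
theorem IsVorticalField.integral_mollified (hn : 2 ≤ n) (hv : IsVorticalField n v) {ε : ℝ}
    (hε : 0 < ε) (p : ℝ × ℝ) :
    ∫ y, inner ℝ (v y) (unitVec (n + 1) 0) * ((n + 1 : ℕ) * ε ^ 2 *
        (ε ^ 2 + ‖y - planeEmb (n + 1) p‖ ^ 2) ^ (-((n + 1 : ℕ) : ℝ) / 2 - 1)) =
      ∫ q, planarVorticity v q * cylKernel n ε p q ∂(halfPlaneMeasure n) := by
  have hd : 3 ≤ n + 1 := by omega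
  set x := planeEmb (n + 1) p with hx
  have hz : zCoord (unitVec (n + 1) 0) = 0 := inner_radial_axial hd
  rw [hv.axisymmetric.integral_mollified hd (fun y => (hv.differentiable y).hasFDerivAt) hv.memLp
    hv.memLp_fderiv hv.divergence_free hε x _ hz]
  have hoff : ∀ y : Euc (n + 1), (inner ℝ (offAxis y) (unitVec (n + 1) 0) : ℝ) =
      inner ℝ y (unitVec (n + 1) 0) := fun y => by
    rw [offAxis, inner_sub_left, real_inner_smul_left, inner_axial_radial hd, mul_zero, sub_zero]
  set P : Euc (n + 1) → ℝ := fun y => (ε ^ 2 + ‖y - x‖ ^ 2) ^ (-((n + 1 : ℕ) : ℝ) / 2) with hP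
  have hPc : Continuous P :=
    Continuous.rpow_const (by fun_prop) fun y => .inl (by positivity)
  have hP0 : ∀ y, 0 ≤ P y := fun y => Real.rpow_nonneg (by positivity) _
  set F : Euc (n + 1) → ℝ := fun y => vorticityOn v y / rCoord y *
    inner ℝ (offAxis y) (unitVec (n + 1) 0) * zCoord (x - y) * P y with hF
  have hωc := hv.continuous_vorticityOn
  have hzc := continuous_zCoord (d := n + 1)
  have hrc := continuous_rCoord (d := n + 1)
  have hoc := continuous_offAxis (d := n + 1)
  have hFm : Measurable F :=
    (((hωc.measurable.div hrc.measurable).mul (by fun_prop)).mul (by fun_prop)).mul hPc.measurable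
  have hFi : Integrable F := by
    have hG : Integrable fun y => vorticityOn v y * (zCoord (x - y) * P y) :=
      Continuous.integrable_of_hasCompactSupport (by fun_prop)
        (hv.hasCompactSupport_vorticityOn hn).mul_right
    refine hG.norm.mono' hFm.aestronglyMeasurable (.of_forall fun y => ?_)
    have h1 : |(inner ℝ (offAxis y) (unitVec (n + 1) 0) : ℝ)| ≤ rCoord y := by
      have := abs_real_inner_le_norm (offAxis y) (unitVec (n + 1) 0)
      rwa [norm_unitVec (by omega), mul_one] at this
    have h2 : |vorticityOn v y / rCoord y * inner ℝ (offAxis y) (unitVec (n + 1) 0)| ≤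
        |vorticityOn v y| := by
      have hr : 0 ≤ rCoord y := norm_nonneg _
      rw [abs_mul, abs_div, abs_of_nonneg hr, div_mul_eq_mul_div]
      exact div_le_of_le_mul₀ hr (abs_nonneg _) (mul_le_mul_of_nonneg_left h1 (abs_nonneg _))
    simp only [hF, norm_mul, Real.norm_eq_abs]
    rw [mul_assoc]
    rw [abs_mul] at h2
    exact mul_le_mul_of_nonneg_right h2 (by positivity)
  have hmp := measurePreserving_cylMap hn
  have e1 : ∫ y, F y = ∫ z, F (cylMap n z) ∂((halfPlaneMeasure n).prod (sphereMeasure n)) := by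
    rw [← hmp.map_eq, integral_map hmp.measurable.aemeasurable hFm.aestronglyMeasurable]
  have hFi' : Integrable (fun z => F (cylMap n z)) ((halfPlaneMeasure n).prod (sphereMeasure n)) :=
    hmp.integrable_comp_of_integrable hFi
  change ∫ y, F y = _
  rw [e1, integral_prod _ hFi']
  refine integral_congr_ae ?_
  filter_upwards [ae_halfPlaneMeasure_pos n] with q hq
  rw [cylKernel, ← integral_const_mul]
  refine integral_congr_ae (.of_forall fun σ => ?_)
  simp only [hF, hP]
  have hvq : vorticityOn v (cylMap n (q, σ)) = planarVorticity v q := by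
    rw [vorticityOn, rCoord_cylMap hn hq.le, zCoord_cylMap]; rfl
  have hzx : zCoord x = p.2 := zCoord_meridian hd _ _
  rw [hvq, hoff, inner_cylMap_radial hn, rCoord_cylMap hn hq.le, zCoord_sub, zCoord_cylMap, hzx,
    hx, norm_cylMap_sub_sq hn]
  have e3 : -((n + 1 : ℕ) : ℝ) / 2 = -((n : ℝ) + 1) / 2 := by push_cast; rfl
  rw [e3, ← add_assoc (ε ^ 2) ((p.1 - q.1) ^ 2 + (p.2 - q.2) ^ 2)]
  field_simp

/-- The pairing of `V(ρ) ω` with the radial velocity of the regularised Biot–Savart law. -/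
noncomputable def regFlux (n : ℕ) (v : Euc (n + 1) → Euc (n + 1)) (V : ℝ → ℝ) (ε : ℝ) : ℝ :=
  ∫ p, V p.1 * planarVorticity v p *
    ∫ q, planarVorticity v q * cylKernel n ε p q ∂(halfPlaneMeasure n) ∂(halfPlaneMeasure n)

/-- The regularised fluxes converge to a multiple of the flux of the field itself. -/
theorem IsVorticalField.tendsto_regFlux (hn : 2 ≤ n) (hv : IsVorticalField n v) {V : ℝ → ℝ}
    (hV : Continuous V) :
    Filter.Tendsto (regFlux n v V) (nhdsWithin 0 (Ioi 0))
      (nhds (mollifierMass (n + 1) *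
        ∫ p, V p.1 * planarVorticity v p * radialComp v p.1 p.2 ∂(halfPlaneMeasure n))) := by
  obtain ⟨M, hM⟩ := hv.bounded
  set g : Euc (n + 1) → ℝ := fun y => inner ℝ (v y) (unitVec (n + 1) 0) with hg
  have hvc := hv.differentiable.continuous
  have hgc : Continuous g := by fun_prop
  have hgM : ∀ y, |g y| ≤ M := fun y => by
    have := abs_real_inner_le_norm (v y) (unitVec (n + 1) 0)
    rw [norm_unitVec (by omega), mul_one] at this
    exact this.trans (hM y)
  have hω := hv.continuous_vorticity
  have hi : Integrable (fun p => V p.1 * planarVorticity v p) (halfPlaneMeasure n) :=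
    integrable_halfPlaneMeasure (by fun_prop) hv.hasCompactSupport.mul_left
  rw [← integral_const_mul]
  refine tendsto_integral_filter_of_dominated_convergence
    (fun p => |V p.1 * planarVorticity v p| * (M * mollifierMass (n + 1))) ?_ ?_
    (hi.norm.mul_const _) ?_
  · refine .of_forall fun ε => (hi.aestronglyMeasurable).mul ?_
    refine (StronglyMeasurable.integral_prod_right' (f := fun z : (ℝ × ℝ) × (ℝ × ℝ) =>
      planarVorticity v z.2 * cylKernel n ε z.1 z.2) ?_).aestronglyMeasurable
    exact (hω.comp continuous_snd).stronglyMeasurable.mul (measurable_cylKernel n ε)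
  · filter_upwards [self_mem_nhdsWithin] with ε hε
    filter_upwards [ae_halfPlaneMeasure_pos n] with p hp
    rw [norm_mul, ← hv.integral_mollified hn hε p]
    exact mul_le_mul_of_nonneg_left (abs_integral_mollifier_le hgM hε _) (norm_nonneg _)
  · filter_upwards [ae_halfPlaneMeasure_pos n] with p hp
    have h1 := (tendsto_integral_mollifier hgc hgM (planeEmb (n + 1) p)).const_mul
      (V p.1 * planarVorticity v p)
    have h2 : mollifierMass (n + 1) * (V p.1 * planarVorticity v p * radialComp v p.1 p.2) =
        V p.1 * planarVorticity v p * (mollifierMass (n + 1) * g (planeEmb (n + 1) p)) := by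
      rw [hg, radialComp, planeEmb_apply]; ring
    rw [h2]
    refine h1.congr' ?_
    filter_upwards [self_mem_nhdsWithin] with ε hε
    rw [← hv.integral_mollified hn hε p]

theorem IsVorticalField.integrable_kernel (hn : 2 ≤ n) (hv : IsVorticalField n v) {V : ℝ → ℝ}
    (hV : Continuous V) {ε : ℝ} (hε : 0 < ε) :
    Integrable (fun z : (ℝ × ℝ) × (ℝ × ℝ) => V z.1.1 * planarVorticity v z.1 *
      (planarVorticity v z.2 * cylKernel n ε z.1 z.2))
      ((halfPlaneMeasure n).prod (halfPlaneMeasure n)) := by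
  have hω := hv.continuous_vorticity
  have hi1 : Integrable (fun p : ℝ × ℝ => V p.1 * planarVorticity v p * (1 + |p.2|))
      (halfPlaneMeasure n) :=
    integrable_halfPlaneMeasure (by fun_prop) hv.hasCompactSupport.mul_left.mul_right
  have hi2 : Integrable (fun p : ℝ × ℝ => planarVorticity v p * (1 + |p.2|))
      (halfPlaneMeasure n) :=
    integrable_halfPlaneMeasure (by fun_prop) hv.hasCompactSupport.mul_right
  refine ((hi1.norm.mul_prod hi2.norm).const_mul ((sphereMeasure n).real univ *
    (ε ^ 2) ^ (-((n : ℝ) + 1) / 2))).mono' ?_ ?_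
  · exact ((Continuous.stronglyMeasurable (by fun_prop)).mul
      ((hω.comp continuous_snd).stronglyMeasurable.mul
        (measurable_cylKernel n ε))).aestronglyMeasurable
  · filter_upwards [Measure.quasiMeasurePreserving_fst.ae (ae_halfPlaneMeasure_pos n),
      Measure.quasiMeasurePreserving_snd.ae (ae_halfPlaneMeasure_pos n)] with z h1 h2
    have h3 := abs_cylKernel_le hn hε h1 h2
    simp only [norm_mul, Real.norm_eq_abs]
    have h4 : abs (1 + |z.1.2|) = 1 + |z.1.2| := abs_of_nonneg (by positivity)
    have h5 : abs (1 + |z.2.2|) = 1 + |z.2.2| := abs_of_nonneg (by positivity)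
    rw [h4, h5]
    calc _ ≤ |V z.1.1| * |planarVorticity v z.1| * (|planarVorticity v z.2| *
          ((sphereMeasure n).real univ * (ε ^ 2) ^ (-((n : ℝ) + 1) / 2) *
      ((1 + |z.1.2|) * (1 + |z.2.2|)))) := by gcongr
      _ = _ := by ring

/-- Symmetrisation of the flux, by the antisymmetry of the kernel. -/
theorem IsVorticalField.two_mul_regFlux (hn : 2 ≤ n) (hv : IsVorticalField n v) {V : ℝ → ℝ}
    (hV : Continuous V) {ε : ℝ} (hε : 0 < ε) :
    2 * regFlux n v V ε = ∫ z : (ℝ × ℝ) × (ℝ × ℝ), (V z.1.1 - V z.2.1) *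
      (planarVorticity v z.1 * planarVorticity v z.2 * cylKernel n ε z.1 z.2)
      ∂((halfPlaneMeasure n).prod (halfPlaneMeasure n)) := by
  have hi := hv.integrable_kernel hn hV hε
  have h1 : regFlux n v V ε = ∫ z : (ℝ × ℝ) × (ℝ × ℝ), V z.1.1 * planarVorticity v z.1 *
      (planarVorticity v z.2 * cylKernel n ε z.1 z.2)
      ∂((halfPlaneMeasure n).prod (halfPlaneMeasure n)) := by
    rw [integral_prod _ hi, regFlux]
    simp only [integral_const_mul]
  have h2 := integral_prod_swap (μ := halfPlaneMeasure n) (ν := halfPlaneMeasure n)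
    (fun z : (ℝ × ℝ) × (ℝ × ℝ) => V z.1.1 * planarVorticity v z.1 *
      (planarVorticity v z.2 * cylKernel n ε z.1 z.2))
  rw [← h1] at h2
  rw [two_mul]
  nth_rewrite 1 [h1]
  have hi' : Integrable (fun z : (ℝ × ℝ) × (ℝ × ℝ) => V z.swap.1.1 * planarVorticity v z.swap.1 *
      (planarVorticity v z.swap.2 * cylKernel n ε z.swap.1 z.swap.2))
      ((halfPlaneMeasure n).prod (halfPlaneMeasure n)) := hi.swap
  rw [← h2, ← integral_add hi hi']
  refine integral_congr_ae (.of_forall fun z => ?_)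
  simp only [Prod.fst_swap, Prod.snd_swap]
  rw [cylKernel_comm n ε z.1 z.2]
  ring

/-- The total radial flux vanishes: for the weight `V = 1` the symmetrised integrand is zero. -/
theorem IsVorticalField.integral_mul_radialComp (hn : 2 ≤ n) (hv : IsVorticalField n v) :
    ∫ p, planarVorticity v p * radialComp v p.1 p.2 ∂(halfPlaneMeasure n) = 0 := by
  have h1 := hv.tendsto_regFlux hn (V := fun _ => 1) continuous_const
  have h2 : Filter.Tendsto (regFlux n v fun _ => 1) (nhdsWithin 0 (Ioi 0)) (nhds 0) := by
    refine tendsto_const_nhds.congr' ?_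
    filter_upwards [self_mem_nhdsWithin] with ε hε
    have := hv.two_mul_regFlux hn (V := fun _ => 1) continuous_const hε
    simp only [sub_self, zero_mul, integral_zero] at this
    linarith
  have h3 := tendsto_nhds_unique h1 h2
  simp only [one_mul] at h3
  exact (mul_eq_zero.1 h3).resolve_left (mollifierMass_pos (by omega)).ne'

/-- The radial flux of the vorticity through the region `ρ > r`, weighted with a Lipschitz function
of the radius. -/
theorem IsVorticalField.abs_integral_flux_le (hn : 2 ≤ n) (hv : IsVorticalField n v) {V : ℝ → ℝ}
    (hV : Continuous V) {Λ r : ℝ} (hΛ : 0 ≤ Λ) (hr : 0 < r) (hVr : ∀ a, a ≤ r → V a = 0)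
    (hVl : ∀ a b, |V a - V b| ≤ Λ * |a - b|) :
    mollifierMass (n + 1) *
        |∫ p, V p.1 * planarVorticity v p * radialComp v p.1 p.2 ∂(halfPlaneMeasure n)| ≤
      Λ * kernelConst n * (∫ p, p.1 * planarVorticity v p ∂(halfPlaneMeasure n)) *
        (r⁻¹ * outerMass v r) := by
  have hω := hv.continuous_vorticity
  have hC := kernelConst_nonneg n
  set μ := halfPlaneMeasure n with hμ
  -- By the kernel bound, the symmetrised integrand is at most `A ⊗ B + B ⊗ A`: `A` is taken at a
  -- point beyond `r`, and `B` is the density of the impulse.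
  set A : ℝ × ℝ → ℝ := indicator {p | r < p.1} fun p => planarVorticity v p / p.1 ^ n with hA
  set B : ℝ × ℝ → ℝ := fun p => p.1 * planarVorticity v p with hB
  have hmeas : MeasurableSet {p : ℝ × ℝ | r < p.1} :=
    measurableSet_lt measurable_const measurable_fst
  have hBi : Integrable B μ :=
    integrable_halfPlaneMeasure (by fun_prop) hv.hasCompactSupport.mul_left
  have hAi : Integrable A μ := by
    have h1 : Integrable (fun p => planarVorticity v p * (r ^ n)⁻¹) μ :=
      integrable_halfPlaneMeasure (by fun_prop) hv.hasCompactSupport.mul_right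
    refine h1.norm.mono' ?_ (.of_forall fun p => ?_)
    · exact ((hω.measurable.div (by fun_prop)).indicator hmeas).aestronglyMeasurable
    · by_cases hp : r < p.1
      · rw [hA, indicator_of_mem (show p ∈ {p : ℝ × ℝ | r < p.1} from hp), norm_div, norm_mul,
          div_eq_mul_inv, norm_inv, norm_pow, norm_pow, Real.norm_of_nonneg hr.le,
          Real.norm_of_nonneg (hr.le.trans hp.le)]
        gcongr
      · rw [hA, indicator_of_notMem (show p ∉ {p : ℝ × ℝ | r < p.1} from hp), norm_zero]
        positivity
  have hA0 : ∀ p, 0 ≤ A p := fun p =>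
    indicator_nonneg (s := {p : ℝ × ℝ | r < p.1}) (f := fun p => planarVorticity v p / p.1 ^ n)
      (fun q hq => div_nonneg (hv.nonneg q (hr.le.trans (le_of_lt hq)))
        (pow_nonneg (hr.le.trans (le_of_lt hq)) _)) p
  have hB0 : 0 ≤ ∫ p, B p ∂μ := by
    refine integral_nonneg_of_ae ?_
    filter_upwards [ae_halfPlaneMeasure_pos n] with p hp
    exact mul_nonneg hp.le (hv.nonneg p hp.le)
  have hbound : ∀ ε : ℝ, 0 < ε → |regFlux n v V ε| ≤
      Λ * kernelConst n * (∫ p, B p ∂μ) * ∫ p, A p ∂μ := fun ε hε => by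
    have h1 := hv.two_mul_regFlux hn hV hε
    have hgi : Integrable (fun z : (ℝ × ℝ) × (ℝ × ℝ) => Λ * kernelConst n *
        (A z.1 * B z.2 + B z.1 * A z.2)) (μ.prod μ) :=
      ((hAi.mul_prod hBi).add (hBi.mul_prod hAi)).const_mul _
    have h2 : |2 * regFlux n v V ε| ≤ ∫ z : (ℝ × ℝ) × (ℝ × ℝ), Λ * kernelConst n *
        (A z.1 * B z.2 + B z.1 * A z.2) ∂(μ.prod μ) := by
      rw [h1, ← Real.norm_eq_abs]
      refine norm_integral_le_of_norm_le hgi ?_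
      filter_upwards [Measure.quasiMeasurePreserving_fst.ae (ae_halfPlaneMeasure_pos n),
        Measure.quasiMeasurePreserving_snd.ae (ae_halfPlaneMeasure_pos n)] with z hz1 hz2
      have k1 := abs_mul_cylKernel_le hn hε hz1 hz2
      have k2 := abs_mul_cylKernel_le hn hε hz2 hz1
      rw [cylKernel_comm n ε z.1 z.2, abs_neg, abs_sub_comm] at k2
      have n1 := hv.nonneg _ hz1.le
      have n2 := hv.nonneg _ hz2.le
      have hA1 : 0 ≤ A z.1 * B z.2 := mul_nonneg (hA0 _) (mul_nonneg hz2.le n2)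
      have hA2 : 0 ≤ B z.1 * A z.2 := mul_nonneg (mul_nonneg hz1.le n1) (hA0 _)
      rw [norm_mul, norm_mul, norm_mul, Real.norm_of_nonneg n1, Real.norm_of_nonneg n2,
        Real.norm_eq_abs, Real.norm_eq_abs]
      have hstep : |V z.1.1 - V z.2.1| * (planarVorticity v z.1 * planarVorticity v z.2 *
          |cylKernel n ε z.1 z.2|) ≤ Λ * (planarVorticity v z.1 * planarVorticity v z.2 *
            (|z.1.1 - z.2.1| * |cylKernel n ε z.1 z.2|)) := by
        refine (mul_le_mul_of_nonneg_right (hVl z.1.1 z.2.1) (by positivity)).trans_eq (by ring)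
      by_cases h3 : r < z.1.1
      · have e1 : A z.1 = planarVorticity v z.1 / z.1.1 ^ n :=
          indicator_of_mem (show z.1 ∈ {p : ℝ × ℝ | r < p.1} from h3) _
        calc _ ≤ _ := hstep
          _ ≤ Λ * (planarVorticity v z.1 * planarVorticity v z.2 *
            (kernelConst n * (z.2.1 / z.1.1 ^ n))) := by gcongr
          _ = Λ * kernelConst n * (A z.1 * B z.2) := by rw [e1, hB]; ring
          _ ≤ _ := by gcongr; linarith
      · by_cases h4 : r < z.2.1
        · have e1 : A z.2 = planarVorticity v z.2 / z.2.1 ^ n :=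
            indicator_of_mem (show z.2 ∈ {p : ℝ × ℝ | r < p.1} from h4) _
          calc _ ≤ _ := hstep
            _ ≤ Λ * (planarVorticity v z.1 * planarVorticity v z.2 *
              (kernelConst n * (z.1.1 / z.2.1 ^ n))) := by gcongr
            _ = Λ * kernelConst n * (B z.1 * A z.2) := by rw [e1, hB]; ring
            _ ≤ _ := by gcongr; linarith
        · rw [hVr _ (not_lt.1 h3), hVr _ (not_lt.1 h4), sub_zero, abs_zero, zero_mul]
          positivity
    rw [integral_const_mul, integral_add (hAi.mul_prod hBi) (hBi.mul_prod hAi),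
      integral_prod_mul, integral_prod_mul, abs_mul, abs_two] at h2
    linarith
  have hlim := (hv.tendsto_regFlux hn hV).abs
  have hle := le_of_tendsto hlim (by
    filter_upwards [self_mem_nhdsWithin] with ε hε
    exact hbound ε hε)
  rw [abs_mul, abs_of_pos (mollifierMass_pos (by omega))] at hle
  refine hle.trans (mul_le_mul_of_nonneg_left ?_ (by positivity))
  rw [outerMass, integral_halfPlaneMeasure hn, ← integral_const_mul]
  have hout : MeasurableSet (outerRegion r) :=
    (measurableSet_le measurable_const measurable_fst).inter
      (measurableSet_le measurable_const measurable_fst)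
  rw [← integral_indicator hout]
  have hii : Integrable ((outerRegion r).indicator fun q : ℝ × ℝ =>
      r⁻¹ * vorticity v q.1 q.2) :=
    Integrable.indicator ((hω.integrable_of_hasCompactSupport hv.hasCompactSupport).const_mul _)
      hout
  refine integral_mono_of_nonneg (.of_forall fun p => ?_) hii (.of_forall fun p => ?_)
  · exact mul_nonneg (pow_nonneg (le_max_right _ _) _) (hA0 p)
  · dsimp only
    by_cases hp : r < p.1
    · have hp0 : 0 < p.1 := hr.trans hp
      have hn0 := hv.nonneg p hp0.le
      rw [hA, indicator_of_mem (show p ∈ {p : ℝ × ℝ | r < p.1} from hp),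
        indicator_of_mem (show p ∈ outerRegion r from ⟨hp0.le, hp.le⟩), max_eq_left hp0.le]
      have e1 : p.1 ^ (n - 1) * (planarVorticity v p / p.1 ^ n) = p.1⁻¹ * planarVorticity v p := by
        obtain ⟨m, rfl⟩ : ∃ m, n = m + 1 := ⟨n - 1, by omega⟩
        rw [Nat.add_sub_cancel, pow_succ]; field_simp
      rw [e1]
      refine mul_le_mul_of_nonneg_right ?_ hn0
      gcongr
    · rw [hA, indicator_of_notMem (show p ∉ {p : ℝ × ℝ | r < p.1} from hp), mul_zero]
      exact indicator_nonneg (fun p (hp : p ∈ outerRegion r) =>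
        mul_nonneg (by positivity) (hv.nonneg p hp.1)) _

end

/-! ### Evolution of radial moments of the vorticity -/

/-- The weak form of the vorticity equation for test functions of the radius only. -/
theorem PlanarFlow.integral_planarCurl_mul_radial {t₁ : ℝ}
    {w w' : ℝ → BoundedContinuousFunction (ℝ × ℝ) (ℝ × ℝ)}
    {D : ℝ → BoundedContinuousFunction (ℝ × ℝ) (ℝ × ℝ →L[ℝ] ℝ × ℝ)} (hW : PlanarFlow t₁ w w' D)
    {R : ℝ} (hR : 0 < R) (hsupp : ∀ t ∈ Icc 0 t₁, ∀ p : ℝ × ℝ, R < ‖p‖ → planarCurl (D t p) = 0)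
    {f f' : ℝ → ℝ} (hf : ∀ ρ, HasDerivAt f (f' ρ) ρ) (hf' : Continuous f') {t : ℝ}
    (ht : t ∈ Icc 0 t₁) :
    (∫ p : ℝ × ℝ, planarCurl (D t p) * f p.1) - ∫ p : ℝ × ℝ, planarCurl (D 0 p) * f p.1 =
      ∫ τ in (0 : ℝ)..t, ∫ p : ℝ × ℝ, planarCurl (D τ p) * ((w τ p).1 * f' p.1) := by
  -- The cut-off equals `1` near the support of the vorticity.
  let χ : ContDiffBump (0 : ℝ) := ⟨R + 1, R + 2, by linarith, by linarith⟩
  have hdf : deriv f = f' := funext fun ρ => (hf ρ).deriv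
  have hfc : ContDiff ℝ 1 f := contDiff_one_iff_deriv.2
    ⟨fun ρ => (hf ρ).differentiableAt, by rwa [hdf]⟩
  have hχ : ContDiff ℝ 1 (χ : ℝ → ℝ) := χ.contDiff
  have hχ1 : ∀ ρ : ℝ, |ρ| ≤ R → χ =ᶠ[nhds ρ] fun _ => 1 := fun ρ hρ => by
    refine χ.eventuallyEq_one_of_mem_ball ?_
    rw [mem_ball_zero_iff, Real.norm_eq_abs]
    change |ρ| < R + 1
    linarith
  have key := hW.integral_planarCurl_sub (X := fun _ => 0) (X' := fun _ => 0) continuous_const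
    continuous_const (fun τ _ => hasDerivWithinAt_const _ _ _) (g := fun ρ => f ρ * χ ρ) (h := χ)
    (hfc.mul hχ) hχ χ.hasCompactSupport.mul_left χ.hasCompactSupport ht
  simp only [zero_add, sub_zero] at key
  have hcut : ∀ τ ∈ Icc 0 t₁, ∀ p : ℝ × ℝ, planarCurl (D τ p) ≠ 0 → |p.1| ≤ R ∧ |p.2| ≤ R :=
    fun τ hτ p hp => by
      have h1 : ‖p‖ ≤ R := not_lt.1 fun h => hp (hsupp τ hτ p h)
      exact ⟨(norm_fst_le p).trans h1, (norm_snd_le p).trans h1⟩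
  have e1 : ∀ τ ∈ Icc 0 t₁, ∫ p : ℝ × ℝ, planarCurl (D τ p) * (f p.1 * χ p.1 * χ p.2) =
      ∫ p : ℝ × ℝ, planarCurl (D τ p) * f p.1 := fun τ hτ => by
    refine integral_congr_ae (.of_forall fun p => ?_)
    by_cases hp : planarCurl (D τ p) = 0
    · simp only [hp, zero_mul]
    · obtain ⟨h1, h2⟩ := hcut τ hτ p hp
      simp only [(hχ1 _ h1).eq_of_nhds, (hχ1 _ h2).eq_of_nhds, mul_one]
  rw [e1 t ht, e1 0 ⟨le_rfl, ht.1.trans ht.2⟩] at key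
  rw [key]
  refine intervalIntegral.integral_congr fun τ hτ => ?_
  rw [uIcc_of_le ht.1] at hτ
  refine integral_congr_ae (.of_forall fun p => ?_)
  by_cases hp : planarCurl (D τ p) = 0
  · simp only [hp, zero_mul]
  · obtain ⟨h1, h2⟩ := hcut τ ⟨hτ.1, hτ.2.trans ht.2⟩ p hp
    have d1 : deriv (fun ρ => f ρ * χ ρ) p.1 = f' p.1 := by
      rw [← hdf]
      refine Filter.EventuallyEq.deriv_eq ?_
      filter_upwards [hχ1 _ h1] with ρ hρ
      rw [hρ, mul_one]
    have d2 : deriv (χ : ℝ → ℝ) p.2 = 0 := by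
      rw [(hχ1 _ h2).deriv_eq, deriv_const]
    simp only [d1, d2, (hχ1 _ h2).eq_of_nhds, mul_one, mul_zero, add_zero]

/-- An axisymmetric solution of the Euler equations without swirl whose initial scalar vorticity is
nonnegative and compactly supported. -/
structure IsVorticalSolution (n : ℕ) (s : ℝ) (T : EReal) (u : ℝ → Euc (n + 1) → Euc (n + 1)) :
    Prop where
  two_le : 2 ≤ n
  regularity : 1 + ((n + 1 : ℕ) : ℝ) / 2 < s
  time_pos : 0 < T
  euler : IsEulerSolution (n + 1) s T u
  axisymmetric : ∀ t ∈ timeInterval T, IsAxisymmetricNoSwirl (u t)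
  nonneg : ∀ x, 0 ≤ vorticityOn (u 0) x
  hasCompactSupport : HasCompactSupport (vorticityOn (u 0))

section

variable {n : ℕ} {s : ℝ} {T : EReal} {u : ℝ → Euc (n + 1) → Euc (n + 1)}

theorem IsVorticalSolution.exists_planarFlow (hu : IsVorticalSolution n s T u) {t₁ : ℝ}
    (ht₁ : t₁ ∈ timeInterval T) :
    ∃ (w w' : ℝ → BoundedContinuousFunction (ℝ × ℝ) (ℝ × ℝ))
      (D : ℝ → BoundedContinuousFunction (ℝ × ℝ) (ℝ × ℝ →L[ℝ] ℝ × ℝ)), PlanarFlow t₁ w w' D ∧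
      (∀ t ∈ Icc 0 t₁, ∀ p, w t p = planarField (u t) p) ∧
      (∀ t ∈ Icc 0 t₁, ∀ p : ℝ × ℝ, planarVorticity (u t) p = planarCurl (D t p)) ∧
      (∀ t ∈ Icc 0 t₁, ∀ p : ℝ × ℝ, 0 ≤ p.1 → 0 ≤ planarCurl (D t p)) ∧
      ∃ R, 0 < R ∧ ∀ t ∈ Icc 0 t₁, ∀ p : ℝ × ℝ, R < ‖p‖ → planarCurl (D t p) = 0 :=
  hu.euler.exists_planarFlow_support (by have := hu.two_le; omega) hu.regularity hu.time_pos
    hu.axisymmetric hu.nonneg hu.hasCompactSupport ht₁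

theorem IsVorticalSolution.isVorticalField (hu : IsVorticalSolution n s T u) {t : ℝ}
    (ht : t ∈ timeInterval T) : IsVorticalField n (u t) := by
  obtain ⟨U, U', D, hU, -, -, hD, -, h2, hD2⟩ :=
    hu.euler.exists_uniform_curves hu.regularity hu.time_pos
  obtain ⟨w, w', A, hW, hw, hcurl, hnn, R, hR, hsupp⟩ := hu.exists_planarFlow ht
  have htt : t ∈ Icc 0 t := ⟨ht.1, le_rfl⟩
  have hcurl' : planarVorticity (u t) = fun p => planarCurl (A t p) := funext (hcurl t htt)
  refine ⟨hu.axisymmetric t ht, hu.euler.differentiable t ht, h2 t ht, ?_,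
    hu.euler.divergence_free t ht, ⟨‖U t‖, fun x => ?_⟩, ?_, ?_, fun p hp => ?_⟩
  · have : fderiv ℝ (u t) = fun x => D t x := funext fun x => (hD t ht x).fderiv
    rw [this]; exact hD2 t ht
  · rw [← hU t ht]; exact (U t).norm_coe_le_norm x
  · rw [hcurl']
    exact hW.continuous_planarCurl.comp (continuous_const.prodMk continuous_id)
  · refine HasCompactSupport.intro (isCompact_closedBall 0 R) fun p hp => ?_
    rw [hcurl']
    exact hsupp t htt p (by simpa using hp)
  · rw [hcurl']
    exact hnn t htt p hp

/-- The primitive of `V(ρ) ρ^{n-1}` on `ρ > 0`, extended by zero. -/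
noncomputable def radialPrimitive (n : ℕ) (V : ℝ → ℝ) (ρ : ℝ) : ℝ :=
  ∫ s in (0 : ℝ)..ρ, V s * max s 0 ^ (n - 1)

theorem hasDerivAt_radialPrimitive (n : ℕ) {V : ℝ → ℝ} (hV : Continuous V) (ρ : ℝ) :
    HasDerivAt (radialPrimitive n V) (V ρ * max ρ 0 ^ (n - 1)) ρ :=
  ((show Continuous fun s => V s * max s 0 ^ (n - 1) by fun_prop).integral_hasStrictDerivAt
    0 ρ).hasDerivAt

theorem continuous_radialPrimitive (n : ℕ) {V : ℝ → ℝ} (hV : Continuous V) :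
    Continuous (radialPrimitive n V) :=
  continuous_iff_continuousAt.2 fun ρ => (hasDerivAt_radialPrimitive n hV ρ).continuousAt

/-- The moment of the vorticity with weight `f(ρ)`, where `f' = V ρ^{n-1}`, changes by the radial
flux weighted with `V`. -/
theorem IsVorticalSolution.integral_radialPrimitive_sub (hu : IsVorticalSolution n s T u) {t : ℝ}
    (ht : t ∈ timeInterval T) {V : ℝ → ℝ} (hV : Continuous V) :
    (∫ p : ℝ × ℝ, planarVorticity (u t) p * radialPrimitive n V p.1) -
        ∫ p : ℝ × ℝ, planarVorticity (u 0) p * radialPrimitive n V p.1 =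
      ∫ τ in (0 : ℝ)..t, ∫ p, V p.1 * planarVorticity (u τ) p * radialComp (u τ) p.1 p.2
        ∂(halfPlaneMeasure n) := by
  obtain ⟨w, w', D, hW, hw, hcurl, hnn, R, hR, hsupp⟩ := hu.exists_planarFlow ht
  have htt : t ∈ Icc 0 t := ⟨ht.1, le_rfl⟩
  have key := hW.integral_planarCurl_mul_radial hR hsupp (hasDerivAt_radialPrimitive n hV)
    (by fun_prop) htt
  simp only [← hcurl t htt, ← hcurl 0 ⟨le_rfl, ht.1⟩] at key
  rw [key]
  refine intervalIntegral.integral_congr fun τ hτ => ?_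
  rw [uIcc_of_le ht.1] at hτ
  simp only [integral_halfPlaneMeasure hu.two_le, ← hcurl τ hτ, hw τ hτ]
  refine integral_congr_ae (.of_forall fun p => ?_)
  simp only [planarField]
  ring

theorem radialPrimitive_one {n : ℕ} (hn : 2 ≤ n) (ρ : ℝ) :
    radialPrimitive n (fun _ => 1) ρ = max ρ 0 ^ n / n := by
  obtain ⟨m, rfl⟩ : ∃ m, n = m + 1 := ⟨n - 1, by omega⟩
  rcases le_total 0 ρ with h | h
  · have e : radialPrimitive (m + 1) (fun _ => 1) ρ = ∫ s in (0 : ℝ)..ρ, s ^ m := by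
      refine intervalIntegral.integral_congr fun s hs => ?_
      rw [uIcc_of_le h] at hs
      simp [max_eq_left hs.1]
    rw [e, integral_pow, max_eq_left h]
    simp
  · have e : radialPrimitive (m + 1) (fun _ => 1) ρ = ∫ s in (0 : ℝ)..ρ, (0 : ℝ) := by
      refine intervalIntegral.integral_congr fun s hs => ?_
      rw [uIcc_of_ge h] at hs
      have : m ≠ 0 := by omega
      simp [max_eq_right hs.2, this]
    rw [e, max_eq_right h]
    simp

/-- Conservation of the impulse. -/
theorem IsVorticalSolution.integral_impulse (hu : IsVorticalSolution n s T u) {t : ℝ}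
    (ht : t ∈ timeInterval T) :
    ∫ p, p.1 * planarVorticity (u t) p ∂(halfPlaneMeasure n) =
      ∫ p, p.1 * planarVorticity (u 0) p ∂(halfPlaneMeasure n) := by
  have hn := hu.two_le
  have key := hu.integral_radialPrimitive_sub ht (V := fun _ => 1) continuous_const
  have h0 : ∫ τ in (0 : ℝ)..t, ∫ p, 1 * planarVorticity (u τ) p * radialComp (u τ) p.1 p.2
      ∂(halfPlaneMeasure n) = ∫ τ in (0 : ℝ)..t, (0 : ℝ) := by
    refine intervalIntegral.integral_congr fun τ hτ => ?_
    rw [uIcc_of_le ht.1] at hτ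
    simp only [one_mul]
    exact (hu.isVorticalField (Icc_subset_timeInterval ht hτ)).integral_mul_radialComp hn
  rw [h0, intervalIntegral.integral_zero, sub_eq_zero] at key
  have e : ∀ v : Euc (n + 1) → Euc (n + 1), ∫ p, p.1 * planarVorticity v p ∂(halfPlaneMeasure n) =
      n * ∫ p : ℝ × ℝ, planarVorticity v p * radialPrimitive n (fun _ => 1) p.1 := fun v => by
    rw [integral_halfPlaneMeasure hn, ← integral_const_mul]
    refine integral_congr_ae (.of_forall fun p => ?_)
    simp only [radialPrimitive_one hn]
    obtain ⟨m, rfl⟩ : ∃ m, n = m + 1 := ⟨n - 1, by omega⟩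
    rw [Nat.add_sub_cancel, pow_succ]
    rcases le_total 0 p.1 with h | h
    · rw [max_eq_left h]; field_simp
    · have : m ≠ 0 := by omega
      rw [max_eq_right h, zero_pow this]; simp
  rw [e, e, key]

/-- The impulse is the norm of `r ω` in `L¹(ℝ^{n+1})`, up to the area of the unit sphere. -/
theorem IsVorticalField.toReal_eLpNorm (hn : 2 ≤ n) {v : Euc (n + 1) → Euc (n + 1)}
    (hv : IsVorticalField n v) :
    (eLpNorm (fun x => rCoord x * vorticityOn v x) 1 (volume : Measure (Euc (n + 1)))).toReal =
      (sphereMeasure n).real univ * ∫ p, p.1 * planarVorticity v p ∂(halfPlaneMeasure n) := by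
  have hc : Continuous fun x => rCoord x * vorticityOn v x :=
    continuous_rCoord.mul hv.continuous_vorticityOn
  have hi : Integrable fun x => rCoord x * vorticityOn v x :=
    hc.integrable_of_hasCompactSupport (hv.hasCompactSupport_vorticityOn hn).mul_left
  have hmp := measurePreserving_cylMap hn
  have hi' : Integrable (fun z => ‖rCoord (cylMap n z) * vorticityOn v (cylMap n z)‖)
      ((halfPlaneMeasure n).prod (sphereMeasure n)) := hmp.integrable_comp_of_integrable hi.norm
  rw [eLpNorm_one_eq_lintegral_enorm, ← integral_norm_eq_lintegral_enorm hi.aestronglyMeasurable,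
    ← hmp.map_eq, integral_map hmp.measurable.aemeasurable
      (by rw [hmp.map_eq]; exact hi.norm.aestronglyMeasurable), integral_prod _ hi', mul_comm,
    ← integral_mul_const]
  refine integral_congr_ae ?_
  filter_upwards [ae_halfPlaneMeasure_pos n] with p hp
  have e : ∀ σ, ‖rCoord (cylMap n (p, σ)) * vorticityOn v (cylMap n (p, σ))‖ =
      p.1 * planarVorticity v p := fun σ => by
    rw [vorticityOn, rCoord_cylMap hn hp.le, zCoord_cylMap, Real.norm_of_nonneg]
    · rfl
    · exact mul_nonneg hp.le (hv.nonneg p hp.le)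
  simp only [e, integral_const, smul_eq_mul]
  ring

theorem measurableSet_outerRegion (r : ℝ) : MeasurableSet (outerRegion r) :=
  (measurableSet_le measurable_const measurable_fst).inter
    (measurableSet_le measurable_const measurable_fst)

theorem IsVorticalField.integrable_vorticity {v : Euc (n + 1) → Euc (n + 1)}
    (hv : IsVorticalField n v) : Integrable (planarVorticity v) :=
  hv.continuous_vorticity.integrable_of_hasCompactSupport hv.hasCompactSupport

theorem IsVorticalSolution.intervalIntegrable_outerMass (hu : IsVorticalSolution n s T u) {t : ℝ}
    (ht : t ∈ timeInterval T) (r : ℝ) :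
    IntervalIntegrable (fun τ => outerMass (u τ) r) volume 0 t := by
  obtain ⟨w, w', D, hW, hw, hcurl, hnn, R, hR, hsupp⟩ := hu.exists_planarFlow ht
  refine ContinuousOn.intervalIntegrable ?_
  rw [uIcc_of_le ht.1]
  have h1 : ContinuousOn (fun τ => ∫ q in outerRegion r, planarCurl (D τ q)) (Icc 0 t) :=
    continuousOn_integral_of_compact_support (isCompact_closedBall 0 R)
      hW.continuous_planarCurl.continuousOn
      fun τ q hτ hq => hsupp τ hτ q (by simpa using hq)
  refine h1.congr fun τ hτ => ?_
  rw [outerMass]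
  exact integral_congr_ae (.of_forall fun q => hcurl τ hτ q)

/-- The initial vorticity vanishes beyond its radial support. -/
theorem IsVorticalSolution.planarVorticity_eq_zero (hu : IsVorticalSolution n s T u) {p : ℝ × ℝ}
    (hp0 : 0 < p.1) (hp : radialSupport (u 0) < p.1) : planarVorticity (u 0) p = 0 := by
  have hd : 3 ≤ n + 1 := by have := hu.two_le; omega
  have hr : rCoord (meridian (n + 1) p.1 p.2) = p.1 := by
    rw [rCoord_meridian hd, abs_of_pos hp0]
  have hon : vorticityOn (u 0) (meridian (n + 1) p.1 p.2) = planarVorticity (u 0) p := by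
    rw [vorticityOn, hr, zCoord_meridian hd, planarVorticity]
  rw [← hon]
  refine image_eq_zero_of_notMem_tsupport fun hm => hp.not_ge ?_
  refine le_csSup ?_ ⟨hp0, _, hm, hr⟩
  refine (hu.hasCompactSupport.isCompact.image continuous_rCoord).bddAbove.mono ?_
  rintro ρ ⟨-, x, hx, rfl⟩
  exact ⟨x, hx, rfl⟩

/-- The growth of the outer mass, in terms of the impulse. The test function is the primitive of
`Λ (ρ - r₁)₊ ρ^{n-1}`, with `Λ` chosen such that it is at least `1` for `ρ ≥ r₂`. -/
theorem IsVorticalSolution.outerMass_le (hu : IsVorticalSolution n s T u) {t r₁ r₂ : ℝ}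
    (ht : t ∈ timeInterval T) (hr₁ : 0 < r₁) (hS : radialSupport (u 0) ≤ r₁) (hr : r₁ < r₂) :
    outerMass (u t) r₂ ≤ 2 * kernelConst n / mollifierMass (n + 1) *
      (∫ p, p.1 * planarVorticity (u 0) p ∂(halfPlaneMeasure n)) / ((r₂ - r₁) ^ 2 * r₁ ^ n) *
        ∫ τ in (0 : ℝ)..t, outerMass (u τ) r₁ := by
  have hn := hu.two_le
  have hκ := mollifierMass_pos (d := n + 1) (by omega)
  have hδ : 0 < r₂ - r₁ := sub_pos.2 hr
  set I := ∫ p, p.1 * planarVorticity (u 0) p ∂(halfPlaneMeasure n) with hI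
  set Λ : ℝ := 2 / (r₁ ^ (n - 1) * (r₂ - r₁) ^ 2) with hΛ
  have hΛ0 : 0 < Λ := by positivity
  set V : ℝ → ℝ := fun ρ => Λ * max (ρ - r₁) 0 with hV
  have hVc : Continuous V := by fun_prop
  have hV0 : ∀ ρ, 0 ≤ V ρ := fun ρ => by positivity
  have hVr : ∀ a, a ≤ r₁ → V a = 0 := fun a ha => by
    rw [hV]; dsimp only; rw [max_eq_right (by linarith), mul_zero]
  have hVl : ∀ a b, |V a - V b| ≤ Λ * |a - b| := fun a b => by
    rw [hV]; dsimp only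
    rw [← mul_sub, abs_mul, abs_of_pos hΛ0]
    refine mul_le_mul_of_nonneg_left ?_ hΛ0.le
    refine (abs_max_sub_max_le_abs _ _ _).trans_eq ?_
    rw [sub_sub_sub_cancel_right]
  set f := radialPrimitive n V with hf
  have hfc := continuous_radialPrimitive n hVc
  have hint : ∀ a b, IntervalIntegrable (fun s => V s * max s 0 ^ (n - 1)) volume a b :=
    fun a b => (by fun_prop : Continuous fun s => V s * max s 0 ^ (n - 1)).intervalIntegrable _ _
  have hf0 : ∀ ρ, ρ ≤ r₁ → f ρ = 0 := fun ρ hρ => by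
    have e : f ρ = ∫ s in (0 : ℝ)..ρ, (0 : ℝ) := by
      refine intervalIntegral.integral_congr fun s hs => ?_
      rw [hVr s (hs.2.trans (max_le hr₁.le hρ)), zero_mul]
    rw [e, intervalIntegral.integral_zero]
  have hfn : ∀ ρ, 0 ≤ f ρ := fun ρ => by
    rcases le_total ρ r₁ with h | h
    · rw [hf0 ρ h]
    · exact intervalIntegral.integral_nonneg (hr₁.le.trans h) fun s _ =>
        mul_nonneg (hV0 s) (by positivity)
  -- `Λ` is such that `∫ Λ (s - r₁) r₁^(n-1) ds = 1` over `[r₁, r₂]`; and `s^(n-1) ≥ r₁^(n-1)`.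
  have hf1 : ∀ ρ, r₂ ≤ ρ → 1 ≤ f ρ := fun ρ hρ => by
    have h1 : ∫ s in r₁..r₂, Λ * (s - r₁) * r₁ ^ (n - 1) = 1 := by
      rw [intervalIntegral.integral_mul_const, intervalIntegral.integral_const_mul,
        intervalIntegral.integral_sub intervalIntegral.intervalIntegrable_id
          intervalIntegrable_const, integral_id,
        intervalIntegral.integral_const, hΛ]
      simp only [smul_eq_mul]
      field_simp
      ring
    have h2 : ∫ s in r₁..r₂, Λ * (s - r₁) * r₁ ^ (n - 1) ≤
        ∫ s in r₁..r₂, V s * max s 0 ^ (n - 1) := by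
      refine intervalIntegral.integral_mono_on hr.le
        ((by fun_prop : Continuous fun s => Λ * (s - r₁) * r₁ ^ (n - 1)).intervalIntegrable _ _)
        (hint _ _) fun s hs => ?_
      have e1 : V s = Λ * (s - r₁) := by
        rw [hV]; dsimp only; rw [max_eq_left (by linarith [hs.1])]
      rw [e1, max_eq_left (hr₁.le.trans hs.1)]
      have := hs.1
      have h3 : 0 ≤ s - r₁ := by linarith
      gcongr
    have h3 : f ρ = f r₁ + ((∫ s in r₁..r₂, V s * max s 0 ^ (n - 1)) +
        ∫ s in r₂..ρ, V s * max s 0 ^ (n - 1)) := by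
      rw [intervalIntegral.integral_add_adjacent_intervals (hint _ _) (hint _ _), hf,
        radialPrimitive, radialPrimitive,
        intervalIntegral.integral_add_adjacent_intervals (hint _ _) (hint _ _)]
    have h4 : 0 ≤ ∫ s in r₂..ρ, V s * max s 0 ^ (n - 1) :=
      intervalIntegral.integral_nonneg hρ fun s _ => mul_nonneg (hV0 s) (by positivity)
    rw [h3, hf0 r₁ le_rfl]
    linarith
  have hvt := hu.isVorticalField ht
  have key := hu.integral_radialPrimitive_sub ht hVc
  -- The test function vanishes on the support of the initial vorticity.
  have hinit : ∫ p : ℝ × ℝ, planarVorticity (u 0) p * f p.1 = 0 := by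
    refine integral_eq_zero_of_ae (.of_forall fun p => ?_)
    rcases le_or_gt p.1 r₁ with h | h
    · simp [hf0 _ h]
    · simp [hu.planarVorticity_eq_zero (hr₁.trans h) (hS.trans_lt h)]
  rw [← hf, hinit, sub_zero] at key
  have hmass : outerMass (u t) r₂ ≤ ∫ p : ℝ × ℝ, planarVorticity (u t) p * f p.1 := by
    rw [outerMass, ← integral_indicator (measurableSet_outerRegion r₂)]
    have hωc := hvt.continuous_vorticity
    refine integral_mono (hvt.integrable_vorticity.indicator (measurableSet_outerRegion r₂))
      (Continuous.integrable_of_hasCompactSupport (by fun_prop) hvt.hasCompactSupport.mul_right)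
      fun p => ?_
    by_cases hp : p ∈ outerRegion r₂
    · rw [indicator_of_mem hp]
      exact le_mul_of_one_le_right (hvt.nonneg p hp.1) (hf1 _ hp.2)
    · rw [indicator_of_notMem hp]
      rcases le_total 0 p.1 with h | h
      · exact mul_nonneg (hvt.nonneg p h) (hfn _)
      · simp [hf0 _ (h.trans hr₁.le)]
  refine hmass.trans ?_
  rw [key]
  have hbi := (hu.intervalIntegrable_outerMass ht r₁).const_mul
    (2 * kernelConst n / mollifierMass (n + 1) * I / ((r₂ - r₁) ^ 2 * r₁ ^ n))
  refine (le_abs_self _).trans ?_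
  rw [← intervalIntegral.integral_const_mul, ← Real.norm_eq_abs]
  refine intervalIntegral.norm_integral_le_of_norm_le ht.1 (.of_forall fun τ hτ => ?_) hbi
  have hτT := Icc_subset_timeInterval ht ⟨hτ.1.le, hτ.2⟩
  have hflux := (hu.isVorticalField hτT).abs_integral_flux_le hn hVc hΛ0.le hr₁ hVr hVl
  rw [hu.integral_impulse hτT, ← hI, mul_comm, ← le_div_iff₀ hκ] at hflux
  refine hflux.trans_eq ?_
  rw [hΛ]
  obtain ⟨m, rfl⟩ : ∃ m, n = m + 1 := ⟨n - 1, by omega⟩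
  rw [Nat.add_sub_cancel, pow_succ]
  field_simp
  ring

end

theorem mainTheorem3 (d : ℕ) (hd : 3 ≤ d) :
    ∃ C : ℝ≥0∞ → ℝ≥0∞ → ℝ → ℝ, (∀ a b S, 0 < C a b S) ∧
      ∀ (s : ℝ) (T : EReal) (u : ℝ → Euc d → Euc d),
        1 + (d : ℝ) / 2 < s → 0 < T →
        IsEulerSolution d s T u →
        (∀ t ∈ timeInterval T, IsAxisymmetricNoSwirl (u t)) →
        (∀ x, 0 ≤ vorticityOn (u 0) x) →
        HasCompactSupport (vorticityOn (u 0)) →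
        MemLp (fun x => vorticityOn (u 0) x / rCoord x ^ (d - 2)) ∞ (volume : Measure (Euc d)) →
        (∀ t ∈ timeInterval T, ∀ r : ℝ, 0 ≤ r →
          IntegrableOn (fun q : ℝ × ℝ => vorticity (u t) q.1 q.2) (outerRegion r)) ∧
        ∀ t ∈ timeInterval T, ∀ r₁ r₂ : ℝ, 0 < r₁ → radialSupport (u 0) ≤ r₁ → r₁ < r₂ →
          IntervalIntegrable (fun τ => outerMass (u τ) r₁) volume 0 t ∧
          outerMass (u t) r₂ ≤
            C (eLpNorm (fun x => rCoord x * vorticityOn (u 0) x) 1 (volume : Measure (Euc d)))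
              (eLpNorm (fun x => vorticityOn (u 0) x / rCoord x ^ (d - 2)) ∞
                (volume : Measure (Euc d)))
              (radialSupport (u 0))
            * r₂ / ((r₂ - r₁) ^ 2 * r₁ ^ d) * ∫ τ in (0 : ℝ)..t, outerMass (u τ) r₁ := by
  obtain ⟨n, rfl⟩ : ∃ n, d = n + 1 := ⟨d - 1, by omega⟩
  have hn : 2 ≤ n := by omega
  have hκ := mollifierMass_pos hd
  have hσ : 0 < (sphereMeasure n).real univ := by
    have : Nonempty (Fin n) := ⟨⟨0, by omega⟩⟩
    have : NeZero (sphereMeasure n) := ⟨Measure.toSphere_ne_zero _⟩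
    exact measureReal_univ_pos
  have hk := kernelConst_nonneg n
  -- Adding `1` makes the constant positive when the impulse is zero.
  refine ⟨fun a _ _ => 2 * kernelConst n / mollifierMass (n + 1) *
    (a.toReal / (sphereMeasure n).real univ) + 1, fun a b S => by positivity, ?_⟩
  intro s T u hs hT hu hax hpos hsupp _
  have hus : IsVorticalSolution n s T u := ⟨hn, hs, hT, hu, hax, hpos, hsupp⟩
  refine ⟨fun t ht r _ => (hus.isVorticalField ht).integrable_vorticity.integrableOn,
    fun t ht r₁ r₂ hr₁ hS hr => ⟨hus.intervalIntegrable_outerMass ht r₁, ?_⟩⟩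
  have h0 : (0 : ℝ) ∈ timeInterval T := ⟨le_rfl, by exact_mod_cast hT⟩
  refine (hus.outerMass_le ht hr₁ hS hr).trans ?_
  dsimp only
  -- `r ω₀` is integrable, so that `toReal` loses nothing.
  rw [(hus.isVorticalField h0).toReal_eLpNorm hn]
  set I := ∫ p, p.1 * planarVorticity (u 0) p ∂(halfPlaneMeasure n) with hI
  have hI0 : 0 ≤ I := by
    refine integral_nonneg_of_ae ?_
    filter_upwards [ae_halfPlaneMeasure_pos n] with p hp
    exact mul_nonneg hp.le ((hus.isVorticalField h0).nonneg p hp.le)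
  have hm0 : 0 ≤ ∫ τ in (0 : ℝ)..t, outerMass (u τ) r₁ :=
    intervalIntegral.integral_nonneg ht.1 fun τ hτ =>
      setIntegral_nonneg (measurableSet_outerRegion r₁) fun q hq =>
        (hus.isVorticalField (Icc_subset_timeInterval ht hτ)).nonneg q hq.1
  have hδ : 0 < r₂ - r₁ := sub_pos.2 hr
  refine mul_le_mul_of_nonneg_right ?_ hm0
  set K := 2 * kernelConst n / mollifierMass (n + 1) * I with hK
  have hK0 : 0 ≤ K := by positivity
  have e1 : 2 * kernelConst n / mollifierMass (n + 1) * ((sphereMeasure n).real univ * I /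
      (sphereMeasure n).real univ) = K := by
    rw [mul_div_cancel_left₀ _ hσ.ne']
  rw [e1, div_le_div_iff₀ (by positivity) (by positivity), pow_succ r₁ n]
  -- The factor `r₂ / r₁` of the claim is at least `1`.
  have h1 : K * r₁ ≤ (K + 1) * r₂ := by nlinarith
  calc K * ((r₂ - r₁) ^ 2 * (r₁ ^ n * r₁)) = K * r₁ * ((r₂ - r₁) ^ 2 * r₁ ^ n) := by ring
    _ ≤ (K + 1) * r₂ * ((r₂ - r₁) ^ 2 * r₁ ^ n) := by gcongr
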